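/- Let $n\ge 0$, let $C^\infty(\mathbb{R}^n)$ be the algebra of complex-valued smooth functions, $\mathcal{W}_0=C^\infty(\mathbb{R}^n)[[p_1,\dots,p_n]]$ and $\mathcal{W}=\mathcal{W}_0[[\lambda]]$ with the Weyl-Moyal product $$a\star b=\mu\circ \exp\Big(\tfrac{i\lambda}{2}\sum_{k=1}^n(\partial_{q^k}\otimes\partial_{p_k}-\partial_{p_k}\otimes\partial_{q^k})\Big)(a\otimes b),$$ where $\mu$ is the commutative multiplication. Regard $\mathcal{W}$ as a $C^\infty(\mathbb{R}^n)$-bimodule by left and right $\star$-multiplication. Let $\mathrm{HC}^k$ be the $\mathbb{C}[[\lambda]]$-module of those $\mathbb{C}$-multilinear maps $\phi:C^\infty(\mathbb{R}^n)^k\to\mathcal{W}$ which are differential, i.e. every coefficient of $\phi$ with respect to the monomials $\lambda^r p^\alpha$ is a multidifferential operator $\sum_I c_I\,\partial^{I_1}f_1\cdots\partial^{I_k}f_k$ (a finite sum, with $c_I\in C^\infty(\mathbb{R}^n)$); respectively of those which are continuous, for the Fréchet topology of $C^\infty(\mathbb{R}^n)$ and the product topology of the coefficients on $\mathcal{W}$.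 Let $$(\delta\phi)(f_0,\dots,f_k)=f_0\star\phi(f_1,\dots,f_k)+\sum_{i=0}^{k-1}(-1)^{i+1}\phi(f_0,\dots,f_if_{i+1},\dots,f_k)+(-1)^{k+1}\phi(f_0,\dots,f_{k-1})\star f_k ,$$ and let $\mathrm{HH}^k$ be the resulting Hochschild cohomology (cocycles in $\mathrm{HC}^k$ modulo $\delta\,\mathrm{HC}^{k-1}$). Let $d_p$ be the exterior derivative with respect to $p_1,\dots,p_n$ on $\mathcal{W}_0\otimes\Lambda^k(\mathbb{R}^n)^*$, the forms $\omega^{i_1\dots i_k}(q,p)\,dp_{i_1}\wedge\dots\wedge dp_{i_k}$ with coefficients not depending on $\lambda$, and let $(\mathcal{W}_0\otimes\Lambda^k(\mathbb{R}^n)^*)_{\mathrm{closed}}$ be the kernel of $d_p$, on which $\mathbb{C}[[\lambda]]$ acts through $\lambda\mapsto 0$. Then, for the differential as well as for the continuous cohomology: 1. $\mathrm{HH}^0\cong C^\infty(\mathbb{R}^n)[[\lambda]]$ as $\mathbb{C}[[\lambda]]$-modules; the degree $0$ cocycles, as elements of $\mathcal{W}$, are the images of the corresponding series under the inclusion $C^\infty(\mathbb{R}^n)[[\lambda]]\subset\mathcal{W}$.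 2. For every $k\ge1$, $\mathrm{HH}^k\cong(\mathcal{W}_0\otimes\Lambda^k(\mathbb{R}^n)^*)_{\mathrm{closed}}$ as $\mathbb{C}[[\lambda]]$-modules. The isomorphism can be chosen to send the class of a cocycle $\phi$ to the form $\omega$ whose value on the basis vectors $e_{i_1},\dots,e_{i_k}$ is $$\omega(e_{i_1},\dots,e_{i_k})=\frac1{k!}\sum_{\sigma\in S_k}\mathrm{sgn}(\sigma)\,\phi(q^{i_{\sigma(1)}},\dots,q^{i_{\sigma(k)}})\big|_{\lambda=0}.$$ 3. Consequently, if $k\ge1$ and $\phi\in\mathrm{HC}^k$ is a cocycle, then $\lambda\phi\in\delta\,\mathrm{HC}^{k-1}$. -/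

import Mathlib

open scoped MvPowerSeries.WithPiTopology PowerSeries.WithPiTopology

noncomputable section

namespace FormalWeyl

/-! ### Smooth functions on `ℝⁿ` -/

/-- The complex algebra of smooth functions `ℝⁿ → ℂ`, with pointwise operations. -/
def smoothSubalgebra (n : ℕ) : Subalgebra ℂ (EuclideanSpace ℝ (Fin n) → ℂ) where
  carrier := {f | ContDiff ℝ (⊤ : ℕ∞) f}
  mul_mem' := fun {f g} (hf : ContDiff ℝ (⊤ : ℕ∞) f) (hg : ContDiff ℝ (⊤ : ℕ∞) g) => hf.mul hg
  add_mem' := fun {f g} (hf : ContDiff ℝ (⊤ : ℕ∞) f) (hg : ContDiff ℝ (⊤ : ℕ∞) g) => hf.add hg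
  algebraMap_mem' := fun c => (contDiff_const : ContDiff ℝ (⊤ : ℕ∞) fun _ => c)

/-- `C^∞(ℝⁿ)`, complex valued. (A type of its own, so that it does not carry the topology of
pointwise convergence.) -/
def Smooth (n : ℕ) : Type := ↥(smoothSubalgebra n)

instance (n : ℕ) : CommRing (Smooth n) := inferInstanceAs (CommRing ↥(smoothSubalgebra n))

instance (n : ℕ) : Algebra ℂ (Smooth n) := inferInstanceAs (Algebra ℂ ↥(smoothSubalgebra n))

/-- The underlying function, as a linear map. -/
def Smooth.eval (n : ℕ) : Smooth n →ₗ[ℂ] (EuclideanSpace ℝ (Fin n) → ℂ) :=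
  (smoothSubalgebra n).val.toLinearMap

theorem Smooth.contDiff {n : ℕ} (f : Smooth n) : ContDiff ℝ (⊤ : ℕ∞) (Smooth.eval n f) := f.2

/-- The coordinate function `q^i`. -/
def coord {n : ℕ} (i : Fin n) : Smooth n :=
  ⟨fun x => ((x i : ℝ) : ℂ), by
    change ContDiff ℝ (⊤ : ℕ∞) fun x : EuclideanSpace ℝ (Fin n) => ((x i : ℝ) : ℂ)
    exact Complex.ofRealCLM.contDiff.comp (EuclideanSpace.proj (𝕜 := ℝ) i).contDiff⟩

/-- The partial derivative `∂/∂q^i` on `C^∞(ℝⁿ)`. -/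
def partialQ {n : ℕ} (i : Fin n) : Module.End ℂ (Smooth n) where
  toFun f := ⟨fun x => fderiv ℝ (Smooth.eval n f) x (EuclideanSpace.single i 1), by
    change ContDiff ℝ (⊤ : ℕ∞) fun x => fderiv ℝ (Smooth.eval n f) x (EuclideanSpace.single i 1)
    exact (f.contDiff.fderiv_right (m := (⊤ : ℕ∞)) (by simp)).clm_apply contDiff_const⟩
  map_add' f g := by
    apply Subtype.ext
    funext x
    change fderiv ℝ (Smooth.eval n f + Smooth.eval n g) x _ = _
    rw [fderiv_add (f.contDiff.differentiable (by simp) x) (g.contDiff.differentiable (by simp) x)]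
    rfl
  map_smul' c f := by
    apply Subtype.ext
    funext x
    change fderiv ℝ (c • Smooth.eval n f) x _ = _
    rw [fderiv_const_smul (f.contDiff.differentiable (by simp) x)]
    rfl

/-- The iterated partial derivative `∂^m = ∂_1^{m_1} ⋯ ∂_n^{m_n}` of a multi-index `m`. -/
def iterPartialQ {n : ℕ} (m : Fin n → ℕ) : Module.End ℂ (Smooth n) :=
  (List.ofFn fun i => partialQ i ^ m i).prod

/-- `∂^m f` as a continuous function. -/
def derivMap {n : ℕ} (m : Fin n → ℕ) (f : Smooth n) : C(EuclideanSpace ℝ (Fin n), ℂ) :=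
  ⟨Smooth.eval n (iterPartialQ m f), (iterPartialQ m f).contDiff.continuous⟩

/-- The Fréchet topology of `C^∞(ℝⁿ)`: uniform convergence on compact sets of all partial
derivatives (`C(_, _)` carries the topology of uniform convergence on compact sets). -/
instance (n : ℕ) : TopologicalSpace (Smooth n) :=
  ⨅ m : Fin n → ℕ, TopologicalSpace.induced (derivMap m) inferInstance

theorem continuous_derivMap {n : ℕ} (m : Fin n → ℕ) : Continuous (derivMap (n := n) m) :=
  continuous_iInf_dom continuous_induced_dom

theorem continuous_of_derivMap {n : ℕ} {X : Type*} [TopologicalSpace X] {g : X → Smooth n}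
    (h : ∀ m, Continuous fun x => derivMap m (g x)) : Continuous g :=
  continuous_iInf_rng.2 fun m => continuous_induced_rng.2 (h m)

instance (n : ℕ) : ContinuousAdd (Smooth n) where
  continuous_add := continuous_of_derivMap fun m => by
    have : (fun x : Smooth n × Smooth n => derivMap m (x.1 + x.2)) =
        fun x => derivMap m x.1 + derivMap m x.2 := by
      funext x
      ext y
      simp [derivMap]
    rw [this]
    exact ((continuous_derivMap m).comp continuous_fst).add
      ((continuous_derivMap m).comp continuous_snd)

instance (n : ℕ) : ContinuousConstSMul ℂ (Smooth n) where
  continuous_const_smul c := continuous_of_derivMap fun m => by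
    have : (fun x : Smooth n => derivMap m (c • x)) = fun x => c • derivMap m x := by
      funext x
      ext y
      simp [derivMap]
    rw [this]
    exact (continuous_derivMap m).const_smul c

/-! ### The formal Weyl algebra -/

/-- `𝓦₀ = C^∞(ℝⁿ)[[p_1, …, p_n]]`. -/
abbrev W₀ (n : ℕ) : Type := MvPowerSeries (Fin n) (Smooth n)

/-- `𝓦 = 𝓦₀[[λ]]`, a module over `ℂ[[λ]]`; the variable `PowerSeries.X` is `λ`. -/
abbrev W (n : ℕ) : Type := PowerSeries (W₀ n)

/-- `∂/∂q^i` on `𝓦₀`, acting on the coefficients. -/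
def dQ {n : ℕ} (i : Fin n) : Module.End ℂ (W₀ n) where
  toFun a := fun α => partialQ i (MvPowerSeries.coeff α a)
  map_add' a b := by
    ext1 α
    change partialQ i (MvPowerSeries.coeff α (a + b)) = _
    rw [map_add, map_add]
    rfl
  map_smul' c a := by
    ext1 α
    change partialQ i (MvPowerSeries.coeff α (c • a)) = _
    exact (partialQ i).map_smul c (MvPowerSeries.coeff α a)

/-- `∂/∂p_i` on `𝓦₀`. -/
def dP {n : ℕ} (i : Fin n) : Module.End ℂ (W₀ n) :=
  (MvPowerSeries.pderiv (Smooth n) i).toLinearMap.restrictScalars ℂ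

open scoped TensorProduct in
/-- `∑_k (∂_{q^k} ⊗ ∂_{p_k} - ∂_{p_k} ⊗ ∂_{q^k})` on `𝓦₀ ⊗ 𝓦₀`. -/
def poissonTensor (n : ℕ) : Module.End ℂ (W₀ n ⊗[ℂ] W₀ n) :=
  ∑ k : Fin n, (TensorProduct.map (dQ k) (dP k) - TensorProduct.map (dP k) (dQ k))

/-- The coefficient of `λ^s` in the Weyl-Moyal product of `a, b ∈ 𝓦₀`:
`(i/2)^s / s! • μ (P^s (a ⊗ b))` with `P` the operator above. -/
def weylCoeff {n : ℕ} (s : ℕ) : W₀ n →ₗ[ℂ] W₀ n →ₗ[ℂ] W₀ n :=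
  TensorProduct.curry
    (((Complex.I / 2) ^ s / (s.factorial : ℂ)) •
      (LinearMap.mul' ℂ (W₀ n) ∘ₗ (poissonTensor n ^ s)))

/-- The Weyl-Moyal star product `a ⋆ b` on `𝓦`, i.e. `μ ∘ exp((iλ/2) P) (a ⊗ b)`,
`λ`-adically extended from `𝓦₀`. -/
def weylStar {n : ℕ} (a b : W n) : W n :=
  PowerSeries.mk fun r =>
    ∑ x ∈ Finset.HasAntidiagonal.antidiagonal r, ∑ y ∈ Finset.HasAntidiagonal.antidiagonal x.2,
      weylCoeff x.1 (PowerSeries.coeff y.1 a) (PowerSeries.coeff y.2 b)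

/-- The inclusion `π^* : C^∞(ℝⁿ)[[λ]] → 𝓦`. -/
def piStar (n : ℕ) : PowerSeries (Smooth n) →+* W n := PowerSeries.map MvPowerSeries.C

/-- The inclusion `C^∞(ℝⁿ) → 𝓦`. -/
def incl {n : ℕ} (f : Smooth n) : W n := piStar n (PowerSeries.C f)

theorem coeff_smul' {n : ℕ} (c : PowerSeries ℂ) (a : W n) (r : ℕ) :
    PowerSeries.coeff r (c • a) = ∑ x ∈ Finset.HasAntidiagonal.antidiagonal r,
      PowerSeries.coeff x.1 c • PowerSeries.coeff x.2 a := by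
  rw [Algebra.smul_def, PowerSeries.coeff_mul]
  refine Finset.sum_congr rfl fun x _ => ?_
  rw [Algebra.smul_def]
  rfl

theorem weylStar_add {n : ℕ} (a b b' : W n) : weylStar a (b + b') = weylStar a b + weylStar a b' := by
  ext1 r
  simp [weylStar, Finset.sum_add_distrib]

theorem add_weylStar {n : ℕ} (a a' b : W n) : weylStar (a + a') b = weylStar a b + weylStar a' b := by
  ext1 r
  simp [weylStar, Finset.sum_add_distrib]

theorem weylStar_smul {n : ℕ} (c : PowerSeries ℂ) (a b : W n) :
    weylStar a (c • b) = c • weylStar a b := by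
  ext1 r
  simp only [weylStar, PowerSeries.coeff_mk, coeff_smul', map_sum, map_smul, Finset.smul_sum,
    Finset.sum_sigma']
  refine Finset.sum_nbij'
    (fun z => ⟨(z.2.2.1, z.1.1 + z.2.1.1 + z.2.2.2), ⟨(z.1.1, z.2.1.1 + z.2.2.2),
      (z.2.1.1, z.2.2.2)⟩⟩)
    (fun z => ⟨(z.2.1.1, z.2.2.1 + z.1.1 + z.2.2.2), ⟨(z.2.2.1, z.1.1 + z.2.2.2),
      (z.1.1, z.2.2.2)⟩⟩) ?_ ?_ ?_ ?_ ?_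
  all_goals
    rintro ⟨⟨a1, a2⟩, ⟨⟨b1, b2⟩, ⟨c1, c2⟩⟩⟩ hz
    simp only [Finset.mem_sigma, Finset.HasAntidiagonal.mem_antidiagonal, Sigma.mk.injEq, heq_eq_eq,
      Prod.mk.injEq, and_true, true_and] at hz ⊢
    try omega

theorem smul_weylStar {n : ℕ} (c : PowerSeries ℂ) (a b : W n) :
    weylStar (c • a) b = c • weylStar a b := by
  ext1 r
  simp only [weylStar, PowerSeries.coeff_mk, coeff_smul', map_sum, map_smul, LinearMap.smul_apply,
    LinearMap.sum_apply, Finset.smul_sum, Finset.sum_sigma']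
  refine Finset.sum_nbij'
    (fun z => ⟨(z.2.2.1, z.1.1 + z.2.2.2 + z.2.1.2), ⟨(z.1.1, z.2.2.2 + z.2.1.2),
      (z.2.2.2, z.2.1.2)⟩⟩)
    (fun z => ⟨(z.2.1.1, z.1.1 + z.2.2.1 + z.2.2.2), ⟨(z.1.1 + z.2.2.1, z.2.2.2),
      (z.1.1, z.2.2.1)⟩⟩) ?_ ?_ ?_ ?_ ?_
  all_goals
    rintro ⟨⟨a1, a2⟩, ⟨⟨b1, b2⟩, ⟨c1, c2⟩⟩⟩ hz
    simp only [Finset.mem_sigma, Finset.HasAntidiagonal.mem_antidiagonal, Sigma.mk.injEq, heq_eq_eq,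
      Prod.mk.injEq, and_true, true_and] at hz ⊢
    try omega

/-! ### Hochschild cochains -/

/-- The two classes of cochains. -/
inductive CochainType
  | differential
  | continuous

/-- `φ` is a formal series (in `p` and `λ`) of multidifferential operators: each coefficient is
of the form `∑_I c_I ∂^{I_1} f_1 ⋯ ∂^{I_k} f_k`, a finite sum with smooth coefficients `c_I`. -/
def IsDifferential {n k : ℕ} (φ : (Fin k → Smooth n) → W n) : Prop :=
  ∀ (r : ℕ) (α : Fin n →₀ ℕ), ∃ c : (Fin k → Fin n → ℕ) →₀ Smooth n,
    ∀ f, MvPowerSeries.coeff α (PowerSeries.coeff r (φ f)) =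
      c.sum fun I a => a * ∏ j, iterPartialQ (I j) (f j)

/-- The regularity required of a cochain. In the continuous case `C^∞(ℝⁿ)` carries its Fréchet
topology and `𝓦 = C^∞(ℝⁿ)[[p]][[λ]]` the product topology of its coefficients. -/
def CochainType.Holds {n k : ℕ} : CochainType → ((Fin k → Smooth n) → W n) → Prop
  | .differential, φ => IsDifferential φ
  | .continuous, φ => Continuous φ

theorem continuous_iff_coeff {n : ℕ} {X : Type*} [TopologicalSpace X] (φ : X → W n) :
    Continuous φ ↔ ∀ r α, Continuous fun x =>
      MvPowerSeries.coeff α (PowerSeries.coeff r (φ x)) := by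
  constructor
  · intro h r α
    exact (MvPowerSeries.WithPiTopology.continuous_coeff (Smooth n) α).comp
      ((PowerSeries.WithPiTopology.continuous_coeff (W₀ n) r).comp h)
  · intro h
    refine continuous_pi fun r => continuous_pi fun α => ?_
    have := h (r ()) α
    convert this using 2 with x
    change _ = φ x (Finsupp.single () (r ())) α
    congr 1
    ext
    simp

/-- `HC^k(C^∞(ℝⁿ), 𝓦)`: the `ℂ`-multilinear maps in `k` arguments that are differential,
respectively continuous. -/
def cochains (t : CochainType) (n k : ℕ) :
    Submodule (PowerSeries ℂ) ((Fin k → Smooth n) → W n) where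
  carrier := {φ | (∃ m : MultilinearMap ℂ (fun _ : Fin k => Smooth n) (W n), ⇑m = φ) ∧ t.Holds φ}
  zero_mem' := by
    refine ⟨⟨0, rfl⟩, ?_⟩
    cases t
    · exact fun r α => ⟨0, fun f => by simp⟩
    · exact continuous_const
  add_mem' := by
    rintro _ _ ⟨⟨m, rfl⟩, hm⟩ ⟨⟨m', rfl⟩, hm'⟩
    refine ⟨⟨m + m', rfl⟩, ?_⟩
    cases t
    · intro r α
      obtain ⟨c, hc⟩ := hm r α
      obtain ⟨c', hc'⟩ := hm' r α
      refine ⟨c + c', fun f => ?_⟩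
      rw [Finsupp.sum_add_index' (by simp) (by simp [add_mul]), ← hc, ← hc']
      simp
    · refine (continuous_iff_coeff _).2 fun r α => ?_
      simp only [Pi.add_apply, map_add]
      exact ((continuous_iff_coeff _).1 hm r α).add ((continuous_iff_coeff _).1 hm' r α)
  smul_mem' := by
    rintro c _ ⟨⟨m, rfl⟩, hm⟩
    refine ⟨⟨⟨fun f => c • m f, fun f i x y => ?_, fun f i d x => ?_⟩, rfl⟩, ?_⟩
    · simp
    · rw [MultilinearMap.map_update_smul, smul_comm]
    cases t
    · intro r α
      choose d hd using fun s => hm s α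
      refine ⟨∑ x ∈ Finset.HasAntidiagonal.antidiagonal r, PowerSeries.coeff x.1 c • d x.2,
        fun f => ?_⟩
      rw [← Finsupp.sum_finsetSum_index (by simp) (by simp [add_mul])]
      simp only [Pi.smul_apply, coeff_smul', map_sum]
      refine Finset.sum_congr rfl fun x _ => ?_
      rw [Finsupp.sum_smul_index' (by simp)]
      have h : MvPowerSeries.coeff α (PowerSeries.coeff x.1 c • PowerSeries.coeff x.2 (m f)) =
        PowerSeries.coeff x.1 c • MvPowerSeries.coeff α (PowerSeries.coeff x.2 (m f)) := rfl
      rw [h, hd, Finsupp.smul_sum]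
      simp
    · refine (continuous_iff_coeff _).2 fun r α => ?_
      simp only [Pi.smul_apply, coeff_smul', map_sum]
      refine continuous_finsetSum _ fun x _ => ?_
      exact ((continuous_iff_coeff _).1 hm x.2 α).const_smul (PowerSeries.coeff x.1 c)

/-- The Hochschild coboundary operator for the bimodule `(𝓦, ⋆)`:
`(δφ)(f_0, …, f_k) = f_0 ⋆ φ(f_1, …, f_k) + ∑_{i<k} (-1)^{i+1} φ(f_0, …, f_i f_{i+1}, …, f_k)
  + (-1)^{k+1} φ(f_0, …, f_{k-1}) ⋆ f_k`. -/
def delta (n k : ℕ) : ((Fin k → Smooth n) → W n) →ₗ[PowerSeries ℂ]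
    ((Fin (k + 1) → Smooth n) → W n) where
  toFun φ := fun f =>
    weylStar (incl (f 0)) (φ (Fin.tail f))
      + ∑ i : Fin k, (-1 : ℤ) ^ ((i : ℕ) + 1) • φ (Fin.contractNth i.castSucc (· * ·) f)
      + (-1 : ℤ) ^ (k + 1) • weylStar (φ (Fin.init f)) (incl (f (Fin.last k)))
  map_add' φ ψ := by
    funext f
    simp only [Pi.add_apply, weylStar_add, add_weylStar, smul_add, Finset.sum_add_distrib]
    abel
  map_smul' c φ := by
    funext f
    simp only [Pi.smul_apply, weylStar_smul, smul_weylStar, smul_add, Finset.smul_sum, RingHom.id_apply]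
    simp only [smul_comm c]

/-- Hochschild cocycles. -/
def cocycles (t : CochainType) (n k : ℕ) :
    Submodule (PowerSeries ℂ) ((Fin k → Smooth n) → W n) :=
  cochains t n k ⊓ LinearMap.ker (delta n k)

/-- Hochschild coboundaries: the images under `δ` of cochains of the same class. -/
def coboundaries (t : CochainType) (n : ℕ) :
    (k : ℕ) → Submodule (PowerSeries ℂ) ((Fin k → Smooth n) → W n)
  | 0 => ⊥
  | k + 1 => (cochains t n k).map (delta n k)

/-- `HH^k(C^∞(ℝⁿ), 𝓦)`: cocycles modulo coboundaries, a `ℂ[[λ]]`-module. -/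
abbrev HH (t : CochainType) (n k : ℕ) : Type :=
  ↥(cocycles t n k) ⧸ (coboundaries t n k).submoduleOf (cocycles t n k)

/-- The cohomology class of a cocycle. -/
def HH.mk {t : CochainType} {n k : ℕ} (φ : cocycles t n k) : HH t n k :=
  Submodule.Quotient.mk φ

/-- The classical limit `cl : 𝓦 → 𝓦₀`, setting `λ = 0`. -/
def cl {n : ℕ} (a : W n) : W₀ n := PowerSeries.constantCoeff a

/-- The value of `Alt (cl φ)` at `(f_1, …, f_k)`. -/
def altCl {n k : ℕ} (φ : (Fin k → Smooth n) → W n) (f : Fin k → Smooth n) : W₀ n :=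
  ((k.factorial : ℂ)⁻¹) • ∑ σ : Equiv.Perm (Fin k), (Equiv.Perm.sign σ : ℤ) • cl (φ (f ∘ σ))

/-! ### Forms in the `p`-directions -/

/-- `𝓦₀ ⊗ Λ^k (ℝⁿ)^*`, as alternating `ℂ`-multilinear maps in `k` arguments from
`ℂⁿ = ℂ ⊗ ℝⁿ` (the complexified space of the variables `p`) to the complex vector space `𝓦₀`;
equivalently, alternating `ℝ`-multilinear maps from `ℝⁿ`. The form `η` has the coefficients `η^{i_1 … i_k} = η (e_{i_1}, …, e_{i_k})`. -/
abbrev Forms (n k : ℕ) : Type := (Fin n → ℂ) [⋀^Fin k]→ₗ[ℂ] W₀ n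

/-- The exterior derivative with respect to the variables `p_1, …, p_n`:
`(d_p η)(v_0, …, v_k) = ∑_j (-1)^j ∂_{v_j} η(v_0, …, v̂_j, …, v_k)`, where
`∂_v = ∑_i v_i ∂/∂p_i`. -/
def extDerivP {n k : ℕ} (η : Forms n k) : Forms n (k + 1) :=
  AlternatingMap.alternatizeUncurryFin
    (∑ i : Fin n, (LinearMap.proj i : (Fin n → ℂ) →ₗ[ℂ] ℂ).smulRight
      ((dP i).compAlternatingMap η))

theorem extDerivP_apply {n k : ℕ} (η : Forms n k) (v : Fin (k + 1) → Fin n → ℂ) :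
    extDerivP η v = ∑ j : Fin (k + 1), (-1 : ℤ) ^ (j : ℕ) •
      ∑ i : Fin n, v j i • dP i (η (j.removeNth v)) := by
  rw [extDerivP, AlternatingMap.alternatizeUncurryFin_apply]
  refine Finset.sum_congr rfl fun j _ => congrArg _ ?_
  rw [LinearMap.sum_apply]
  exact map_sum (⟨⟨fun θ => θ (j.removeNth v), rfl⟩, fun _ _ => rfl⟩ : Forms n k →+ W₀ n) _ _

/-- The kernel of `d_p` on `𝓦₀ ⊗ Λ^k (ℝⁿ)^*`. -/
def closedSubmodule (n k : ℕ) : Submodule ℂ (Forms n k) where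
  carrier := {η | extDerivP η = 0}
  zero_mem' := by
    have : (fun η : Forms n k => extDerivP η) 0 = 0 := by
      ext1 v
      simp [extDerivP_apply]
    exact this
  add_mem' := by
    intro η θ hη hθ
    have h : extDerivP (η + θ) = extDerivP η + extDerivP θ := by
      ext1 v
      simp [extDerivP_apply, Finset.sum_add_distrib]
    change extDerivP (η + θ) = 0
    rw [h, hη, hθ, add_zero]
  smul_mem' := by
    intro c η hη
    have h : extDerivP (c • η) = c • extDerivP η := by
      ext1 v
      simp only [extDerivP_apply, AlternatingMap.smul_apply, map_smul, Finset.smul_sum]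
      refine Finset.sum_congr rfl fun j _ => Finset.sum_congr rfl fun i _ => ?_
      rw [smul_comm c, smul_comm c]
    change extDerivP (c • η) = 0
    have h0 : extDerivP η = 0 := hη
    rw [h, h0]
    exact smul_zero c

/-- `(𝓦₀ ⊗ Λ^k (ℝⁿ)^*)_closed`. -/
def ClosedForms (n k : ℕ) : Type := ↥(closedSubmodule n k)

instance (n k : ℕ) : AddCommGroup (ClosedForms n k) :=
  inferInstanceAs (AddCommGroup ↥(closedSubmodule n k))

instance (n k : ℕ) : Module ℂ (ClosedForms n k) :=
  inferInstanceAs (Module ℂ ↥(closedSubmodule n k))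

/-- Elements of `(𝓦₀ ⊗ Λ^k (ℝⁿ)^*)_closed` do not depend on `λ`: a series `c ∈ ℂ[[λ]]` acts
through its constant term, so that `λ` acts by zero. -/
instance (n k : ℕ) : Module (PowerSeries ℂ) (ClosedForms n k) :=
  Module.compHom (ClosedForms n k) (PowerSeries.constantCoeff (R := ℂ))

/-- The coefficient `η^{i_1 … i_k}` of a closed form. -/
def ClosedForms.component {n k : ℕ} (η : ClosedForms n k) (i : Fin k → Fin n) : W₀ n :=
  (η : ↥(closedSubmodule n k)).1 fun j => Pi.single (i j) 1

end FormalWeyl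

end

noncomputable section

set_option linter.unusedSectionVars false

namespace FormalWeyl

/-! ### Hochschild cochains of a commutative ring, by recursion on the first argument -/

section Algebra

variable {R V : Type*} [CommRing R] [AddCommGroup V]

local infixr:67 " ∷ " => Matrix.vecCons

/-! Left and right `⋆`-multiplication by `f` are `∑ (± iλ/2)^s M_s(f)`, where `M_s(f)` (`moyal`)
contracts the `s`-th derivatives of `f` in `q` with `s` derivatives in `p`. At `λ = 0` both are
multiplication by `f`, so the classical limit of the complex splits, one copy for each `p^α`, into
the Hochschild complex of `C^∞(ℝⁿ)` with values in itself. The proof combines the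
Hochschild-Kostant-Rosenberg theorem for that complex with a first-order computation in `λ`.

The first-order computation rests on two facts. Antisymmetrizing a Hochschild coboundary over its
arguments leaves only commutators `l - r` (`sum_sign_hochschild`), and the `⋆`-commutator with `q^i`
is exactly `iλ ∂/∂p_i` (`coeff_succ_starL_sub_starR`). Hence the form of a coboundary vanishes, and
if `δψ = λφ` then the form of `φ` is `i/(k+1)` times `d_p` of the form of `ψ`
(`altForm_of_delta_eq`). With `φ = 0` this says that forms of cocycles are closed. Conversely, given
a form `ζ`, quantize a multiple of it by products of partial derivatives. The result is a cocycle at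
`λ = 0`, so its coboundary is `λφ` with `φ` a cocycle, and the form of `φ` is `d_p ζ`
(`exists_cocycle_of_exact`). The Poincaré lemma for power series in `p` (`extDerivP_homotopyP`) then
gives surjectivity in positive degree.

For injectivity, let the form of a cocycle `φ` vanish. By HKR its classical limit is a coboundary,
so `φ = δχ + λφ₁`. The form of `φ₁` is closed, hence exact, and can be removed by changing `χ`. So
`φ = δψ + λφ'` with the form of `φ'` zero again (`exists_cohomologous_X_smul`), and iterating
`λ`-adically makes `φ` a coboundary. Since the form only sees `λ = 0`, `λφ` is always a coboundary.
In degree zero, commuting with every `q^i` means not depending on `p`.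

HKR must hold for differential and for continuous cochains alike. Fix a point `x` and pull all
arguments back along the dilations with centre `x`. Differentiating in the factor `s` puts `(q^i -
x^i) ∂_i` on one argument at a time, and this operation is homotopic to inserting `q^i - x^i` into
the cochain and multiplying by `∂_i` of the first argument (`shuffleH_hochschild_add`). Integrating
over `s` from 0 to 1 lowers the degree by one (`exists_decomposition`), and induction reduces every
cocycle to products of derivations. The analytic work is to show that these averages, whose centre
is also the point of evaluation, are again differential or continuous. -/

theorem comp_vecCons {α β : Type*} (D : α → β) {k : ℕ} (a : α) (w : Fin k → α) :
    D ∘ Matrix.vecCons a w = Matrix.vecCons (D a) (D ∘ w) :=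
  funext fun i => by refine Fin.cases ?_ (fun _ => ?_) i <;> rfl

theorem exists_eq_vecCons {α : Type*} {k : ℕ} (f : Fin (k + 1) → α) :
    ∃ a w, f = Matrix.vecCons a w :=
  ⟨_, _, (Matrix.cons_head_tail f).symm⟩

/-- The terms of the Hochschild differential which do not involve the left action. -/
def rho (r : R → V →+ V) : (k : ℕ) → ((Fin k → R) → V) → (Fin (k + 1) → R) → V
  | 0, φ, f => r (f 0) (φ ![])
  | k + 1, φ, f => φ ((f 0 * f 1) ∷ Matrix.vecTail (Matrix.vecTail f)) -
      rho r k (fun w => φ (f 0 ∷ w)) (Matrix.vecTail f)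

/-- The Hochschild differential of a bimodule with left action `l` and right action `r`. -/
def hochschild (l r : R → V →+ V) (k : ℕ) (φ : (Fin k → R) → V) (f : Fin (k + 1) → R) : V :=
  l (f 0) (φ (Matrix.vecTail f)) - rho r k φ f

/-- Alternating sum of the insertions of `u` in all positions. -/
def iota (u : R) : (k : ℕ) → ((Fin (k + 1) → R) → V) → (Fin k → R) → V
  | 0, φ, _ => φ ![u]
  | k + 1, φ, f => φ (u ∷ f) - iota u k (fun w => φ (f 0 ∷ w)) (Matrix.vecTail f)

/-- Apply `D` to all arguments but one, `X` to the remaining one, and insert `u` in all positions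
to the right of the latter. -/
def shuffleH (D X : R → R) (u : R) : (k : ℕ) → ((Fin (k + 1) → R) → V) → (Fin k → R) → V
  | 0, _, _ => 0
  | k + 1, φ, f => iota u k (fun w => φ (X (f 0) ∷ w)) (D ∘ Matrix.vecTail f) -
      shuffleH D X u k (fun w => φ (D (f 0) ∷ w)) (Matrix.vecTail f)

/-- Apply `u * X` to one argument and `D` to the others, and sum. -/
def derivSum (D X : R → R) (u : R) : (k : ℕ) → ((Fin k → R) → V) → (Fin k → R) → V
  | 0, _, _ => 0
  | k + 1, φ, f => φ ((u * X (f 0)) ∷ (D ∘ Matrix.vecTail f)) +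
      derivSum D X u k (fun w => φ (D (f 0) ∷ w)) (Matrix.vecTail f)

/-- Additivity in each argument. -/
def IsMultiAdd {k : ℕ} (φ : (Fin k → R) → V) : Prop :=
  ∀ f j a b, φ (Function.update f j (a + b)) =
    φ (Function.update f j a) + φ (Function.update f j b)

theorem update_vecCons_zero {k : ℕ} (c a : R) (w : Fin k → R) :
    Function.update (c ∷ w) 0 a = a ∷ w :=
  Fin.update_cons_zero (α := fun _ => R) c w a

theorem update_vecCons_succ {k : ℕ} (c a : R) (w : Fin k → R) (j : Fin k) :
    Function.update (c ∷ w) j.succ a = c ∷ Function.update w j a :=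
  (Fin.cons_update (α := fun _ => R) c w j a).symm

theorem IsMultiAdd.vecCons {k : ℕ} {φ : (Fin (k + 1) → R) → V} (h : IsMultiAdd φ) (c : R) :
    IsMultiAdd fun w => φ (c ∷ w) := fun f j a b => by
  have := h (c ∷ f) j.succ a b
  simpa only [update_vecCons_succ] using this

theorem IsMultiAdd.add_vecCons {k : ℕ} {φ : (Fin (k + 1) → R) → V} (h : IsMultiAdd φ) (a b : R)
    (w : Fin k → R) : φ ((a + b) ∷ w) = φ (a ∷ w) + φ (b ∷ w) := by
  have := h (a ∷ w) 0 a b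
  simpa only [update_vecCons_zero] using this

theorem rho_zero (r : R → V →+ V) (φ : (Fin 0 → R) → V) (a : R) (w : Fin 0 → R) :
    rho r 0 φ (a ∷ w) = r a (φ ![]) := rfl

theorem rho_cons (r : R → V →+ V) (k : ℕ) (φ : (Fin (k + 1) → R) → V) (a b : R) (w : Fin k → R) :
    rho r (k + 1) φ (a ∷ b ∷ w) = φ ((a * b) ∷ w) - rho r k (fun w => φ (a ∷ w)) (b ∷ w) := rfl

theorem hochschild_cons (l r : R → V →+ V) (k : ℕ) (φ : (Fin k → R) → V) (a : R) (w : Fin k → R) :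
    hochschild l r k φ (a ∷ w) = l a (φ w) - rho r k φ (a ∷ w) := rfl

theorem iota_cons (u : R) (k : ℕ) (φ : (Fin (k + 2) → R) → V) (a : R) (w : Fin k → R) :
    iota u (k + 1) φ (a ∷ w) = φ (u ∷ a ∷ w) - iota u k (fun w => φ (a ∷ w)) w := rfl

theorem shuffleH_cons (D X : R → R) (u : R) (k : ℕ) (φ : (Fin (k + 2) → R) → V) (a : R)
    (w : Fin k → R) :
    shuffleH D X u (k + 1) φ (a ∷ w) = iota u k (fun w => φ (X a ∷ w)) (D ∘ w) -
      shuffleH D X u k (fun w => φ (D a ∷ w)) w := rfl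

theorem derivSum_cons (D X : R → R) (u : R) (k : ℕ) (φ : (Fin (k + 1) → R) → V) (a : R)
    (w : Fin k → R) :
    derivSum D X u (k + 1) φ (a ∷ w) = φ ((u * X a) ∷ (D ∘ w)) +
      derivSum D X u k (fun w => φ (D a ∷ w)) w := rfl

theorem rho_sub (r : R → V →+ V) (k : ℕ) (φ ψ : (Fin k → R) → V) (f : Fin (k + 1) → R) :
    rho r k (fun w => φ w - ψ w) f = rho r k φ f - rho r k ψ f := by
  induction k with
  | zero => simp [rho]
  | succ k ih => simp only [rho, ih]; abel

theorem rho_map {V' : Type*} [AddCommGroup V'] (r : R → V →+ V) (r' : R → V' →+ V') (T : V →+ V')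
    (h : ∀ a v, T (r a v) = r' a (T v)) (k : ℕ) (φ : (Fin k → R) → V) (f : Fin (k + 1) → R) :
    rho r' k (fun w => T (φ w)) f = T (rho r k φ f) := by
  induction k with
  | zero => simp [rho, h]
  | succ k ih => simp only [rho, ih, map_sub]

theorem hochschild_map {V' : Type*} [AddCommGroup V'] (l r : R → V →+ V) (l' r' : R → V' →+ V')
    (T : V →+ V') (hl : ∀ a v, T (l a v) = l' a (T v)) (hr : ∀ a v, T (r a v) = r' a (T v))
    (k : ℕ) (φ : (Fin k → R) → V) (f : Fin (k + 1) → R) :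
    hochschild l' r' k (fun w => T (φ w)) f = T (hochschild l r k φ f) := by
  rw [hochschild, hochschild, rho_map r r' T hr, map_sub, hl]

theorem rho_comp (r : R → V →+ V) (D : R → R) (hD : ∀ a b, D (a * b) = D a * D b)
    (hr : ∀ a, r (D a) = r a) (k : ℕ) (φ : (Fin k → R) → V) (f : Fin (k + 1) → R) :
    rho r k (fun w => φ (D ∘ w)) f = rho r k φ (D ∘ f) := by
  induction k with
  | zero =>
    obtain ⟨a, w, rfl⟩ := exists_eq_vecCons f
    rw [comp_vecCons, rho_zero, rho_zero, hr]
    congr 2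
    exact Subsingleton.elim _ _
  | succ k ih =>
    obtain ⟨a, w, rfl⟩ := exists_eq_vecCons f
    obtain ⟨b, w, rfl⟩ := exists_eq_vecCons w
    simp only [comp_vecCons, rho_cons, hD]
    rw [ih (fun w => φ (D a ∷ w)), comp_vecCons]

/-- Substituting a multiplicative map that neither action notices is a cochain map. It is used for
dilations about `x`, which do not change values at `x`. -/
theorem hochschild_comp (l r : R → V →+ V) (D : R → R) (hD : ∀ a b, D (a * b) = D a * D b)
    (hl : ∀ a, l (D a) = l a) (hr : ∀ a, r (D a) = r a) (k : ℕ) (φ : (Fin k → R) → V)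
    (f : Fin (k + 1) → R) :
    hochschild l r k (fun w => φ (D ∘ w)) f = hochschild l r k φ (D ∘ f) := by
  obtain ⟨a, w, rfl⟩ := exists_eq_vecCons f
  rw [hochschild_cons, rho_comp r D hD hr]
  simp only [comp_vecCons, hochschild_cons, hl]

/-- The part of the differential without the left action squares to zero by itself. For the full
differential only the interplay with `l` then remains to be checked. -/
theorem rho_rho (r : R → V →+ V) (hr : ∀ a b v, r b (r a v) = r (a * b) v) (k : ℕ)
    (φ : (Fin k → R) → V) (f : Fin (k + 2) → R) : rho r (k + 1) (rho r k φ) f = 0 := by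
  induction k with
  | zero =>
    obtain ⟨a, w, rfl⟩ := exists_eq_vecCons f
    obtain ⟨b, w, rfl⟩ := exists_eq_vecCons w
    simp only [rho_cons, rho_zero, hr, sub_self]
  | succ k ih =>
    obtain ⟨a, w, rfl⟩ := exists_eq_vecCons f
    obtain ⟨b, w, rfl⟩ := exists_eq_vecCons w
    obtain ⟨c, w, rfl⟩ := exists_eq_vecCons w
    have h : (fun w => rho r (k + 1) φ (a ∷ w)) = fun w : Fin (k + 1) → R =>
        φ ((a * w 0) ∷ Matrix.vecTail w) - rho r k (fun w => φ (a ∷ w)) w := by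
      funext w
      obtain ⟨c, w, rfl⟩ := exists_eq_vecCons w
      rfl
    rw [rho_cons, h, rho_sub, ih, rho_cons, rho_cons]
    simp only [Matrix.cons_val_zero, Matrix.tail_cons, mul_assoc]
    abel

theorem hochschild_hochschild (l r : R → V →+ V) (hl : ∀ a b v, l a (l b v) = l (a * b) v)
    (hr : ∀ a b v, r b (r a v) = r (a * b) v) (hlr : ∀ a b v, l a (r b v) = r b (l a v)) (k : ℕ)
    (φ : (Fin k → R) → V) (f : Fin (k + 2) → R) :
    hochschild l r (k + 1) (hochschild l r k φ) f = 0 := by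
  obtain ⟨a, w, rfl⟩ := exists_eq_vecCons f
  obtain ⟨b, w, rfl⟩ := exists_eq_vecCons w
  have h : hochschild l r k φ = fun w : Fin (k + 1) → R =>
      l (w 0) (φ (Matrix.vecTail w)) - rho r k φ w := rfl
  rw [hochschild_cons, h, rho_sub, rho_rho r hr, rho_cons]
  simp only [Matrix.cons_val_zero, Matrix.tail_cons, map_sub, hl]
  rw [rho_map r r (l a) fun b v => hlr a b v]
  abel

theorem iota_sub (u : R) (k : ℕ) (φ ψ : (Fin (k + 1) → R) → V) (f : Fin k → R) :
    iota u k (fun w => φ w - ψ w) f = iota u k φ f - iota u k ψ f := by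
  induction k with
  | zero => simp [iota]
  | succ k ih => simp only [iota, ih]; abel

theorem iota_add (u : R) (k : ℕ) (φ ψ : (Fin (k + 1) → R) → V) (f : Fin k → R) :
    iota u k (fun w => φ w + ψ w) f = iota u k φ f + iota u k ψ f := by
  induction k with
  | zero => simp [iota]
  | succ k ih => simp only [iota, ih]; abel

theorem iota_map {V' : Type*} [AddCommGroup V'] (T : V →+ V') (u : R) (k : ℕ)
    (φ : (Fin (k + 1) → R) → V) (f : Fin k → R) :
    iota u k (fun w => T (φ w)) f = T (iota u k φ f) := by
  induction k with
  | zero => simp [iota]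
  | succ k ih => simp only [iota, ih, map_sub]

theorem shuffleH_sub (D X : R → R) (u : R) (k : ℕ) (φ ψ : (Fin (k + 1) → R) → V) (f : Fin k → R) :
    shuffleH D X u k (fun w => φ w - ψ w) f = shuffleH D X u k φ f - shuffleH D X u k ψ f := by
  induction k with
  | zero => simp [shuffleH]
  | succ k ih => simp only [shuffleH, ih, iota_sub]; abel

theorem shuffleH_map {V' : Type*} [AddCommGroup V'] (T : V →+ V') (D X : R → R) (u : R) (k : ℕ)
    (φ : (Fin (k + 1) → R) → V) (f : Fin k → R) :
    shuffleH D X u k (fun w => T (φ w)) f = T (shuffleH D X u k φ f) := by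
  induction k with
  | zero => simp [shuffleH]
  | succ k ih => simp only [shuffleH, ih, iota_map, map_sub]

theorem rho_vecCons (r : R → V →+ V) (k : ℕ) (φ : (Fin (k + 1) → R) → V) (a : R) :
    (fun w => rho r (k + 1) φ (a ∷ w)) = fun w : Fin (k + 1) → R =>
      φ ((a * w 0) ∷ Matrix.vecTail w) - rho r k (fun w => φ (a ∷ w)) w := by
  funext w
  obtain ⟨c, w, rfl⟩ := exists_eq_vecCons w
  rfl

/-- Each product of `u` with a neighbouring argument occurs twice, once from either side and with
opposite signs, and cancels because `R` is commutative. Only the insertion next to the right action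
survives. -/
theorem iota_rho_add_rho_iota (r : R → V →+ V) (u : R) (k : ℕ) (φ : (Fin (k + 1) → R) → V)
    (f : Fin (k + 1) → R) :
    iota u (k + 1) (rho r (k + 1) φ) f + rho r k (iota u k φ) f = r u (φ f) := by
  induction k with
  | zero =>
    obtain ⟨a, w, rfl⟩ := exists_eq_vecCons f
    obtain rfl : w = ![] := Subsingleton.elim _ _
    rw [iota_cons, rho_cons, rho_zero, rho_zero]
    simp only [iota, rho_cons, rho_zero]
    rw [mul_comm a u]
    abel
  | succ k ih =>
    obtain ⟨a, w, rfl⟩ := exists_eq_vecCons f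
    obtain ⟨b, w, rfl⟩ := exists_eq_vecCons w
    have h1 := ih (fun w => φ (a ∷ w)) (b ∷ w)
    have h2 : (fun w => iota u (k + 1) φ (a ∷ w)) = fun w =>
      φ (u ∷ a ∷ w) - iota u k (fun w => φ (a ∷ w)) w := rfl
    rw [iota_cons, rho_vecCons, rho_cons, rho_cons r k fun w => φ (u ∷ w),
      rho_cons r k (iota u (k + 1) φ), h2,
      iota_sub, rho_sub, iota_cons, iota_cons u k φ (a * b), ← h1]
    simp only [Matrix.cons_val_zero, Matrix.tail_cons]
    rw [mul_comm a u]
    abel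

/-- When `u` acts equally from both sides, insertion anticommutes with the differential, so it sends
cocycles to cocycles. -/
theorem iota_hochschild_add_hochschild_iota (l r : R → V →+ V) (u : R) (k : ℕ)
    (φ : (Fin (k + 1) → R) → V) (f : Fin (k + 1) → R) :
    iota u (k + 1) (hochschild l r (k + 1) φ) f + hochschild l r k (iota u k φ) f =
      l u (φ f) - r u (φ f) := by
  obtain ⟨a, w, rfl⟩ := exists_eq_vecCons f
  have h : hochschild l r (k + 1) φ = fun w : Fin (k + 2) → R =>
      l (w 0) (φ (Matrix.vecTail w)) - rho r (k + 1) φ w := rfl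
  rw [h, iota_sub, hochschild_cons, iota_cons, ← iota_rho_add_rho_iota r u k φ]
  simp only [Matrix.cons_val_zero, Matrix.tail_cons, iota_map]
  abel

/-- The induction peels off the first argument. The Leibniz rule `hX` splits the contraction of the
first two arguments into the two places where `X` can sit; for the first, the insertion identity
applies with `r u = 0`. -/
theorem shuffleH_rho_add (r : R → V →+ V) (D X : R → R) (u : R)
    (hD : ∀ a b, D (a * b) = D a * D b) (hX : ∀ a b, X (a * b) = X a * D b + D a * X b)
    (hr : ∀ a, r (D a) = r a) (hu : r u = 0) (k : ℕ) (φ : (Fin (k + 1) → R) → V)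
    (hφ : IsMultiAdd φ) (f : Fin (k + 1) → R) :
    shuffleH D X u (k + 1) (rho r (k + 1) φ) f + rho r k (shuffleH D X u k φ) f =
      derivSum D X u (k + 1) φ f := by
  induction k with
  | zero =>
    obtain ⟨a, w, rfl⟩ := exists_eq_vecCons f
    obtain rfl : w = ![] := Subsingleton.elim _ _
    rw [shuffleH_cons, derivSum_cons]
    simp only [iota, rho_cons, rho_zero, shuffleH, derivSum, hu, map_zero, AddMonoidHom.zero_apply,
      sub_zero, add_zero, mul_comm u]
    congr 2
    exact Subsingleton.elim _ _
  | succ k ih =>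
    obtain ⟨a, w, rfl⟩ := exists_eq_vecCons f
    obtain ⟨b, w, rfl⟩ := exists_eq_vecCons w
    have h1 := ih (fun w => φ (D a ∷ w)) (hφ.vecCons _) (b ∷ w)
    have h2 : (fun w => shuffleH D X u (k + 1) φ (a ∷ w)) = fun w =>
      iota u k (fun w => φ (X a ∷ w)) (D ∘ w) - shuffleH D X u k (fun w => φ (D a ∷ w)) w := rfl
    -- Since `r u = 0`, insertion of `u` anticommutes with `rho`.
    have h3 := iota_rho_add_rho_iota r u k (fun w => φ (X a ∷ w)) (D ∘ (b ∷ w))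
    rw [hu, AddMonoidHom.zero_apply] at h3
    have h4 : (fun w => φ (X (a * b) ∷ w)) =
        fun w => φ ((X a * D b) ∷ w) + φ ((D a * X b) ∷ w) := by
      funext w
      rw [hX, hφ.add_vecCons]
    rw [shuffleH_cons, rho_vecCons, rho_vecCons, rho_cons, h2, iota_sub, rho_sub, shuffleH_sub,
      derivSum_cons, ← h1, rho_comp r D hD hr, shuffleH_cons (a := a * b), h4, iota_add, hD,
      eq_neg_of_add_eq_zero_left h3, comp_vecCons, iota_cons, shuffleH_cons]
    simp only [Matrix.cons_val_zero, Matrix.tail_cons, mul_comm u]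
    abel

/-- This is the homotopy behind HKR. The left action sees the first argument only, and when that
argument carries `X` it leaves the factor `l (X a)` in front of an insertion into the rest. -/
theorem shuffleH_hochschild_add (l r : R → V →+ V) (D X : R → R) (u : R)
    (hD : ∀ a b, D (a * b) = D a * D b) (hX : ∀ a b, X (a * b) = X a * D b + D a * X b)
    (hl : ∀ a, l (D a) = l a) (hr : ∀ a, r (D a) = r a) (hu : r u = 0) (k : ℕ)
    (φ : (Fin (k + 1) → R) → V) (hφ : IsMultiAdd φ) (a : R) (w : Fin k → R) :
    shuffleH D X u (k + 1) (hochschild l r (k + 1) φ) (a ∷ w) +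
      hochschild l r k (shuffleH D X u k φ) (a ∷ w) =
      l (X a) (iota u k φ (D ∘ w)) - derivSum D X u (k + 1) φ (a ∷ w) := by
  have h : hochschild l r (k + 1) φ = fun w : Fin (k + 2) → R =>
      l (w 0) (φ (Matrix.vecTail w)) - rho r (k + 1) φ w := rfl
  rw [h, shuffleH_sub, hochschild_cons, shuffleH_cons,
    ← shuffleH_rho_add r D X u hD hX hr hu k φ hφ]
  simp only [Matrix.cons_val_zero, Matrix.tail_cons, iota_map, shuffleH_map, hl]
  abel

/-! ### Closed formulas for the recursively defined operations -/

theorem iota_eq_sum (u : R) (k : ℕ) (φ : (Fin (k + 1) → R) → V) (f : Fin k → R) :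
    iota u k φ f = ∑ l : Fin (k + 1), (-1 : ℤ) ^ (l : ℕ) • φ (l.insertNth u f) := by
  induction k with
  | zero =>
    simp [iota, Fin.insertNth_zero']
    congr 1
    ext i; fin_cases i; rfl
  | succ k ih =>
    obtain ⟨a, w, rfl⟩ := exists_eq_vecCons f
    rw [iota_cons, ih, sub_eq_add_neg, ← Finset.sum_neg_distrib]
    conv_rhs => rw [Fin.sum_univ_succ]
    congr 1
    · simp [Fin.insertNth_zero', Matrix.vecCons]
    · refine Finset.sum_congr rfl fun l _ => ?_
      rw [Fin.val_succ, pow_succ, mul_neg_one, neg_smul]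
      congr 3
      exact (Fin.insertNth_succ_cons (α := R) l u a w).symm

theorem derivSum_eq_sum (D X : R → R) (u : R) (k : ℕ) (φ : (Fin k → R) → V) (f : Fin k → R) :
    derivSum D X u k φ f = ∑ j, φ (Function.update (D ∘ f) j (u * X (f j))) := by
  induction k with
  | zero => simp [derivSum]
  | succ k ih =>
    obtain ⟨a, w, rfl⟩ := exists_eq_vecCons f
    rw [derivSum_cons, ih, Fin.sum_univ_succ, comp_vecCons, update_vecCons_zero]
    simp only [update_vecCons_succ, Matrix.cons_val_zero, Matrix.cons_val_succ]

/-- The signs in `shuffleH`. -/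
def shuffleSign : (k : ℕ) → Fin k → Fin (k + 1) → ℤ
  | 0 => fun j => j.elim0
  | k + 1 => Fin.cases (Fin.cases 0 fun l => (-1) ^ (l : ℕ))
      fun j => Fin.cases 0 fun l => -shuffleSign k j l

theorem vecCons_insertNth {k : ℕ} (l : Fin (k + 1)) (a u : R) (w : Fin k → R) :
    (a ∷ (l.insertNth u w : Fin (k + 1) → R)) = l.succ.insertNth u (a ∷ w) :=
  (Fin.insertNth_succ_cons (α := R) l u a w).symm

/-- Regularity and integration over `s` are treated term by term, where only the shape of the terms
matters and not the values of the signs. -/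
theorem shuffleH_eq_sum (D X : R → R) (u : R) (k : ℕ) (φ : (Fin (k + 1) → R) → V) (f : Fin k → R) :
    shuffleH D X u k φ f = ∑ j, ∑ l, shuffleSign k j l •
      φ (l.insertNth u (Function.update (D ∘ f) j (X (f j)))) := by
  induction k with
  | zero => simp [shuffleH]
  | succ k ih =>
    obtain ⟨a, w, rfl⟩ := exists_eq_vecCons f
    rw [shuffleH_cons, ih, iota_eq_sum, comp_vecCons, sub_eq_add_neg, ← Finset.sum_neg_distrib]
    conv_rhs => rw [Fin.sum_univ_succ]
    congr 1
    · conv_rhs => rw [Fin.sum_univ_succ]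
      simp [shuffleSign, vecCons_insertNth, update_vecCons_zero]
    · refine Finset.sum_congr rfl fun j _ => ?_
      rw [← Finset.sum_neg_distrib]
      conv_rhs => rw [Fin.sum_univ_succ]
      simp [shuffleSign, ← vecCons_insertNth, update_vecCons_succ]

theorem contractNth_zero_vecCons {α : Type*} {k : ℕ} (op : α → α → α) (a b : α) (w : Fin k → α) :
    Fin.contractNth 0 op (Matrix.vecCons a (Matrix.vecCons b w)) = Matrix.vecCons (op a b) w := by
  funext i
  refine Fin.cases ?_ (fun i => ?_) i
  · rw [Fin.contractNth_apply_of_eq _ _ _ _ (by simp)]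
    rfl
  · rw [Fin.contractNth_apply_of_gt _ _ _ _ (by simp)]
    rfl

theorem contractNth_succ_vecCons {α : Type*} {k : ℕ} (op : α → α → α) (j : Fin (k + 1)) (a : α)
    (w : Fin (k + 1) → α) :
    Fin.contractNth j.succ op (Matrix.vecCons a w) = Matrix.vecCons a (Fin.contractNth j op w) := by
  funext i
  refine Fin.cases ?_ (fun i => ?_) i
  · rw [Fin.contractNth_apply_of_lt _ _ _ _ (by simp)]
    rfl
  · simp only [Fin.contractNth, Matrix.cons_val_succ, Fin.val_succ, Nat.add_lt_add_iff_right,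
      Nat.add_right_cancel_iff, ← Fin.succ_castSucc]

theorem hochschild_eq_sum (l r : R → V →+ V) (k : ℕ) (φ : (Fin k → R) → V) (f : Fin (k + 1) → R) :
    hochschild l r k φ f = l (f 0) (φ (Fin.tail f))
      + ∑ i : Fin k, (-1 : ℤ) ^ ((i : ℕ) + 1) • φ (Fin.contractNth i.castSucc (· * ·) f)
      + (-1 : ℤ) ^ (k + 1) • r (f (Fin.last k)) (φ (Fin.init f)) := by
  have key : rho r k φ f = -(∑ i : Fin k, (-1 : ℤ) ^ ((i : ℕ) + 1) •
      φ (Fin.contractNth i.castSucc (· * ·) f) +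
      (-1 : ℤ) ^ (k + 1) • r (f (Fin.last k)) (φ (Fin.init f))) := by
    induction k with
    | zero => simp [rho, Subsingleton.elim (Fin.init f) ![]]
    | succ k ih =>
      obtain ⟨a, w, rfl⟩ := exists_eq_vecCons f
      obtain ⟨b, w, rfl⟩ := exists_eq_vecCons w
      have hinit : Fin.init (a ∷ b ∷ w) = a ∷ Fin.init (b ∷ w) := by
        funext i
        refine Fin.cases ?_ (fun i => ?_) i <;> rfl
      have hlast : (a ∷ b ∷ w) (Fin.last (k + 1)) = (b ∷ w) (Fin.last k) := rfl
      rw [rho_cons, ih, Fin.sum_univ_succ, hinit, hlast, Fin.castSucc_zero,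
        contractNth_zero_vecCons]
      simp only [Fin.castSucc_succ, contractNth_succ_vecCons, Fin.val_succ, pow_succ _ (_ + 1),
        mul_neg_one, neg_smul, Finset.sum_neg_distrib]
      simp
      abel
  rw [hochschild, key, sub_neg_eq_add, add_assoc]
  rfl

theorem hochschild_sum {ι : Type*} (s : Finset ι) (l r : R → V →+ V) (k : ℕ)
    (φ : ι → (Fin k → R) → V) (f : Fin (k + 1) → R) :
    hochschild l r k (∑ i ∈ s, φ i) f = ∑ i ∈ s, hochschild l r k (φ i) f := by
  simp only [hochschild_eq_sum, Finset.sum_apply, map_sum, Finset.smul_sum, Finset.sum_add_distrib]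
  rw [Finset.sum_comm]

/-- The alternation of a Hochschild coboundary only involves the commutators `l - r`. -/
theorem sum_sign_hochschild (l r : R → V →+ V) (k : ℕ) (φ : (Fin k → R) → V)
    (f : Fin (k + 1) → R) :
    ∑ σ : Equiv.Perm (Fin (k + 1)), (Equiv.Perm.sign σ : ℤ) • hochschild l r k φ (f ∘ σ) =
      ∑ σ : Equiv.Perm (Fin (k + 1)), (Equiv.Perm.sign σ : ℤ) •
        (l (f (σ 0)) (φ (Fin.tail (f ∘ σ))) - r (f (σ 0)) (φ (Fin.tail (f ∘ σ)))) := by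
  have h1 : ∀ i : Fin k, ∑ σ : Equiv.Perm (Fin (k + 1)), (Equiv.Perm.sign σ : ℤ) •
      φ (Fin.contractNth i.castSucc (· * ·) (f ∘ σ)) = 0 := fun i => by
    -- Exchanging the two arguments that get multiplied changes the sign of the permutation but not
    -- the product.
    refine Finset.sum_involution (fun σ _ => σ * Equiv.swap i.castSucc i.succ) ?_ ?_ ?_ ?_
    · intro σ _
      have hne : i.castSucc ≠ i.succ := (Fin.castSucc_lt_succ).ne
      have : Fin.contractNth i.castSucc (· * ·) (f ∘ ⇑(σ * Equiv.swap i.castSucc i.succ)) =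
          Fin.contractNth i.castSucc (· * ·) (f ∘ σ) := by
        funext j
        rcases lt_trichotomy j i with h | rfl | h
        · rw [Fin.contractNth_apply_of_lt _ _ _ _ (by simpa using h),
            Fin.contractNth_apply_of_lt _ _ _ _ (by simpa using h)]
          simp only [Function.comp_apply, Equiv.Perm.coe_mul]
          rw [Equiv.swap_apply_of_ne_of_ne]
          · simpa using h.ne
          · exact (h.trans_le le_rfl |> fun h => (Fin.castSucc_lt_castSucc_iff.2 h).trans
              Fin.castSucc_lt_succ).ne
        · rw [Fin.contractNth_apply_of_eq _ _ _ _ (by simp),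
            Fin.contractNth_apply_of_eq _ _ _ _ (by simp)]
          simp [mul_comm]
        · rw [Fin.contractNth_apply_of_gt _ _ _ _ (by simpa using h),
            Fin.contractNth_apply_of_gt _ _ _ _ (by simpa using h)]
          simp only [Function.comp_apply, Equiv.Perm.coe_mul]
          rw [Equiv.swap_apply_of_ne_of_ne]
          · exact (Fin.castSucc_lt_succ.trans (Fin.succ_lt_succ_iff.2 h)).ne'
          · simpa using h.ne'
      rw [this, Equiv.Perm.sign_mul, Equiv.Perm.sign_swap hne]
      simp
    · intro σ _ _ h
      have := congrArg Equiv.Perm.sign h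
      rw [Equiv.Perm.sign_mul, Equiv.Perm.sign_swap (Fin.castSucc_lt_succ).ne] at this
      simp at this
    · simp
    · intro σ _
      simp [mul_assoc]
  have h2 : ∑ σ : Equiv.Perm (Fin (k + 1)), (Equiv.Perm.sign σ : ℤ) • ((-1 : ℤ) ^ (k + 1) •
      r ((f ∘ σ) (Fin.last k)) (φ (Fin.init (f ∘ σ)))) =
      ∑ σ : Equiv.Perm (Fin (k + 1)), (Equiv.Perm.sign σ : ℤ) •
        (-r (f (σ 0)) (φ (Fin.tail (f ∘ σ)))) := by
    -- A cyclic rotation turns the last argument into the first. Its sign `(-1)^k` against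
    -- `(-1)^(k+1)` leaves a single minus.
    rw [← Equiv.sum_comp (Equiv.mulRight (finRotate (k + 1)))]
    refine Finset.sum_congr rfl fun σ _ => ?_
    have h3 : Fin.init (f ∘ ⇑(σ * finRotate (k + 1))) = Fin.tail (f ∘ σ) := by
      funext j
      simp only [Fin.init, Fin.tail, Function.comp_apply, Equiv.Perm.coe_mul]
      congr 2
      rw [finRotate_apply]
      simp
    rw [Equiv.coe_mulRight, h3, Equiv.Perm.sign_mul, sign_finRotate]
    simp only [Function.comp_apply, Equiv.Perm.coe_mul, finRotate_last, smul_smul, smul_neg]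
    rw [← neg_smul]
    congr 1
    push_cast
    rw [pow_succ, mul_assoc, ← mul_assoc ((-1) ^ k), ← mul_pow]
    simp
  simp only [hochschild_eq_sum, smul_add, Finset.sum_add_distrib, Finset.smul_sum]
  rw [h2, Finset.sum_comm]
  simp only [smul_comm _ ((-1 : ℤ) ^ _), ← Finset.smul_sum, h1]
  simp [sub_eq_add_neg, Finset.sum_add_distrib]

end Algebra

/-! ### Smooth functions and their partial derivatives -/

section SmoothBasics

variable {n : ℕ}

theorem Smooth.eval_ext {f g : Smooth n} (h : ∀ x, Smooth.eval n f x = Smooth.eval n g x) :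
    f = g :=
  Subtype.ext (funext h)

/-- A smooth function as an element of `Smooth n`. -/
def Smooth.ofFun (f : EuclideanSpace ℝ (Fin n) → ℂ) (hf : ContDiff ℝ (⊤ : ℕ∞) f) : Smooth n :=
  ⟨f, hf⟩

@[simp]
theorem Smooth.eval_ofFun (f : EuclideanSpace ℝ (Fin n) → ℂ) (hf : ContDiff ℝ (⊤ : ℕ∞) f) :
    Smooth.eval n (Smooth.ofFun f hf) = f := rfl

@[simp]
theorem Smooth.eval_mul (f g : Smooth n) (x) :
    Smooth.eval n (f * g) x = Smooth.eval n f x * Smooth.eval n g x := rfl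

@[simp]
theorem Smooth.eval_one (x) : Smooth.eval n 1 x = 1 := rfl

@[simp]
theorem eval_coord (i : Fin n) (x) : Smooth.eval n (coord i) x = ((x i : ℝ) : ℂ) := rfl

/-- Evaluation at a point. -/
def evalAt (x : EuclideanSpace ℝ (Fin n)) : Smooth n →+* ℂ where
  toFun f := Smooth.eval n f x
  map_one' := rfl
  map_mul' _ _ := rfl
  map_zero' := rfl
  map_add' _ _ := rfl

theorem evalAt_apply (x : EuclideanSpace ℝ (Fin n)) (f : Smooth n) :
    evalAt x f = Smooth.eval n f x := rfl

theorem Smooth.differentiableAt (f : Smooth n) (x) : DifferentiableAt ℝ (Smooth.eval n f) x :=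
  f.contDiff.differentiable (by simp) x

theorem eval_partialQ (i : Fin n) (f : Smooth n) (x) : Smooth.eval n (partialQ i f) x =
    fderiv ℝ (Smooth.eval n f) x (EuclideanSpace.single i 1) := rfl

theorem fderiv_eval (f : Smooth n) (x v : EuclideanSpace ℝ (Fin n)) :
    fderiv ℝ (Smooth.eval n f) x v = ∑ i, (v i : ℂ) * Smooth.eval n (partialQ i f) x := by
  conv_lhs => rw [← (EuclideanSpace.basisFun (Fin n) ℝ).sum_repr v]
  rw [map_sum]
  refine Finset.sum_congr rfl fun i _ => ?_
  rw [map_smul, eval_partialQ]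
  simp

@[simp]
theorem partialQ_mul (i : Fin n) (f g : Smooth n) :
    partialQ i (f * g) = partialQ i f * g + f * partialQ i g := by
  refine Smooth.eval_ext fun x => ?_
  have h : Smooth.eval n (f * g) = fun y => Smooth.eval n f y * Smooth.eval n g y := rfl
  rw [map_add, Pi.add_apply, Smooth.eval_mul, Smooth.eval_mul, eval_partialQ, h,
    fderiv_fun_mul (f.differentiableAt x) (g.differentiableAt x)]
  simp [eval_partialQ]
  ring

@[simp]
theorem partialQ_one (i : Fin n) : partialQ i (1 : Smooth n) = 0 := by
  have := partialQ_mul i (1 : Smooth n) 1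
  simpa using this

@[simp]
theorem partialQ_algebraMap (i : Fin n) (c : ℂ) : partialQ i (algebraMap ℂ (Smooth n) c) = 0 := by
  rw [Algebra.algebraMap_eq_smul_one, map_smul, partialQ_one, smul_zero]

theorem partialQ_coord (i j : Fin n) : partialQ i (coord j) = if i = j then 1 else 0 := by
  refine Smooth.eval_ext fun x => ?_
  have h : HasFDerivAt (Smooth.eval n (coord j)) (Complex.ofRealCLM.comp
      (EuclideanSpace.proj j : EuclideanSpace ℝ (Fin n) →L[ℝ] ℝ)) x :=
    (Complex.ofRealCLM.comp (EuclideanSpace.proj j : EuclideanSpace ℝ (Fin n) →L[ℝ] ℝ)).hasFDerivAt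
  rw [eval_partialQ, h.fderiv]
  split_ifs with hij
  · subst hij; simp
  · simp [Ne.symm hij]

theorem partialQ_comm (i j : Fin n) (f : Smooth n) :
    partialQ i (partialQ j f) = partialQ j (partialQ i f) := by
  refine Smooth.eval_ext fun x => ?_
  have key : ∀ (i j : Fin n), Smooth.eval n (partialQ i (partialQ j f)) x =
      fderiv ℝ (fderiv ℝ (Smooth.eval n f)) x (EuclideanSpace.single i 1)
        (EuclideanSpace.single j 1) := fun i j => by
    have hd : DifferentiableAt ℝ (fderiv ℝ (Smooth.eval n f)) x :=
      (f.contDiff.fderiv_right (m := (⊤ : ℕ∞)) (by simp)).differentiable (by simp) x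
    have h : Smooth.eval n (partialQ j f) =
      fun y => fderiv ℝ (Smooth.eval n f) y (EuclideanSpace.single j 1) := rfl
    rw [eval_partialQ, h, fderiv_clm_apply hd (by fun_prop)]
    simp
  rw [key, key]
  have hs : IsSymmSndFDerivAt ℝ (Smooth.eval n f) x :=
    f.contDiff.contDiffAt.isSymmSndFDerivAt (by
      simp only [minSmoothness_of_isRCLikeNormedField]
      exact WithTop.coe_le_coe.2 le_top)
  exact hs _ _

theorem commute_partialQ (i j : Fin n) : Commute (partialQ i) (partialQ j) :=
  LinearMap.ext (partialQ_comm i j)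

theorem iterPartialQ_zero : iterPartialQ (0 : Fin n → ℕ) = 1 := by
  simp [iterPartialQ]

theorem partialQ_iterPartialQ (i : Fin n) (m : Fin n → ℕ) (f : Smooth n) :
    partialQ i (iterPartialQ m f) = iterPartialQ (m + Pi.single i 1) f := by
  -- The product defining `iterPartialQ` is an ordered one in a noncommutative ring. Inside the
  -- submonoid generated by the commuting partial derivatives it may be reordered.
  let S : Set (Module.End ℂ (Smooth n)) := Set.range partialQ
  have hS : ∀ a ∈ S, ∀ b ∈ S, a * b = b * a := by
    rintro _ ⟨i, rfl⟩ _ ⟨j, rfl⟩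
    exact commute_partialQ i j
  have hcomm := Submonoid.isMulCommutative_closure (Module.End ℂ (Smooth n)) hS
  let _ : CommMonoid (Submonoid.closure S) :=
    { (inferInstance : Monoid (Submonoid.closure S)) with mul_comm := hcomm.is_comm.comm }
  let P : Fin n → Submonoid.closure S := fun i => ⟨partialQ i, Submonoid.subset_closure ⟨i, rfl⟩⟩
  have h : ∀ m : Fin n → ℕ, iterPartialQ m = ((∏ i, P i ^ m i : Submonoid.closure S) :
      Module.End ℂ (Smooth n)) := fun m => by
    rw [← List.prod_ofFn, iterPartialQ]
    have := map_list_prod (Submonoid.closure S).subtype (List.ofFn fun i => P i ^ m i)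
    rw [Submonoid.coe_subtype] at this
    refine Eq.trans ?_ this.symm
    rw [List.map_ofFn]
    rfl
  have h2 : P i * ∏ j, P j ^ m j = ∏ j, P j ^ (m + Pi.single i 1 : Fin n → ℕ) j := by
    simp only [Pi.add_apply, pow_add, Finset.prod_mul_distrib]
    rw [mul_comm]
    congr 1
    rw [Finset.prod_eq_single i (fun j _ hj => by simp [hj]) (by simp)]
    simp
  have h3 := congrArg (Subtype.val) h2
  rw [← h] at h3
  rw [← h3]
  have := h m
  change partialQ i (iterPartialQ m f) = (partialQ i * ((∏ i, P i ^ m i : Submonoid.closure S) :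
      Module.End ℂ (Smooth n))) f
  rw [← this]
  rfl

/-! ### Continuity of maps into `Smooth n` -/

/-- Evaluation `C(ℝⁿ, ℂ) × ℝⁿ → ℂ` is continuous because `ℝⁿ` is locally compact. With the converse
`continuous_of_iterPartialQ`, continuity into the Fréchet space becomes joint continuity of all
derivatives. -/
theorem continuous_eval_iterPartialQ {X : Type*} [TopologicalSpace X] {g : X → Smooth n}
    (hg : Continuous g) (m : Fin n → ℕ) :
    Continuous fun z : X × EuclideanSpace ℝ (Fin n) =>
      Smooth.eval n (iterPartialQ m (g z.1)) z.2 := by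
  have h : Continuous fun x => derivMap m (g x) := (continuous_derivMap m).comp hg
  exact continuous_eval.comp ((h.comp continuous_fst).prodMk continuous_snd)

theorem continuous_eval₂ {X : Type*} [TopologicalSpace X] {g : X → Smooth n}
    (hg : Continuous g) {y : X → EuclideanSpace ℝ (Fin n)} (hy : Continuous y) :
    Continuous fun z => Smooth.eval n (g z) (y z) := by
  have := continuous_eval_iterPartialQ hg 0
  simp only [iterPartialQ_zero, Module.End.one_apply] at this
  exact this.comp (continuous_id.prodMk hy)

theorem continuous_of_iterPartialQ {X : Type*} [TopologicalSpace X] {g : X → Smooth n}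
    (h : ∀ m, Continuous fun z : X × EuclideanSpace ℝ (Fin n) =>
      Smooth.eval n (iterPartialQ m (g z.1)) z.2) : Continuous g :=
  continuous_of_derivMap fun m => ContinuousMap.continuous_of_continuous_uncurry _ (h m)

/-- A map into `Smooth n` is continuous if it belongs to a class of jointly continuous maps which
is stable under partial derivatives. -/
theorem continuous_of_class {X : Type*} [TopologicalSpace X] (P : (X → Smooth n) → Prop)
    (hP : ∀ g, P g → Continuous fun z : X × EuclideanSpace ℝ (Fin n) => Smooth.eval n (g z.1) z.2)
    (hd : ∀ g, P g → ∀ i, P fun x => partialQ i (g x)) {g : X → Smooth n} (hg : P g) :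
    Continuous g := by
  refine continuous_of_iterPartialQ fun m => hP (fun x => iterPartialQ m (g x)) ?_
  have key : ∀ L : List (Module.End ℂ (Smooth n)),
      (∀ T ∈ L, ∀ g, P g → P fun x => T (g x)) → ∀ g, P g → P fun x => L.prod (g x) := by
    intro L
    induction L with
    | nil => exact fun _ g hg => hg
    | cons T L ih =>
      intro hL g hg
      rw [List.prod_cons]
      exact hL T (by simp) _ (ih (fun T' hT' => hL T' (by simp [hT'])) g hg)
  refine key _ (fun T hT => ?_) g hg
  obtain ⟨i, rfl⟩ := (List.mem_ofFn' _ _).1 hT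
  dsimp only
  induction m i with
  | zero => exact fun g hg => by simpa using hg
  | succ k ih =>
    intro g hg
    rw [pow_succ]
    exact ih _ (hd g hg i)

theorem continuous_partialQ (i : Fin n) : Continuous (partialQ i : Smooth n → Smooth n) := by
  refine continuous_of_iterPartialQ fun m => ?_
  have : ∀ f, iterPartialQ m (partialQ i f) = iterPartialQ (m + Pi.single i 1) f := fun f => by
    rw [← partialQ_iterPartialQ]
    have : Commute (partialQ i) (iterPartialQ m) := by
      refine Commute.list_prod_right _ _ fun T hT => ?_
      obtain ⟨j, rfl⟩ := (List.mem_ofFn' _ _).1 hT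
      exact (commute_partialQ i j).pow_right _
    exact (congrArg (fun T : Module.End ℂ (Smooth n) => T f) this).symm
  simp only [this]
  exact continuous_eval_iterPartialQ continuous_id _

instance (n : ℕ) : ContinuousMul (Smooth n) where
  continuous_mul := by
    -- Sums of products of continuous maps are jointly continuous and, by the Leibniz rule, stable
    -- under partial derivatives.
    let S : Set (Smooth n × Smooth n → Smooth n) :=
      {g | ∃ a b : Smooth n × Smooth n → Smooth n, Continuous a ∧ Continuous b ∧ g = a * b}
    refine continuous_of_class (fun g => g ∈ AddSubmonoid.closure S) (fun g hg => ?_)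
      (fun g hg i => ?_) (AddSubmonoid.subset_closure ⟨_, _, continuous_fst, continuous_snd, rfl⟩)
    · refine AddSubmonoid.closure_induction (motive := fun g _ => Continuous
        fun z : (Smooth n × Smooth n) × EuclideanSpace ℝ (Fin n) => Smooth.eval n (g z.1) z.2)
        ?_ ?_ ?_ hg
      · rintro _ ⟨a, b, ha, hb, rfl⟩
        exact (continuous_eval₂ (ha.comp continuous_fst) continuous_snd).mul
          (continuous_eval₂ (hb.comp continuous_fst) continuous_snd)
      · simpa using continuous_const
      · intro a b _ _ ha hb
        simp only [Pi.add_apply, map_add]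
        exact ha.add hb
    · refine AddSubmonoid.closure_induction
        (motive := fun g _ => (fun x => partialQ i (g x)) ∈ AddSubmonoid.closure S) ?_ ?_ ?_ hg
      · rintro _ ⟨a, b, ha, hb, rfl⟩
        have : (fun x => partialQ i ((a * b) x)) =
            (fun x => partialQ i (a x)) * b + a * fun x => partialQ i (b x) := by
          funext x
          simp
        rw [this]
        exact add_mem (AddSubmonoid.subset_closure ⟨_, _, (continuous_partialQ i).comp ha, hb, rfl⟩)
          (AddSubmonoid.subset_closure ⟨_, _, ha, (continuous_partialQ i).comp hb, rfl⟩)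
      · simp only [Pi.zero_apply, map_zero]
        exact zero_mem (AddSubmonoid.closure S)
      · intro a b _ _ ha hb
        have : (fun x => partialQ i ((a + b) x)) =
            (fun x => partialQ i (a x)) + fun x => partialQ i (b x) := by
          funext x
          simp
        rw [this]
        exact add_mem ha hb

end SmoothBasics

/-! ### Regular scalar cochains -/

section Regular

variable {n k m : ℕ}

/-- `θ` is linear in each of the arguments in `S` and does not depend on the others. -/
structure IsMultiLin (S : Set (Fin k)) (θ : (Fin k → Smooth n) → Smooth n) : Prop where
  add : ∀ f, ∀ j ∈ S, ∀ a b, θ (Function.update f j (a + b)) =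
    θ (Function.update f j a) + θ (Function.update f j b)
  smul : ∀ f, ∀ j ∈ S, ∀ (c : ℂ) a, θ (Function.update f j (c • a)) = c • θ (Function.update f j a)
  const : ∀ f, ∀ j ∉ S, ∀ a, θ (Function.update f j a) = θ f

open Classical in
/-- The span of the multidifferential operators in the arguments in `S`. -/
def diffOps (n : ℕ) {k : ℕ} (S : Set (Fin k)) :
    Submodule (Smooth n) ((Fin k → Smooth n) → Smooth n) :=
  Submodule.span (Smooth n) (Set.range fun (I : Fin k → Fin n → ℕ) f =>
    ∏ j with j ∈ S, iterPartialQ (I j) (f j))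

/-- Regular maps with values in `C^∞`, multilinear in the arguments in `S` and independent of the
others. -/
def IsRegular (t : CochainType) (S : Set (Fin k)) (θ : (Fin k → Smooth n) → Smooth n) : Prop :=
  match t with
  | .differential => θ ∈ diffOps n S
  | .continuous => IsMultiLin S θ ∧ Continuous θ

namespace IsMultiLin

variable {S T : Set (Fin k)} {θ η : (Fin k → Smooth n) → Smooth n}

theorem zero (S : Set (Fin k)) : IsMultiLin S (0 : (Fin k → Smooth n) → Smooth n) :=
  ⟨by simp, by simp, by simp⟩

theorem const' (c : Smooth n) : IsMultiLin (∅ : Set (Fin k)) fun _ => c :=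
  ⟨by simp, by simp, by simp⟩

theorem add' (hθ : IsMultiLin S θ) (hη : IsMultiLin S η) : IsMultiLin S (θ + η) where
  add f j hj a b := by simp only [Pi.add_apply, hθ.add f j hj, hη.add f j hj]; abel
  smul f j hj c a := by simp only [Pi.add_apply, hθ.smul f j hj, hη.smul f j hj, smul_add]
  const f j hj a := by simp only [Pi.add_apply, hθ.const f j hj, hη.const f j hj]

theorem comp_linear (hθ : IsMultiLin S θ) (T : Module.End ℂ (Smooth n)) :
    IsMultiLin S fun f => T (θ f) where
  add f j hj a b := by simp only [hθ.add f j hj, map_add]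
  smul f j hj c a := by simp only [hθ.smul f j hj, map_smul]
  const f j hj a := by simp only [hθ.const f j hj]

theorem proj (j : Fin k) : IsMultiLin {j} fun f : Fin k → Smooth n => f j where
  add f i hi a b := by obtain rfl := hi; simp
  smul f i hi c a := by obtain rfl := hi; simp
  const f i hi a := by
    rw [Function.update_of_ne]
    rintro rfl
    exact hi rfl

theorem mul (hθ : IsMultiLin S θ) (hη : IsMultiLin T η) (h : Disjoint S T) :
    IsMultiLin (S ∪ T) (θ * η) where
  add f j hj a b := by
    rcases hj with hj | hj
    · have hj' := Set.disjoint_left.1 h hj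
      simp only [Pi.mul_apply, hθ.add f j hj, hη.const f j hj', add_mul]
    · have hj' := Set.disjoint_right.1 h hj
      simp only [Pi.mul_apply, hη.add f j hj, hθ.const f j hj', mul_add]
  smul f j hj c a := by
    rcases hj with hj | hj
    · have hj' := Set.disjoint_left.1 h hj
      simp only [Pi.mul_apply, hθ.smul f j hj, hη.const f j hj', smul_mul_assoc]
    · have hj' := Set.disjoint_right.1 h hj
      simp only [Pi.mul_apply, hη.smul f j hj, hθ.const f j hj', mul_smul_comm]
  const f j hj a := by
    simp only [Set.mem_union, not_or] at hj
    simp only [Pi.mul_apply, hη.const f j hj.2, hθ.const f j hj.1]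

/-- By disjointness a change of one inner argument reaches at most one slot of `φ`, so linearity in
that slot suffices. -/
theorem comp {φ : (Fin k → Smooth n) → Smooth n} (hφ : IsMultiLin Set.univ φ)
    {S : Fin k → Set (Fin m)} (hS : Pairwise (Function.onFun Disjoint S))
    {θ : Fin k → (Fin m → Smooth n) → Smooth n} (hθ : ∀ j, IsMultiLin (S j) (θ j)) :
    IsMultiLin (⋃ j, S j) fun f => φ fun j => θ j f := by
  have key : ∀ f i a j, i ∈ S j → (fun j => θ j (Function.update f i a)) =
      Function.update (fun j => θ j f) j (θ j (Function.update f i a)) := by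
    intro f i a j hi
    funext l
    by_cases hj : l = j
    · subst hj; simp
    · rw [Function.update_of_ne hj,
        (hθ l).const f i fun h => Set.disjoint_left.1 (hS hj) h hi]
  refine ⟨fun f i hi a b => ?_, fun f i hi c a => ?_, fun f i hi a => ?_⟩
  · obtain ⟨j, hj⟩ := Set.mem_iUnion.1 hi
    rw [key _ _ _ j hj, key f i a j hj, key f i b j hj, (hθ j).add f i hj,
      hφ.add _ _ (Set.mem_univ _)]
  · obtain ⟨j, hj⟩ := Set.mem_iUnion.1 hi
    rw [key _ _ _ j hj, key f i a j hj, (hθ j).smul f i hj, hφ.smul _ _ (Set.mem_univ _)]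
  · congr 1
    funext j
    exact (hθ j).const f i (fun h => hi (Set.mem_iUnion.2 ⟨j, h⟩)) a

theorem isMultiAdd (hθ : IsMultiLin Set.univ θ) : IsMultiAdd θ :=
  fun f j a b => hθ.add f j (Set.mem_univ j) a b

/-- The bundled multilinear map. -/
def toMultilinearMap (hθ : IsMultiLin Set.univ θ) :
    MultilinearMap ℂ (fun _ : Fin k => Smooth n) (Smooth n) where
  toFun := θ
  map_update_add' {inst} f j a b := by
    rw [Subsingleton.elim inst (instDecidableEqFin k)]
    exact hθ.add f j (Set.mem_univ j) a b
  map_update_smul' {inst} f j c a := by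
    rw [Subsingleton.elim inst (instDecidableEqFin k)]
    exact hθ.smul f j (Set.mem_univ j) c a

end IsMultiLin

namespace IsRegular

variable {t : CochainType} {S T : Set (Fin k)} {θ η : (Fin k → Smooth n) → Smooth n}

theorem congr_set (hθ : IsRegular t S θ) (h : S = T) : IsRegular t T θ := h ▸ hθ

open Classical in
theorem zero (t : CochainType) (S : Set (Fin k)) :
    IsRegular t S (0 : (Fin k → Smooth n) → Smooth n) := by
  cases t
  · exact zero_mem (diffOps n S)
  · exact ⟨.zero S, continuous_const⟩

open Classical in
theorem add (hθ : IsRegular t S θ) (hη : IsRegular t S η) : IsRegular t S (θ + η) := by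
  cases t
  · exact add_mem (S := Submodule _ _) (s := diffOps n S) hθ hη
  · exact ⟨hθ.1.add' hη.1, hθ.2.add hη.2⟩

theorem sum {ι : Type*} (s : Finset ι) {θ : ι → (Fin k → Smooth n) → Smooth n}
    (h : ∀ i ∈ s, IsRegular t S (θ i)) : IsRegular t S (∑ i ∈ s, θ i) := by
  classical
  induction s using Finset.induction_on with
  | empty => exact .zero t S
  | insert a s ha ih =>
    rw [Finset.sum_insert ha]
    exact (h a (by simp)).add (ih fun i hi => h i (by simp [hi]))

open Classical in
theorem const (t : CochainType) (c : Smooth n) :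
    IsRegular t (∅ : Set (Fin k)) fun _ => c := by
  cases t
  · have : (fun _ : Fin k → Smooth n => c) = c • fun f : Fin k → Smooth n =>
        ∏ j with j ∈ (∅ : Set (Fin k)), iterPartialQ ((0 : Fin k → Fin n → ℕ) j) (f j) := by
      funext f
      simp
    unfold IsRegular
    rw [this]
    exact Submodule.smul_mem _ _ (Submodule.subset_span ⟨0, by simp⟩)
  · exact ⟨.const' c, continuous_const⟩

open Classical in
theorem proj (t : CochainType) (j : Fin k) : IsRegular t {j} fun f : Fin k → Smooth n => f j := by
  cases t
  · refine Submodule.subset_span ⟨0, ?_⟩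
    funext f
    simp [iterPartialQ_zero, Finset.filter_eq']
  · exact ⟨.proj j, continuous_apply j⟩

open Classical in
theorem mul (hθ : IsRegular t S θ) (hη : IsRegular t T η) (h : Disjoint S T) :
    IsRegular t (S ∪ T) (θ * η) := by
  cases t
  · have key : diffOps n S * diffOps n T ≤ diffOps n (S ∪ T) := by
      unfold diffOps
      rw [Submodule.span_mul_span, Submodule.span_le]
      rintro _ ⟨_, ⟨I, rfl⟩, _, ⟨J, rfl⟩, rfl⟩
      -- The two monomials involve disjoint sets of arguments, so their multi-indices can be glued.
      refine Submodule.subset_span ⟨fun j => if j ∈ S then I j else J j, ?_⟩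
      funext f
      simp only [Pi.mul_apply, Finset.prod_filter]
      rw [← Finset.prod_mul_distrib]
      refine Finset.prod_congr rfl fun j _ => ?_
      by_cases hj : j ∈ S
      · simp [hj, Set.disjoint_left.1 h hj]
      · simp [hj]
    exact key (Submodule.mul_mem_mul hθ hη)
  · exact ⟨hθ.1.mul hη.1 h, hθ.2.mul hη.2⟩

theorem mulLeft (c : Smooth n) (hθ : IsRegular t S θ) : IsRegular t S fun f => c * θ f :=
  ((const t c).mul hθ (Set.empty_disjoint S)).congr_set (Set.empty_union S)

theorem smul (c : ℂ) (hθ : IsRegular t S θ) : IsRegular t S (c • θ) := by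
  have : c • θ = fun f => algebraMap ℂ (Smooth n) c * θ f := by
    funext f
    rw [Pi.smul_apply, Algebra.smul_def]
  rw [this]
  exact hθ.mulLeft _

theorem zsmul (c : ℤ) (hθ : IsRegular t S θ) : IsRegular t S (c • θ) := by
  have : c • θ = (c : ℂ) • θ := by rw [Int.cast_smul_eq_zsmul]
  rw [this]
  exact hθ.smul _

theorem sub (hθ : IsRegular t S θ) (hη : IsRegular t S η) : IsRegular t S (θ - η) := by
  rw [sub_eq_add_neg, ← neg_one_zsmul]
  exact hθ.add (hη.zsmul _)

open Classical in
theorem partialQ (i : Fin n) (hθ : IsRegular t S θ) :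
    IsRegular t S fun f => FormalWeyl.partialQ i (θ f) := by
  cases t
  · refine Submodule.span_induction
      (p := fun θ _ => (fun f => FormalWeyl.partialQ i (θ f)) ∈ diffOps n S) ?_ ?_ ?_ ?_ hθ
    · rintro _ ⟨I, rfl⟩
      -- Leibniz rule: the `l`-th summand raises the multi-index of the `l`-th factor.
      have key : ∀ (s : Finset (Fin k)) (f : Fin k → Smooth n),
          FormalWeyl.partialQ i (∏ j ∈ s, iterPartialQ (I j) (f j)) = ∑ l ∈ s, ∏ j ∈ s,
            iterPartialQ (if j = l then I j + Pi.single i 1 else I j) (f j) := by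
        intro s f
        induction s using Finset.induction_on with
        | empty => simp
        | insert a s ha ih =>
          rw [Finset.prod_insert ha, partialQ_mul, ih, Finset.sum_insert ha,
            partialQ_iterPartialQ, Finset.mul_sum, Finset.prod_insert ha, if_pos rfl]
          congr 1
          · congr 1
            refine Finset.prod_congr rfl fun j hj => ?_
            rw [if_neg]
            rintro rfl
            exact ha hj
          · refine Finset.sum_congr rfl fun l hl => ?_
            rw [Finset.prod_insert ha, if_neg]
            rintro rfl
            exact ha hl
      simp only [key]
      have : (fun f : Fin k → Smooth n => ∑ l with l ∈ S, ∏ j with j ∈ S,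
            iterPartialQ (if j = l then I j + Pi.single i 1 else I j) (f j)) =
          ∑ l with l ∈ S, fun f => ∏ j with j ∈ S,
            iterPartialQ (if j = l then I j + Pi.single i 1 else I j) (f j) := by
        funext f
        rw [Finset.sum_apply]
      rw [this]
      exact sum_mem fun l _ => Submodule.subset_span
        ⟨fun j => if j = l then I j + Pi.single i 1 else I j, rfl⟩
    · simp only [Pi.zero_apply, map_zero]
      exact zero_mem (diffOps n S)
    · intro θ η _ _ hθ hη
      simp only [Pi.add_apply, map_add]
      exact add_mem hθ hη
    · intro c θ hθ h
      have : (fun f => FormalWeyl.partialQ i ((c • θ) f)) =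
          (FormalWeyl.partialQ i c) • θ + c • fun f => FormalWeyl.partialQ i (θ f) := by
        funext f
        simp
      rw [this]
      exact add_mem (Submodule.smul_mem _ _ hθ) (Submodule.smul_mem _ _ h)
  · exact ⟨hθ.1.comp_linear _, (continuous_partialQ i).comp hθ.2⟩

theorem iterPartialQ (I : Fin n → ℕ) (hθ : IsRegular t S θ) :
    IsRegular t S fun f => FormalWeyl.iterPartialQ I (θ f) := by
  rw [FormalWeyl.iterPartialQ]
  have key : ∀ L : List (Module.End ℂ (Smooth n)),
      (∀ T ∈ L, ∀ θ : (Fin k → Smooth n) → Smooth n, IsRegular t S θ →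
        IsRegular t S fun x => T (θ x)) → IsRegular t S fun x => L.prod (θ x) := by
    intro L
    induction L with
    | nil => exact fun _ => hθ
    | cons T L ih =>
      intro hL
      rw [List.prod_cons]
      exact hL T (by simp) _ (ih fun T' hT' => hL T' (by simp [hT']))
  refine key _ fun T hT => ?_
  obtain ⟨i, rfl⟩ := (List.mem_ofFn' _ _).1 hT
  dsimp only
  induction I i with
  | zero => exact fun g hg => by simpa using hg
  | succ k ih =>
    intro g hg
    rw [pow_succ]
    exact ih _ (hg.partialQ i)

theorem prod (s : Finset (Fin m)) {T : Fin m → Set (Fin k)}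
    {θ : Fin m → (Fin k → Smooth n) → Smooth n} (hθ : ∀ j, IsRegular t (T j) (θ j))
    (hT : Pairwise (Function.onFun Disjoint T)) :
    IsRegular t (⋃ j ∈ s, T j) (∏ j ∈ s, θ j) := by
  classical
  induction s using Finset.induction_on with
  | empty =>
    exact (const t 1).congr_set (by simp)
  | insert a s ha ih =>
    rw [Finset.prod_insert ha, Finset.set_biUnion_insert]
    refine (hθ a).mul ih ?_
    rw [Set.disjoint_iUnion₂_right]
    intro j hj
    refine hT ?_
    rintro rfl
    exact ha hj

-- Differential cochains are continuous, so the differentiation and integration formulas need proof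
-- in the continuous case only.
open Classical in
theorem of_differential (hθ : IsRegular .differential S θ) : IsRegular .continuous S θ := by
  refine Submodule.span_induction (p := fun θ _ => IsRegular .continuous S θ) ?_ (zero _ _)
    (fun _ _ _ _ => add) (fun c _ _ h => mulLeft c h) hθ
  rintro _ ⟨I, rfl⟩
  have := prod (t := .continuous) (Finset.univ.filter (· ∈ S)) (T := fun j => {j})
    (fun j => (proj .continuous j).iterPartialQ (I j)) (by
      intro i j hij
      simpa [Function.onFun] using hij)
  convert this.congr_set (T := S) (by ext; simp) using 1
  funext f
  simp

theorem continuous_type (hθ : IsRegular t S θ) : IsRegular .continuous S θ := by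
  cases t
  · exact hθ.of_differential
  · exact hθ

theorem isMultiLin (hθ : IsRegular t S θ) : IsMultiLin S θ := hθ.continuous_type.1

theorem continuous (hθ : IsRegular t S θ) : Continuous θ := hθ.continuous_type.2

open Classical in
/-- Composition with regular maps in disjoint sets of arguments. -/
theorem comp' {φ : (Fin k → Smooth n) → Smooth n} (hφ : IsRegular t Set.univ φ)
    {S : Fin k → Set (Fin m)} (hS : Pairwise (Function.onFun Disjoint S))
    {θ : Fin k → (Fin m → Smooth n) → Smooth n} (hθ : ∀ j, IsRegular t (S j) (θ j)) :
    IsRegular t (⋃ j, S j) fun f => φ fun j => θ j f := by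
  cases t
  · refine Submodule.span_induction
      (p := fun φ _ => (fun f => φ fun j => θ j f) ∈ diffOps n (⋃ j, S j)) ?_ ?_ ?_ ?_ hφ
    · rintro _ ⟨I, rfl⟩
      have := prod (t := .differential) Finset.univ (fun j => (hθ j).iterPartialQ (I j)) hS
      have h2 : (∏ j, fun f => FormalWeyl.iterPartialQ (I j) (θ j f)) ∈ diffOps n (⋃ j, S j) :=
        this.congr_set (by ext; simp)
      convert h2 using 1
      funext f
      simp
    · exact zero_mem (diffOps n _)
    · intro φ ψ _ _ hφ hψ
      exact add_mem hφ hψ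
    · intro c φ _ h
      exact Submodule.smul_mem _ c h
  · exact ⟨hφ.1.comp hS fun j => (hθ j).1, hφ.2.comp (continuous_pi fun j => (hθ j).2)⟩

/-- Composition with regular maps whose sets of arguments are the fibres of `π`. -/
theorem comp {φ : (Fin k → Smooth n) → Smooth n} (hφ : IsRegular t Set.univ φ) (π : Fin m → Fin k)
    {θ : Fin k → (Fin m → Smooth n) → Smooth n} (hθ : ∀ j, IsRegular t {i | π i = j} (θ j)) :
    IsRegular t Set.univ fun f => φ fun j => θ j f := by
  refine (hφ.comp' (S := fun j => {i | π i = j}) ?_ hθ).congr_set (by ext; simp)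
  exact fun i j hij => Set.disjoint_left.2 fun l hl hl' => hij (hl.symm.trans hl')

end IsRegular

end Regular

/-! ### Parameter integrals -/

section ParameterIntegrals

variable {n : ℕ}

/-- The linear form with coefficients `c`. -/
def linForm (c : Fin n → ℂ) : EuclideanSpace ℝ (Fin n) →L[ℝ] ℂ :=
  ∑ i, (EuclideanSpace.proj i : EuclideanSpace ℝ (Fin n) →L[ℝ] ℝ).smulRight (c i)

theorem linForm_apply (c : Fin n → ℂ) (v : EuclideanSpace ℝ (Fin n)) :
    linForm c v = ∑ i, (v i : ℂ) * c i := by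
  simp [linForm]

theorem linForm_single (c : Fin n → ℂ) (i : Fin n) :
    linForm c (EuclideanSpace.single i 1) = c i := by
  rw [linForm_apply, Finset.sum_eq_single i (fun j _ hj => by simp [hj]) (by simp)]
  simp

theorem continuous_linForm {X : Type*} [TopologicalSpace X] {c : X → Fin n → ℂ}
    (hc : Continuous c) : Continuous fun x => linForm (c x) := by
  unfold linForm
  refine continuous_finsetSum _ fun i _ => ?_
  exact ((ContinuousLinearMap.smulRightL ℝ (EuclideanSpace ℝ (Fin n)) ℂ
    (EuclideanSpace.proj i)).continuous).comp ((continuous_apply i).comp hc)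

theorem hasFDerivAt_eval (f : Smooth n) (x : EuclideanSpace ℝ (Fin n)) :
    HasFDerivAt (Smooth.eval n f) (linForm fun i => Smooth.eval n (partialQ i f) x) x := by
  refine (f.differentiableAt x).hasFDerivAt.congr_fderiv (ContinuousLinearMap.ext fun v => ?_)
  rw [linForm_apply, fderiv_eval]

/-- A function is smooth if it belongs to a class of functions stable under partial derivatives. -/
theorem contDiff_of_class (P : (EuclideanSpace ℝ (Fin n) → ℂ) → Prop)
    (hP : ∀ f, P f → ∃ c : Fin n → EuclideanSpace ℝ (Fin n) → ℂ,
      (∀ i, P (c i)) ∧ ∀ x, HasFDerivAt f (linForm fun i => c i x) x)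
    {f : EuclideanSpace ℝ (Fin n) → ℂ} (hf : P f) : ContDiff ℝ (⊤ : ℕ∞) f := by
  refine contDiff_infty.2 fun m => ?_
  induction m generalizing f with
  | zero =>
    obtain ⟨c, -, h⟩ := hP f hf
    exact contDiff_zero.2 (continuous_iff_continuousAt.2 fun x => (h x).continuousAt)
  | succ m ih =>
    obtain ⟨c, hc, h⟩ := hP f hf
    have h1 : ContDiff ℝ m fun x => linForm fun i => c i x := by
      unfold linForm
      refine ContDiff.sum fun i _ => ?_
      exact ((ContinuousLinearMap.smulRightL ℝ (EuclideanSpace ℝ (Fin n)) ℂ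
        (EuclideanSpace.proj i)).contDiff).comp (ih (hc i))
    exact_mod_cast contDiff_succ_iff_hasFDerivAt.2 ⟨_, h1, h⟩

theorem hasFDerivAt_integral_linForm {F : EuclideanSpace ℝ (Fin n) → ℝ → ℂ}
    {c : Fin n → EuclideanSpace ℝ (Fin n) → ℝ → ℂ} (hF : Continuous (Function.uncurry F))
    (hc : ∀ i, Continuous (Function.uncurry (c i)))
    (h : ∀ x r, HasFDerivAt (fun x => F x r) (linForm fun i => c i x r) x)
    (x : EuclideanSpace ℝ (Fin n)) :
    HasFDerivAt (fun x => ∫ r in (0 : ℝ)..1, F x r)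
      (linForm fun i => ∫ r in (0 : ℝ)..1, c i x r) x := by
  have hF' : Continuous (Function.uncurry fun (x : EuclideanSpace ℝ (Fin n)) r =>
      linForm fun i => c i x r) := continuous_linForm (continuous_pi hc)
  -- The derivative is jointly continuous, hence bounded on a ball times `[0, 1]`. This constant is
  -- the dominating function.
  obtain ⟨C, hC⟩ := ((isCompact_closedBall x 1).prod (isCompact_Icc (a := (0 : ℝ)) (b := 1))
    ).exists_bound_of_continuousOn hF'.continuousOn
  have hcont : ∀ y, Continuous (F y) := fun y => hF.comp (by fun_prop : Continuous fun r => (y, r))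
  have := (intervalIntegral.hasFDerivAt_integral_of_dominated_of_fderiv_le (𝕜 := ℝ)
    (μ := MeasureTheory.volume) (a := 0) (b := 1) (F := F)
    (F' := fun x r => linForm fun i => c i x r) (bound := fun _ => C)
    (Metric.closedBall_mem_nhds x one_pos)
    (Filter.Eventually.of_forall fun y => (hcont y).aestronglyMeasurable)
    ((hcont x).intervalIntegrable _ _)
    (hF'.comp (by fun_prop : Continuous fun r : ℝ => (x, r))).aestronglyMeasurable
    (Filter.Eventually.of_forall fun r hr y hy => hC (y, r) ⟨hy, by
      rw [Set.uIoc_of_le zero_le_one] at hr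
      exact ⟨hr.1.le, hr.2⟩⟩)
    intervalIntegrable_const (Filter.Eventually.of_forall fun r _ y _ => h y r))
  refine this.congr_fderiv (ContinuousLinearMap.ext fun v => ?_)
  have hcc : ∀ i, Continuous fun r => c i x r := fun i =>
    (hc i).comp (by fun_prop : Continuous fun r : ℝ => (x, r))
  have happ := ContinuousLinearMap.intervalIntegral_apply (μ := MeasureTheory.volume)
    ((hF'.comp (by fun_prop : Continuous fun r : ℝ => (x, r))).intervalIntegrable 0 1) v
  simp only [Function.comp_def, Function.uncurry_def] at happ
  rw [happ]
  simp only [linForm_apply]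
  rw [intervalIntegral.integral_finsetSum fun i _ => Continuous.intervalIntegrable (by
    have := hcc i
    fun_prop) 0 1]
  simp only [intervalIntegral.integral_const_mul]

/-- `y ↦ ∫₀¹ w(r) g(a(r) y + b(r)) dr`. -/
def kernelFun (w a : C(ℝ, ℝ)) (b : C(ℝ, EuclideanSpace ℝ (Fin n))) (g : Smooth n)
    (y : EuclideanSpace ℝ (Fin n)) : ℂ :=
  ∫ r in (0 : ℝ)..1, (w r : ℂ) * Smooth.eval n g (a r • y + b r)

/-- The chain rule brings out one factor `a(r)`, which the weight absorbs. The integrals therefore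
form a class closed under partial derivatives, and this yields both their smoothness and their
continuous dependence on the data. -/
theorem hasFDerivAt_kernelFun (w a : C(ℝ, ℝ)) (b : C(ℝ, EuclideanSpace ℝ (Fin n))) (g : Smooth n)
    (y : EuclideanSpace ℝ (Fin n)) : HasFDerivAt (kernelFun w a b g)
      (linForm fun i => kernelFun (w * a) a b (partialQ i g) y) y := by
  have hcont : ∀ g : Smooth n, Continuous (Smooth.eval n g) := fun g => g.contDiff.continuous
  refine hasFDerivAt_integral_linForm
    (F := fun y r => (w r : ℂ) * Smooth.eval n g (a r • y + b r))
    (c := fun i y r => ((w * a) r : ℂ) * Smooth.eval n (partialQ i g) (a r • y + b r)) ?_ ?_ ?_ y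
  · have := hcont g
    simp only [Function.uncurry_def]
    fun_prop
  · intro i
    have := hcont (partialQ i g)
    simp only [Function.uncurry_def]
    fun_prop
  · intro y r
    have h1 : HasFDerivAt (fun y : EuclideanSpace ℝ (Fin n) => a r • y + b r)
        (a r • ContinuousLinearMap.id ℝ _) y := ((hasFDerivAt_id y).const_smul (a r)).add_const _
    have h2 := ((hasFDerivAt_eval g (a r • y + b r)).comp y h1).const_mul (w r : ℂ)
    refine h2.congr_fderiv (ContinuousLinearMap.ext fun v => ?_)
    simp only [smul_apply, ContinuousLinearMap.comp_apply, linForm_apply,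
      ContinuousLinearMap.id_apply, smul_eq_mul, Finset.mul_sum, PiLp.smul_apply]
    refine Finset.sum_congr rfl fun i _ => ?_
    simp
    ring

theorem contDiff_kernelFun (w a : C(ℝ, ℝ)) (b : C(ℝ, EuclideanSpace ℝ (Fin n))) (g : Smooth n) :
    ContDiff ℝ (⊤ : ℕ∞) (kernelFun w a b g) :=
  contDiff_of_class (fun f => ∃ w g, f = kernelFun w a b g) (by
    rintro _ ⟨w, g, rfl⟩
    exact ⟨fun i => kernelFun (w * a) a b (partialQ i g), fun i => ⟨_, _, rfl⟩,
      hasFDerivAt_kernelFun w a b g⟩) ⟨w, g, rfl⟩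

/-- `kernelFun` as an element of `Smooth n`. -/
def kernel (w a : C(ℝ, ℝ)) (b : C(ℝ, EuclideanSpace ℝ (Fin n))) (g : Smooth n) : Smooth n :=
  .ofFun (kernelFun w a b g) (contDiff_kernelFun w a b g)

theorem eval_kernel (w a : C(ℝ, ℝ)) (b : C(ℝ, EuclideanSpace ℝ (Fin n))) (g : Smooth n) (y) :
    Smooth.eval n (kernel w a b g) y =
      ∫ r in (0 : ℝ)..1, (w r : ℂ) * Smooth.eval n g (a r • y + b r) := rfl

theorem partialQ_kernel (w a : C(ℝ, ℝ)) (b : C(ℝ, EuclideanSpace ℝ (Fin n))) (g : Smooth n)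
    (i : Fin n) : partialQ i (kernel w a b g) = kernel (w * a) a b (partialQ i g) := by
  refine Smooth.eval_ext fun y => ?_
  rw [eval_partialQ]
  change fderiv ℝ (kernelFun w a b g) y _ = _
  rw [(hasFDerivAt_kernelFun w a b g y).fderiv, linForm_single]
  rfl

theorem continuous_kernel {X : Type*} [TopologicalSpace X] {w a : X → C(ℝ, ℝ)}
    {b : X → C(ℝ, EuclideanSpace ℝ (Fin n))} {g : X → Smooth n} (hw : Continuous w)
    (ha : Continuous a) (hb : Continuous b) (hg : Continuous g) :
    Continuous fun x => kernel (w x) (a x) (b x) (g x) := by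
  refine continuous_of_class (fun G => ∃ (w : X → C(ℝ, ℝ)) (g : X → Smooth n), Continuous w ∧
    Continuous g ∧ G = fun x => kernel (w x) (a x) (b x) (g x)) ?_ ?_ ⟨w, g, hw, hg, rfl⟩
  · rintro _ ⟨w, g, hw, hg, rfl⟩
    simp only [eval_kernel]
    refine intervalIntegral.continuous_parametric_intervalIntegral_of_continuous' ?_ 0 1
    simp only [Function.uncurry_def]
    refine Continuous.mul (by fun_prop) (continuous_eval₂ (by fun_prop) (by fun_prop))
  · rintro _ ⟨w, g, hw, hg, rfl⟩ i
    refine ⟨fun x => w x * a x, fun x => partialQ i (g x), hw.mul ha,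
      (continuous_partialQ i).comp hg, ?_⟩
    funext x
    exact partialQ_kernel _ _ _ _ i

/-- Hadamard's lemma. -/
theorem eval_add (f : Smooth n) (z v : EuclideanSpace ℝ (Fin n)) :
    Smooth.eval n f (z + v) = Smooth.eval n f z +
      ∑ i, (v i : ℂ) * ∫ r in (0 : ℝ)..1, Smooth.eval n (partialQ i f) (z + r • v) := by
  have hcont : ∀ g : Smooth n, Continuous (Smooth.eval n g) := fun g => g.contDiff.continuous
  have hd : ∀ r : ℝ, HasDerivAt (fun r : ℝ => Smooth.eval n f (z + r • v))
      (∑ i, (v i : ℂ) * Smooth.eval n (partialQ i f) (z + r • v)) r := fun r => by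
    have h1 : HasDerivAt (fun r : ℝ => z + r • v) v r := by
      simpa using ((hasDerivAt_id r).smul_const v).const_add z
    have := (hasFDerivAt_eval f (z + r • v)).comp_hasDerivAt r h1
    rwa [linForm_apply] at this
  have h := intervalIntegral.integral_eq_sub_of_hasDerivAt (fun r _ => hd r)
    (Continuous.intervalIntegrable (by
      have := fun i => hcont (partialQ i f)
      fun_prop) 0 1)
  rw [intervalIntegral.integral_finsetSum fun i _ => Continuous.intervalIntegrable (by
      have := hcont (partialQ i f)
      fun_prop) 0 1] at h
  simp only [intervalIntegral.integral_const_mul, one_smul, zero_smul, add_zero] at h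
  rw [h]
  ring

end ParameterIntegrals

/-! ### Dilations -/

section Dilations

variable {n k : ℕ}

/-- Pullback along the dilation with centre `x` and factor `s`. -/
def dil (s : ℝ) (x : EuclideanSpace ℝ (Fin n)) : Smooth n →ₐ[ℂ] Smooth n where
  toFun f := .ofFun (fun y => Smooth.eval n f (s • y + (1 - s) • x))
    (f.contDiff.comp ((contDiff_id.const_smul s).add contDiff_const))
  map_one' := rfl
  map_mul' _ _ := rfl
  map_zero' := rfl
  map_add' _ _ := rfl
  commutes' _ := rfl

theorem eval_dil (s : ℝ) (x : EuclideanSpace ℝ (Fin n)) (f : Smooth n) (y) :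
    Smooth.eval n (dil s x f) y = Smooth.eval n f (s • y + (1 - s) • x) := rfl

theorem eval_dil_self (s : ℝ) (x : EuclideanSpace ℝ (Fin n)) (f : Smooth n) :
    Smooth.eval n (dil s x f) x = Smooth.eval n f x := by
  rw [eval_dil, ← add_smul]
  simp

theorem dil_one (x : EuclideanSpace ℝ (Fin n)) (f : Smooth n) : dil 1 x f = f :=
  Smooth.eval_ext fun y => by simp [eval_dil]

theorem dil_zero (x : EuclideanSpace ℝ (Fin n)) (f : Smooth n) :
    dil 0 x f = algebraMap ℂ (Smooth n) (Smooth.eval n f x) :=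
  Smooth.eval_ext fun y => by
    simp only [eval_dil, zero_smul, sub_zero, one_smul, zero_add]
    rfl

/-- The integrand does not depend on the variable of integration. The point is to inherit continuity
and derivatives from `kernel`. -/
theorem dil_eq_kernel (s : ℝ) (x : EuclideanSpace ℝ (Fin n)) (f : Smooth n) :
    dil s x f = kernel 1 (.const _ s) (.const _ ((1 - s) • x)) f :=
  Smooth.eval_ext fun y => by simp [eval_kernel, eval_dil]

/-- A continuous function of two variables as a continuous family of functions. -/
theorem continuous_curry {X Y Z : Type*} [TopologicalSpace X] [TopologicalSpace Y]
    [TopologicalSpace Z] {F : X → C(Y, Z)} (h : Continuous fun z : X × Y => F z.1 z.2) :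
    Continuous F :=
  ContinuousMap.continuous_of_continuous_uncurry _ h

theorem continuous_dil {X : Type*} [TopologicalSpace X] {s : X → ℝ}
    {x : X → EuclideanSpace ℝ (Fin n)} {f : X → Smooth n} (hs : Continuous s) (hx : Continuous x)
    (hf : Continuous f) : Continuous fun z => dil (s z) (x z) (f z) := by
  simp only [dil_eq_kernel]
  refine continuous_kernel continuous_const (continuous_curry ?_) (continuous_curry ?_) hf
  · simp only [ContinuousMap.const_apply]
    fun_prop
  · simp only [ContinuousMap.const_apply]
    fun_prop

/-- The difference quotients of `x ↦ dil s x f`. -/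
def quotCenter (s : ℝ) (x h : EuclideanSpace ℝ (Fin n)) (f : Smooth n) (i : Fin n) : Smooth n :=
  kernel (.const _ (1 - s)) (.const _ s) ⟨fun r => (1 - s) • (x + r • h), by fun_prop⟩
    (partialQ i f)

/-- Hadamard's lemma along the displacement `(1 - s)h`. The increment is an exact combination of
smooth functions continuous in `h`, so a continuous multilinear map can be applied to it before
passing to the limit. -/
theorem dil_add_center (s : ℝ) (x h : EuclideanSpace ℝ (Fin n)) (f : Smooth n) :
    dil s (x + h) f = dil s x f + ∑ i, (h i : ℂ) • quotCenter s x h f i := by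
  refine Smooth.eval_ext fun y => ?_
  have h1 : s • y + (1 - s) • (x + h) = (s • y + (1 - s) • x) + (1 - s) • h := by
    rw [smul_add, add_assoc]
  rw [eval_dil, h1, eval_add]
  simp only [map_add, map_sum, map_smul, Pi.add_apply, Finset.sum_apply, Pi.smul_apply, smul_eq_mul,
    quotCenter, eval_kernel, eval_dil, ContinuousMap.const_apply, ContinuousMap.coe_mk,
    intervalIntegral.integral_const_mul]
  congr 1
  refine Finset.sum_congr rfl fun i _ => ?_
  have h2 : ∀ r : ℝ, s • y + (1 - s) • (x + r • h) = s • y + (1 - s) • x + r • (1 - s) • h :=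
    fun r => by rw [smul_add, smul_comm r, add_assoc]
  simp only [h2, PiLp.smul_apply, smul_eq_mul]
  push_cast
  ring

theorem quotCenter_zero (s : ℝ) (x : EuclideanSpace ℝ (Fin n)) (f : Smooth n) (i : Fin n) :
    quotCenter s x 0 f i = ((1 - s : ℝ) : ℂ) • dil s x (partialQ i f) :=
  Smooth.eval_ext fun y => by simp [quotCenter, eval_kernel, eval_dil]

theorem continuous_quotCenter (s : ℝ) (x : EuclideanSpace ℝ (Fin n)) (f : Smooth n) (i : Fin n) :
    Continuous fun h => quotCenter s x h f i := by
  refine continuous_kernel continuous_const continuous_const (continuous_curry ?_) continuous_const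
  simp only [ContinuousMap.coe_mk]
  fun_prop

/-- The difference quotients of `s ↦ dil s x f`. -/
def quotFactor (s : ℝ) (x : EuclideanSpace ℝ (Fin n)) (h : ℝ) (f : Smooth n) (i : Fin n) :
    Smooth n :=
  kernel 1 ⟨fun r => s + r * h, by fun_prop⟩ ⟨fun r => (1 - (s + r * h)) • x, by fun_prop⟩
    (partialQ i f)

/-- Changing the factor by `h` moves the point by `h(y - x)`. The components of `y - x` are the
functions `q^i - x^i`, which vanish at the centre. -/
theorem dil_add_factor (s : ℝ) (x : EuclideanSpace ℝ (Fin n)) (h : ℝ) (f : Smooth n) :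
    dil (s + h) x f = dil s x f +
      (h : ℂ) • ∑ i, (coord i - algebraMap ℂ _ (x i : ℂ)) * quotFactor s x h f i := by
  refine Smooth.eval_ext fun y => ?_
  have h1 : (s + h) • y + (1 - (s + h)) • x = (s • y + (1 - s) • x) + h • (y - x) := by
    module
  have h3 : ∀ i, Smooth.eval n (algebraMap ℂ (Smooth n) (x i : ℂ)) y = (x i : ℂ) := fun _ => rfl
  rw [eval_dil, h1, eval_add]
  simp only [map_add, map_sum, map_smul, Pi.add_apply, Finset.sum_apply, Pi.smul_apply, smul_eq_mul,
    quotFactor, eval_kernel, eval_dil, ContinuousMap.coe_mk, Smooth.eval_mul, map_sub,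
    Pi.sub_apply, eval_coord, Finset.mul_sum, h3]
  congr 1
  refine Finset.sum_congr rfl fun i _ => ?_
  have h2 : ∀ r : ℝ, (s + r * h) • y + (1 - (s + r * h)) • x =
      s • y + (1 - s) • x + r • h • (y - x) := fun r => by module
  simp only [h2, PiLp.smul_apply, smul_eq_mul]
  simp
  ring

theorem quotFactor_zero (s : ℝ) (x : EuclideanSpace ℝ (Fin n)) (f : Smooth n) (i : Fin n) :
    quotFactor s x 0 f i = dil s x (partialQ i f) :=
  Smooth.eval_ext fun y => by simp [quotFactor, eval_kernel, eval_dil]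

theorem continuous_quotFactor (s : ℝ) (x : EuclideanSpace ℝ (Fin n)) (f : Smooth n) (i : Fin n) :
    Continuous fun h => quotFactor s x h f i := by
  refine continuous_kernel continuous_const (continuous_curry ?_) (continuous_curry ?_)
    continuous_const
  · simp only [ContinuousMap.coe_mk]
    fun_prop
  · simp only [ContinuousMap.coe_mk]
    fun_prop

/-! ### Difference quotients of multilinear maps -/

/-- The argument with entries `F` before `j`, `q` at `j` and `F'` after `j`. -/
def mixArg {α : Type*} (F F' : Fin k → α) (j : Fin k) (q : α) : Fin k → α :=
  fun l => if l < j then F l else if j = l then q else F' l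

theorem mixArg_self {α : Type*} (F : Fin k → α) (j : Fin k) (q : α) :
    mixArg F F j q = Function.update F j q := by
  funext l
  unfold mixArg
  split_ifs with h1 h2
  · rw [Function.update_of_ne h1.ne]
  · subst h2; simp
  · rw [Function.update_of_ne (Ne.symm h2)]

theorem update_mixArg {α : Type*} (F F' : Fin k → α) (j : Fin k) (q q' : α) :
    Function.update (mixArg F F' j q) j q' = mixArg F F' j q' := by
  funext l
  by_cases h : l = j
  · subst h; simp [mixArg]
  · rw [Function.update_of_ne h]
    simp [mixArg, Ne.symm h]

theorem continuous_mixArg {X α : Type*} [TopologicalSpace X] [TopologicalSpace α]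
    {F F' : X → Fin k → α} {q : X → α} (hF : Continuous F) (hF' : Continuous F')
    (hq : Continuous q) (j : Fin k) : Continuous fun x => mixArg (F x) (F' x) j (q x) := by
  refine continuous_pi fun l => ?_
  unfold mixArg
  split_ifs
  · exact (continuous_apply l).comp hF
  · exact hq
  · exact (continuous_apply l).comp hF'

/-- Telescoping: the arguments are replaced one at a time, and linearity in the slot being replaced
extracts the scalars `c i`. -/
theorem IsMultiLin.map_add_sum {φ : (Fin k → Smooth n) → Smooth n} (hφ : IsMultiLin Set.univ φ)
    {ι : Type*} (s : Finset ι) (F F' : Fin k → Smooth n) (c : ι → ℂ) (Q : Fin k → ι → Smooth n)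
    (h : ∀ j, F' j = F j + ∑ i ∈ s, c i • Q j i) :
    φ F' = φ F + ∑ i ∈ s, c i • ∑ j, φ (mixArg F' F j (Q j i)) := by
  have h1 := hφ.toMultilinearMap.map_sub_map_piecewise F' F Finset.univ
  rw [Finset.piecewise_univ] at h1
  have h2 : ∀ j, (fun l => if l ∈ Finset.univ → l < j then F' l else
      if j = l then F' l - F l else F l) = mixArg F' F j (∑ i ∈ s, c i • Q j i) := by
    intro j
    funext l
    simp only [Finset.mem_univ, true_imp_iff, mixArg]
    split_ifs with h1 h3
    · rfl
    · subst h3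
      rw [h, add_sub_cancel_left]
    · rfl
  have h3 : ∀ j, φ (mixArg F' F j (∑ i ∈ s, c i • Q j i)) =
      ∑ i ∈ s, c i • φ (mixArg F' F j (Q j i)) := by
    intro j
    have := hφ.toMultilinearMap.map_update_sum s j (fun i => c i • Q j i) (mixArg F' F j 0)
    simp only [update_mixArg] at this
    refine this.trans (Finset.sum_congr rfl fun i _ => ?_)
    have h5 := hφ.smul (mixArg F' F j 0) j (Set.mem_univ j) (c i) (Q j i)
    simp only [update_mixArg] at h5
    exact h5
  have h4 : φ F' - φ F = ∑ j, φ (mixArg F' F j (∑ i ∈ s, c i • Q j i)) :=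
    h1.trans (Finset.sum_congr rfl fun j _ => congrArg φ (h2 j))
  rw [← sub_eq_iff_eq_add', h4]
  simp only [h3, Finset.smul_sum]
  exact Finset.sum_comm

end Dilations

/-! ### Averaging cochains over dilations -/

section Averaging

variable {n k : ℕ}

/-- Continuity of the coefficients at `0` is enough, since the linear factors supply the remaining
smallness. No differentiability of the quotients is available. -/
theorem hasFDerivAt_sum_mul {ρ : Fin n → EuclideanSpace ℝ (Fin n) → ℂ}
    (hρ : ∀ i, ContinuousAt (ρ i) 0) :
    HasFDerivAt (fun h : EuclideanSpace ℝ (Fin n) => ∑ i, (h i : ℂ) * ρ i h)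
      (linForm fun i => ρ i 0) 0 := by
  rw [hasFDerivAt_iff_isLittleO_nhds_zero]
  have h1 : ∀ i, (fun h : EuclideanSpace ℝ (Fin n) => (h i : ℂ) * (ρ i h - ρ i 0)) =o[nhds 0]
      fun h => h := fun i => by
    have h2 : (fun h : EuclideanSpace ℝ (Fin n) => (h i : ℂ)) =O[nhds 0] fun h => h :=
      Asymptotics.isBigO_of_le _ fun h => by
        rw [Complex.norm_real]
        exact PiLp.norm_apply_le h i
    have h3 : (fun h => ρ i h - ρ i 0) =o[nhds 0] fun _ => (1 : ℝ) := by
      rw [Asymptotics.isLittleO_one_iff]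
      exact tendsto_sub_nhds_zero_iff.2 (hρ i)
    have h4 := (h2.norm_right).mul_isLittleO h3
    exact Asymptotics.isLittleO_norm_right.1 (by simpa using h4)
  refine (Asymptotics.IsLittleO.sum (s := Finset.univ) fun i _ => h1 i).congr_left fun h => ?_
  simp [linForm_apply, mul_sub, Finset.sum_sub_distrib]

/-- The value at `x` of the cochain `φ` on the dilated arguments. -/
def dilEval (φ : (Fin k → Smooth n) → Smooth n) (f : Fin k → Smooth n) (s : ℝ)
    (x : EuclideanSpace ℝ (Fin n)) : ℂ :=
  Smooth.eval n (φ fun j => dil s x (f j)) x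

theorem continuous_dilEval {φ : (Fin k → Smooth n) → Smooth n} (hφ : Continuous φ) {X : Type*}
    [TopologicalSpace X] {f : X → Fin k → Smooth n} {s : X → ℝ} {x : X → EuclideanSpace ℝ (Fin n)}
    (hf : Continuous f) (hs : Continuous s) (hx : Continuous x) :
    Continuous fun z => dilEval φ (f z) (s z) (x z) :=
  continuous_eval₂ (hφ.comp (continuous_pi fun j =>
    continuous_dil hs hx ((continuous_apply j).comp hf))) hx

/-- The point `x` enters twice. As point of evaluation it contributes `∂_i` of the value of `φ`; as
centre of the dilation it differentiates one argument at a time, with the factor `1 - s`. -/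
theorem hasFDerivAt_dilEval {φ : (Fin k → Smooth n) → Smooth n}
    (hφ : IsRegular .continuous Set.univ φ) (f : Fin k → Smooth n) (s : ℝ)
    (x : EuclideanSpace ℝ (Fin n)) :
    HasFDerivAt (dilEval φ f s) (linForm fun i => dilEval (fun f => partialQ i (φ f)) f s x +
      ((1 - s : ℝ) : ℂ) * ∑ j, dilEval φ (Function.update f j (partialQ i (f j))) s x) x := by
  let F : EuclideanSpace ℝ (Fin n) → Fin k → Smooth n := fun h j => dil s (x + h) (f j)
  let R : Fin n → EuclideanSpace ℝ (Fin n) → Smooth n := fun i h =>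
    ∑ j, φ (mixArg (F h) (F 0) j (quotCenter s x h (f j) i))
  have hF : Continuous F := continuous_pi fun j =>
    continuous_dil continuous_const (by fun_prop) continuous_const
  have hR : ∀ i, Continuous (R i) := fun i => continuous_finsetSum _ fun j _ =>
    hφ.2.comp (continuous_mixArg hF continuous_const (continuous_quotCenter s x (f j) i) j)
  -- The increment of `φ` is computed exactly, with difference quotients inside the slots.
  -- Continuity of `φ` then makes `R` continuous.
  have hφF : ∀ h, φ (F h) = φ (F 0) + ∑ i, (h i : ℂ) • R i h := fun h =>
    hφ.1.map_add_sum Finset.univ (F 0) (F h) (fun i => (h i : ℂ))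
      (fun j i => quotCenter s x h (f j) i) fun j => by
        simp only [F, add_zero]
        exact dil_add_center s x h (f j)
  have hR0 : ∀ i, R i 0 = ((1 - s : ℝ) : ℂ) •
      ∑ j, φ fun l => dil s x (Function.update f j (partialQ i (f j)) l) := fun i => by
    rw [Finset.smul_sum]
    refine Finset.sum_congr rfl fun j _ => ?_
    rw [mixArg_self, quotCenter_zero, hφ.1.smul _ _ (Set.mem_univ j)]
    congr 2
    funext l
    by_cases hl : l = j
    · subst hl; simp
    · simp [Function.update_of_ne hl, F]
  have h1 : ∀ h, dilEval φ f s (x + h) = Smooth.eval n (φ (F 0)) (x + h) +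
      ∑ i, (h i : ℂ) * Smooth.eval n (R i h) (x + h) := fun h => by
    have : dilEval φ f s (x + h) = Smooth.eval n (φ (F h)) (x + h) := rfl
    rw [this, hφF]
    simp
  have h2 : HasFDerivAt (fun h => Smooth.eval n (φ (F 0)) (x + h) +
      ∑ i, (h i : ℂ) * Smooth.eval n (R i h) (x + h))
      ((linForm fun i => Smooth.eval n (partialQ i (φ (F 0))) x) +
        linForm fun i => Smooth.eval n (R i 0) x) 0 := by
    refine HasFDerivAt.add ?_ ?_
    · have h3 := hasFDerivAt_eval (φ (F 0)) (x + 0)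
      have h4 := h3.comp (0 : EuclideanSpace ℝ (Fin n)) ((hasFDerivAt_id 0).const_add x)
      simpa [Function.comp_def] using h4
    · have h3 := hasFDerivAt_sum_mul (ρ := fun i h => Smooth.eval n (R i h) (x + h)) fun i =>
        (continuous_eval₂ (hR i) (by fun_prop)).continuousAt
      simpa using h3
  simp only [← h1] at h2
  have h6 := (hasFDerivAt_comp_add_left x (f := dilEval φ f s) (x := 0)).1 h2
  rw [add_zero] at h6
  refine h6.congr_fderiv (ContinuousLinearMap.ext fun v => ?_)
  simp only [add_apply, linForm_apply, ← Finset.sum_add_distrib, ← mul_add]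
  refine Finset.sum_congr rfl fun i _ => ?_
  rw [hR0]
  simp [dilEval, F]

/-- `x ↦ ∫₀¹ w(s) φ(dilated f)(x) ds`. -/
def averageFun (w : C(ℝ, ℝ)) (φ : (Fin k → Smooth n) → Smooth n) (f : Fin k → Smooth n)
    (x : EuclideanSpace ℝ (Fin n)) : ℂ :=
  ∫ s in (0 : ℝ)..1, (w s : ℂ) * dilEval φ f s x

/-- The function `s ↦ 1 - s`. -/
def oneSub : C(ℝ, ℝ) := ⟨fun s => 1 - s, by fun_prop⟩

/-- Every term is again an average, for another weight, cochain or argument. General weights are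
needed for this closure, although the final application takes `w = 1`. -/
theorem hasFDerivAt_averageFun (w : C(ℝ, ℝ)) {φ : (Fin k → Smooth n) → Smooth n}
    (hφ : IsRegular .continuous Set.univ φ) (f : Fin k → Smooth n)
    (x : EuclideanSpace ℝ (Fin n)) :
    HasFDerivAt (averageFun w φ f) (linForm fun i => averageFun w (fun f => partialQ i (φ f)) f x +
      ∑ j, averageFun (w * oneSub) φ (Function.update f j (partialQ i (f j))) x) x := by
  have hc : ∀ (w : C(ℝ, ℝ)) {φ : (Fin k → Smooth n) → Smooth n} (f : Fin k → Smooth n),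
      Continuous φ → Continuous (Function.uncurry fun (x : EuclideanSpace ℝ (Fin n)) s =>
        (w s : ℂ) * dilEval φ f s x) := fun w φ f hφ => by
    simp only [Function.uncurry_def]
    exact Continuous.mul (by fun_prop)
      (continuous_dilEval hφ continuous_const continuous_snd continuous_fst)
  have hint : ∀ (w : C(ℝ, ℝ)) {φ : (Fin k → Smooth n) → Smooth n} (f : Fin k → Smooth n),
      Continuous φ → IntervalIntegrable (fun s => (w s : ℂ) * dilEval φ f s x)
        MeasureTheory.volume 0 1 := fun w φ f hφ =>
    ((hc w f hφ).comp (by fun_prop : Continuous fun s : ℝ => (x, s))).intervalIntegrable 0 1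
  have h := hasFDerivAt_integral_linForm (F := fun x s => (w s : ℂ) * dilEval φ f s x)
    (c := fun i x s => (w s : ℂ) * dilEval (fun f => partialQ i (φ f)) f s x +
      ∑ j, ((w * oneSub) s : ℂ) * dilEval φ (Function.update f j (partialQ i (f j))) s x)
    (hc w f hφ.2)
    (fun i => (hc w f (hφ.partialQ i).2).add (continuous_finsetSum _ fun j _ => hc _ _ hφ.2))
    (fun x s => by
      refine ((hasFDerivAt_dilEval hφ f s x).const_mul (w s : ℂ)).congr_fderiv
        (ContinuousLinearMap.ext fun v => ?_)
      simp only [smul_apply, linForm_apply, smul_eq_mul, Finset.mul_sum]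
      refine Finset.sum_congr rfl fun i _ => ?_
      simp only [mul_add, Finset.mul_sum, oneSub, ContinuousMap.mul_apply, ContinuousMap.coe_mk]
      congr 1
      · ring
      · refine Finset.sum_congr rfl fun j _ => ?_
        push_cast
        ring) x
  refine h.congr_fderiv (congrArg linForm (funext fun i => ?_))
  have hsum : IntervalIntegrable (fun s => ∑ j, ((w * oneSub) s : ℂ) *
      dilEval φ (Function.update f j (partialQ i (f j))) s x) MeasureTheory.volume 0 1 :=
    Continuous.intervalIntegrable (continuous_finsetSum _ fun j _ =>
      (hc _ _ hφ.2).comp (by fun_prop : Continuous fun s : ℝ => (x, s))) 0 1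
  rw [intervalIntegral.integral_add (hint w f (hφ.partialQ i).2) hsum,
    intervalIntegral.integral_finsetSum]
  · rfl
  · exact fun j _ => hint _ _ hφ.2

theorem contDiff_averageFun (w : C(ℝ, ℝ)) {φ : (Fin k → Smooth n) → Smooth n}
    (hφ : IsRegular .continuous Set.univ φ) (f : Fin k → Smooth n) :
    ContDiff ℝ (⊤ : ℕ∞) (averageFun w φ f) := by
  let S : Set (EuclideanSpace ℝ (Fin n) → ℂ) :=
    {g | ∃ w φ f, IsRegular .continuous Set.univ φ ∧ g = averageFun (k := k) w φ f}
  refine contDiff_of_class (fun g => g ∈ AddSubmonoid.closure S) (fun g hg => ?_)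
    (AddSubmonoid.subset_closure ⟨w, φ, f, hφ, rfl⟩)
  refine AddSubmonoid.closure_induction (motive := fun g _ =>
    ∃ c : Fin n → EuclideanSpace ℝ (Fin n) → ℂ, (∀ i, c i ∈ AddSubmonoid.closure S) ∧
      ∀ x, HasFDerivAt g (linForm fun i => c i x) x) ?_ ?_ ?_ hg
  · rintro _ ⟨w, φ, f, hφ, rfl⟩
    refine ⟨fun i => averageFun w (fun f => partialQ i (φ f)) f +
      ∑ j, averageFun (w * oneSub) φ (Function.update f j (partialQ i (f j))), fun i => ?_,
      fun x => ?_⟩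
    · exact add_mem (AddSubmonoid.subset_closure ⟨_, _, _, hφ.partialQ i, rfl⟩)
        (sum_mem fun j _ => AddSubmonoid.subset_closure ⟨_, _, _, hφ, rfl⟩)
    · simpa using hasFDerivAt_averageFun w hφ f x
  · refine ⟨0, fun i => zero_mem _, fun x => ?_⟩
    refine (hasFDerivAt_const (0 : ℂ) x).congr_fderiv (ContinuousLinearMap.ext fun v => ?_)
    simp [linForm_apply]
  · rintro g g' - - ⟨c, hc, h⟩ ⟨c', hc', h'⟩
    refine ⟨c + c', fun i => add_mem (hc i) (hc' i), fun x => ?_⟩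
    refine ((h x).add (h' x)).congr_fderiv (ContinuousLinearMap.ext fun v => ?_)
    simp [linForm_apply, mul_add, Finset.sum_add_distrib]

/-- `averageFun` as a cochain. -/
def average (w : C(ℝ, ℝ)) {φ : (Fin k → Smooth n) → Smooth n}
    (hφ : IsRegular .continuous Set.univ φ) (f : Fin k → Smooth n) : Smooth n :=
  .ofFun (averageFun w φ f) (contDiff_averageFun w hφ f)

theorem eval_average (w : C(ℝ, ℝ)) {φ : (Fin k → Smooth n) → Smooth n}
    (hφ : IsRegular .continuous Set.univ φ) (f : Fin k → Smooth n) (x) :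
    Smooth.eval n (average w hφ f) x = ∫ s in (0 : ℝ)..1, (w s : ℂ) * dilEval φ f s x := rfl

theorem partialQ_average (w : C(ℝ, ℝ)) {φ : (Fin k → Smooth n) → Smooth n}
    (hφ : IsRegular .continuous Set.univ φ) (f : Fin k → Smooth n) (i : Fin n) :
    partialQ i (average w hφ f) = average w (hφ.partialQ i) f +
      ∑ j, average (w * oneSub) hφ (Function.update f j (partialQ i (f j))) := by
  refine Smooth.eval_ext fun x => ?_
  rw [eval_partialQ]
  change fderiv ℝ (averageFun w φ f) x _ = _
  rw [(hasFDerivAt_averageFun w hφ f x).fderiv, linForm_single, map_add, map_sum, Pi.add_apply,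
    Finset.sum_apply]
  rfl

theorem intervalIntegrable_dilEval (w : C(ℝ, ℝ)) {φ : (Fin k → Smooth n) → Smooth n}
    (hφ : Continuous φ) (f : Fin k → Smooth n) (x : EuclideanSpace ℝ (Fin n)) :
    IntervalIntegrable (fun s => (w s : ℂ) * dilEval φ f s x) MeasureTheory.volume 0 1 :=
  Continuous.intervalIntegrable (Continuous.mul (by fun_prop)
      (continuous_dilEval hφ continuous_const continuous_id continuous_const)) 0 1

theorem isRegular_average (w : C(ℝ, ℝ)) {φ : (Fin k → Smooth n) → Smooth n}
    (hφ : IsRegular .continuous Set.univ φ) : IsRegular .continuous Set.univ (average w hφ) := by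
  have hdil : ∀ s x (f : Fin k → Smooth n) j a, (fun l => dil s x (Function.update f j a l)) =
      Function.update (fun l => dil s x (f l)) j (dil s x a) := by
    intro s x f j a
    funext l
    by_cases hl : l = j
    · subst hl; simp
    · simp [Function.update_of_ne hl]
  refine ⟨⟨fun f j _ a b => ?_, fun f j _ c a => ?_, fun f j hj => absurd (Set.mem_univ j) hj⟩, ?_⟩
  · refine Smooth.eval_ext fun x => ?_
    rw [map_add, Pi.add_apply, eval_average, eval_average, eval_average,
      ← intervalIntegral.integral_add (intervalIntegrable_dilEval w hφ.2 _ x)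
        (intervalIntegrable_dilEval w hφ.2 _ x)]
    simp only [dilEval, hdil, map_add, hφ.1.add _ j (Set.mem_univ j), Pi.add_apply, mul_add]
  · refine Smooth.eval_ext fun x => ?_
    rw [map_smul, Pi.smul_apply, eval_average, eval_average, smul_eq_mul,
      ← intervalIntegral.integral_const_mul]
    simp only [dilEval, hdil, map_smul, hφ.1.smul _ j (Set.mem_univ j), Pi.smul_apply, smul_eq_mul,
      mul_left_comm c]
  -- Derivatives of averages differentiate the arguments as well, so the class allows arbitrary
  -- continuous families `F` of arguments.
  · let S : Set ((Fin k → Smooth n) → Smooth n) := {g | ∃ (w : C(ℝ, ℝ))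
      (φ : (Fin k → Smooth n) → Smooth n) (hφ : IsRegular .continuous Set.univ φ)
      (F : (Fin k → Smooth n) → Fin k → Smooth n), Continuous F ∧ g = fun ξ => average w hφ (F ξ)}
    refine continuous_of_class (fun g => g ∈ AddSubmonoid.closure S) (fun g hg => ?_)
      (fun g hg i => ?_) (AddSubmonoid.subset_closure ⟨w, φ, hφ, id, continuous_id, rfl⟩)
    · refine AddSubmonoid.closure_induction (motive := fun g _ => Continuous
        fun z : (Fin k → Smooth n) × EuclideanSpace ℝ (Fin n) => Smooth.eval n (g z.1) z.2)
        ?_ ?_ ?_ hg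
      · rintro _ ⟨w, φ, hφ, F, hF, rfl⟩
        simp only [eval_average]
        refine intervalIntegral.continuous_parametric_intervalIntegral_of_continuous' ?_ 0 1
        simp only [Function.uncurry_def]
        exact Continuous.mul (by fun_prop)
          (continuous_dilEval hφ.2 (hF.comp (by fun_prop)) (by fun_prop) (by fun_prop))
      · simpa using continuous_const
      · intro a b _ _ ha hb
        simp only [Pi.add_apply, map_add]
        exact ha.add hb
    · refine AddSubmonoid.closure_induction
        (motive := fun g _ => (fun x => partialQ i (g x)) ∈ AddSubmonoid.closure S) ?_ ?_ ?_ hg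
      · rintro _ ⟨w, φ, hφ, F, hF, rfl⟩
        simp only [partialQ_average]
        have : (fun ξ => average w (hφ.partialQ i) (F ξ) + ∑ j,
            average (w * oneSub) hφ (Function.update (F ξ) j (partialQ i (F ξ j)))) =
            (fun ξ => average w (hφ.partialQ i) (F ξ)) + ∑ j, fun ξ =>
              average (w * oneSub) hφ (Function.update (F ξ) j (partialQ i (F ξ j))) := by
          funext ξ
          simp
        rw [this]
        refine add_mem (AddSubmonoid.subset_closure ⟨_, _, _, F, hF, rfl⟩)
          (sum_mem fun j _ => AddSubmonoid.subset_closure ⟨_, _, hφ,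
            fun ξ => Function.update (F ξ) j (partialQ i (F ξ j)), ?_, rfl⟩)
        exact hF.update j ((continuous_partialQ i).comp ((continuous_apply j).comp hF))
      · simp only [Pi.zero_apply, map_zero]
        exact zero_mem (AddSubmonoid.closure S)
      · intro a b _ _ ha hb
        have : (fun x => partialQ i ((a + b) x)) =
            (fun x => partialQ i (a x)) + fun x => partialQ i (b x) := by
          funext x
          simp
        rw [this]
        exact add_mem ha hb

/-! ### Averages of differential cochains -/

theorem partialQ_dil (i : Fin n) (s : ℝ) (x : EuclideanSpace ℝ (Fin n)) (f : Smooth n) :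
    partialQ i (dil s x f) = (s : ℂ) • dil s x (partialQ i f) := by
  rw [dil_eq_kernel, partialQ_kernel, dil_eq_kernel]
  refine Smooth.eval_ext fun y => ?_
  simp [eval_kernel]

/-- Each partial derivative of a dilated function brings out one factor `s`; only the existence of
the exponent is used. -/
theorem iterPartialQ_dil (I : Fin n → ℕ) :
    ∃ N : ℕ, ∀ (s : ℝ) (x : EuclideanSpace ℝ (Fin n)) (f : Smooth n),
      iterPartialQ I (dil s x f) = (s : ℂ) ^ N • dil s x (iterPartialQ I f) := by
  have key : ∀ L : List (Module.End ℂ (Smooth n)), (∀ T ∈ L, ∃ N : ℕ, ∀ (s : ℝ)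
      (x : EuclideanSpace ℝ (Fin n)) (f : Smooth n), T (dil s x f) = (s : ℂ) ^ N • dil s x (T f)) →
      ∃ N : ℕ, ∀ (s : ℝ) (x : EuclideanSpace ℝ (Fin n)) (f : Smooth n),
        L.prod (dil s x f) = (s : ℂ) ^ N • dil s x (L.prod f) := by
    intro L
    induction L with
    | nil => exact fun _ => ⟨0, by simp⟩
    | cons T L ih =>
      intro hL
      obtain ⟨N, hN⟩ := hL T (by simp)
      obtain ⟨M, hM⟩ := ih fun T' hT' => hL T' (by simp [hT'])
      exact ⟨M + N, fun s x f => by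
        rw [List.prod_cons, Module.End.mul_apply, hM, map_smul, hN, smul_smul, pow_add]
        rfl⟩
  refine key _ fun T hT => ?_
  obtain ⟨i, rfl⟩ := (List.mem_ofFn' _ _).1 hT
  dsimp only
  induction I i with
  | zero => exact ⟨0, by simp⟩
  | succ k ih =>
    obtain ⟨N, hN⟩ := ih
    exact ⟨N + 1, fun s x f => by
      rw [pow_succ, Module.End.mul_apply, partialQ_dil, map_smul, hN, smul_smul, pow_succ']
      rfl⟩

/-- At the centre a dilated monomial operator is a power of `s` times the undilated one. Averaging
therefore only rescales monomials and introduces no new derivatives. -/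
theorem exists_average_differential {φ : (Fin k → Smooth n) → Smooth n}
    (hφ : φ ∈ diffOps n Set.univ) : ∃ ψ : (Fin k → Smooth n) → Smooth n, ψ ∈ diffOps n Set.univ ∧
      ∀ f x, Smooth.eval n (ψ f) x = ∫ s in (0 : ℝ)..1, dilEval φ f s x := by
  have hint : ∀ {φ : (Fin k → Smooth n) → Smooth n}, φ ∈ diffOps n Set.univ → ∀ f x,
      IntervalIntegrable (fun s => dilEval φ f s x) MeasureTheory.volume 0 1 :=
    fun {φ} hφ f x => by
      have hc : Continuous φ := IsRegular.continuous (t := .differential) hφ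
      simpa using intervalIntegrable_dilEval 1 hc f x
  refine Submodule.span_induction (p := fun φ _ => ∃ ψ : (Fin k → Smooth n) → Smooth n,
    ψ ∈ diffOps n Set.univ ∧ ∀ f x, Smooth.eval n (ψ f) x = ∫ s in (0 : ℝ)..1, dilEval φ f s x)
    ?_ ?_ ?_ ?_ hφ
  · rintro _ ⟨I, rfl⟩
    choose N hN using fun j => iterPartialQ_dil (I j)
    have hI : (fun f : Fin k → Smooth n => ∏ j, iterPartialQ (I j) (f j)) ∈
        diffOps n Set.univ := Submodule.subset_span ⟨I, by simp⟩
    simp only [Set.mem_univ, Finset.filter_true]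
    have h : ∀ f s x, dilEval (fun f => ∏ j, iterPartialQ (I j) (f j)) f s x =
        (s : ℂ) ^ (∑ j, N j) * Smooth.eval n (∏ j, iterPartialQ (I j) (f j)) x := fun f s x => by
      simp only [dilEval, ← evalAt_apply, map_prod, hN]
      rw [← Finset.prod_pow_eq_pow_sum, ← Finset.prod_mul_distrib]
      refine Finset.prod_congr rfl fun j _ => ?_
      simp only [evalAt_apply, map_smul, Pi.smul_apply, eval_dil_self, smul_eq_mul]
    refine ⟨_, Submodule.smul_mem _ (algebraMap ℂ (Smooth n)
      (∫ s in (0 : ℝ)..1, (s : ℂ) ^ (∑ j, N j))) hI,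
      fun f x => ?_⟩
    simp only [h, intervalIntegral.integral_mul_const]
    rfl
  · refine ⟨0, zero_mem _, fun f x => ?_⟩
    simp [dilEval]
  · rintro φ ψ hφ' hψ' ⟨φ', hφ, h⟩ ⟨ψ', hψ, h'⟩
    refine ⟨φ' + ψ', add_mem hφ hψ, fun f x => ?_⟩
    have : ∀ s, dilEval (φ + ψ) f s x = dilEval φ f s x + dilEval ψ f s x := fun s => by
      simp [dilEval]
    simp only [this]
    rw [intervalIntegral.integral_add (hint hφ' f x) (hint hψ' f x), ← h, ← h']
    simp
  · rintro c φ - ⟨φ', hφ, h⟩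
    refine ⟨c • φ', Submodule.smul_mem _ c hφ, fun f x => ?_⟩
    have : ∀ s, dilEval (c • φ) f s x = Smooth.eval n c x * dilEval φ f s x := fun s => by
      simp [dilEval]
    simp only [this, intervalIntegral.integral_const_mul, ← h]
    simp

/-- Averaging over dilations preserves regularity. -/
theorem exists_average {t : CochainType} {φ : (Fin k → Smooth n) → Smooth n}
    (hφ : IsRegular t Set.univ φ) : ∃ ψ : (Fin k → Smooth n) → Smooth n, IsRegular t Set.univ ψ ∧
      ∀ f x, Smooth.eval n (ψ f) x = ∫ s in (0 : ℝ)..1, dilEval φ f s x := by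
  cases t
  · exact exists_average_differential hφ
  · exact ⟨_, isRegular_average 1 hφ, fun f x => by simp [eval_average]⟩

/-! ### Differentiation along the dilations -/

/-- The function `q^i - x^i`. -/
def centered (x : EuclideanSpace ℝ (Fin n)) (i : Fin n) : Smooth n :=
  coord i - algebraMap ℂ _ (x i : ℂ)

theorem eval_centered (x : EuclideanSpace ℝ (Fin n)) (i : Fin n) :
    Smooth.eval n (centered x i) x = 0 := by
  rw [centered, map_sub, Pi.sub_apply, eval_coord]
  exact sub_self _

/-- The velocity of the dilation is `y - x`, so the derivative puts `(q^i - x^i)` times the dilated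
`∂_i f_j` into one slot at a time. That is `derivSum` with `u = q^i - x^i`, the situation of the
algebraic homotopy. -/
theorem hasDerivAt_dilEval {φ : (Fin k → Smooth n) → Smooth n}
    (hφ : IsRegular .continuous Set.univ φ) (f : Fin k → Smooth n) (s : ℝ)
    (x : EuclideanSpace ℝ (Fin n)) :
    HasDerivAt (fun s => dilEval φ f s x) (∑ i, derivSum (dil s x)
      (fun g => dil s x (partialQ i g)) (centered x i) k (fun g => Smooth.eval n (φ g) x) f) s := by
  let F : ℝ → Fin k → Smooth n := fun h j => dil (s + h) x (f j)
  let Q : ℝ → Fin k → Smooth n := fun h j => ∑ i, centered x i * quotFactor s x h (f j) i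
  let R : ℝ → Smooth n := fun h => ∑ j, φ (mixArg (F h) (F 0) j (Q h j))
  have hF : Continuous F := continuous_pi fun j =>
    continuous_dil (by fun_prop) continuous_const continuous_const
  have hQ : ∀ j, Continuous fun h => Q h j := fun j => continuous_finsetSum _ fun i _ =>
    continuous_const.mul (continuous_quotFactor s x (f j) i)
  have hR : Continuous R := continuous_finsetSum _ fun j _ =>
    hφ.2.comp (continuous_mixArg hF continuous_const (hQ j) j)
  have hφF : ∀ h, φ (F h) = φ (F 0) + (h : ℂ) • R h := fun h => by
    have := hφ.1.map_add_sum (Finset.univ : Finset Unit) (F 0) (F h) (fun _ => (h : ℂ))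
      (fun j _ => Q h j) fun j => by
        simp only [F, add_zero, Finset.univ_unique, Finset.sum_singleton]
        exact dil_add_factor s x h (f j)
    simpa using this
  have hR0 : Smooth.eval n (R 0) x = ∑ i, derivSum (dil s x)
      (fun g => dil s x (partialQ i g)) (centered x i) k (fun g => Smooth.eval n (φ g) x) f := by
    simp only [R, mixArg_self, Q, quotFactor_zero, derivSum_eq_sum]
    rw [Finset.sum_comm, map_sum, Finset.sum_apply]
    refine Finset.sum_congr rfl fun j _ => ?_
    have := hφ.1.toMultilinearMap.map_update_sum Finset.univ j
      (fun i => centered x i * dil s x (partialQ i (f j))) (F 0)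
    have h2 : φ (Function.update (F 0) j (∑ i, centered x i * dil s x (partialQ i (f j)))) =
      ∑ i, φ (Function.update (F 0) j (centered x i * dil s x (partialQ i (f j)))) := this
    rw [h2, map_sum, Finset.sum_apply]
    refine Finset.sum_congr rfl fun i _ => ?_
    have h3 : F 0 = dil s x ∘ f := by
      funext l
      simp [F]
    rw [h3]
  have h1 : ∀ h, dilEval φ f (s + h) x = dilEval φ f s x + h * Smooth.eval n (R h) x := fun h => by
    have e1 : dilEval φ f (s + h) x = Smooth.eval n (φ (F h)) x := rfl
    have e2 : dilEval φ f s x = Smooth.eval n (φ (F 0)) x := by simp [dilEval, F]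
    rw [e1, e2, hφF]
    simp
  rw [← hR0, hasDerivAt_iff_tendsto_slope_zero]
  have hc : Continuous fun h => Smooth.eval n (R h) x := continuous_eval₂ hR continuous_const
  refine Filter.Tendsto.congr' ?_ (hc.continuousAt.tendsto.mono_left nhdsWithin_le_nhds)
  filter_upwards [self_mem_nhdsWithin] with h hh
  rw [h1, add_sub_cancel_left, Complex.real_smul, Complex.ofReal_inv, inv_mul_cancel_left₀]
  exact Complex.ofReal_ne_zero.2 hh

theorem continuous_derivSum_dil {φ : (Fin k → Smooth n) → Smooth n} (hφ : Continuous φ)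
    (f : Fin k → Smooth n) (x : EuclideanSpace ℝ (Fin n)) (i : Fin n) :
    Continuous fun s => derivSum (dil s x) (fun g => dil s x (partialQ i g)) (centered x i) k
      (fun g => Smooth.eval n (φ g) x) f := by
  simp only [derivSum_eq_sum]
  refine continuous_finsetSum _ fun j _ => continuous_eval₂ (hφ.comp ?_) continuous_const
  refine Continuous.update (continuous_pi fun l => ?_) j (continuous_const.mul ?_)
  · exact continuous_dil continuous_id continuous_const continuous_const
  · exact continuous_dil continuous_id continuous_const continuous_const

/-- Taylor's formula of order one for a cochain along the dilations. -/
theorem integral_derivSum {φ : (Fin k → Smooth n) → Smooth n}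
    (hφ : IsRegular .continuous Set.univ φ) (f : Fin k → Smooth n) (x : EuclideanSpace ℝ (Fin n)) :
    ∑ i, (∫ s in (0 : ℝ)..1, derivSum (dil s x) (fun g => dil s x (partialQ i g))
      (centered x i) k (fun g => Smooth.eval n (φ g) x) f) =
      Smooth.eval n (φ f) x - Smooth.eval n ((∏ j, f j) * φ fun _ => 1) x := by
  have h := intervalIntegral.integral_eq_sub_of_hasDerivAt
    (fun s _ => hasDerivAt_dilEval hφ f s x) (Continuous.intervalIntegrable
      (continuous_finsetSum _ fun i _ => continuous_derivSum_dil hφ.2 f x i) 0 1)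
  rw [intervalIntegral.integral_finsetSum fun i _ => Continuous.intervalIntegrable
      (continuous_derivSum_dil hφ.2 f x i) 0 1] at h
  rw [h]
  -- At `s = 1` the dilation is the identity. At `s = 0` all arguments become constants, and
  -- multilinearity pulls out their values.
  congr 1
  · simp [dilEval, dil_one]
  · simp only [dilEval, dil_zero, Algebra.algebraMap_eq_smul_one]
    have := hφ.1.toMultilinearMap.map_smul_univ (fun j => Smooth.eval n (f j) x) fun _ => 1
    have h2 : (φ fun j => Smooth.eval n (f j) x • 1) =
      (∏ j, Smooth.eval n (f j) x) • φ fun _ => 1 := this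
    rw [h2, map_smul, Smooth.eval_mul, ← evalAt_apply, ← evalAt_apply, map_prod]
    rfl

end Averaging

/-! ### The Hochschild cohomology of `C^∞(ℝⁿ)` with values in itself -/

section ScalarCohomology

local infixr:67 " ∷ " => Matrix.vecCons

variable {n k : ℕ} {t : CochainType}

/-- The Hochschild differential of `C^∞(ℝⁿ)` with values in itself. -/
abbrev scalarDelta (n k : ℕ) (φ : (Fin k → Smooth n) → Smooth n) :
    (Fin (k + 1) → Smooth n) → Smooth n :=
  hochschild (V := Smooth n) AddMonoidHom.mulLeft AddMonoidHom.mulLeft k φ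

/-- The action of functions on `ℂ` through evaluation at a point. -/
def pointAct (x : EuclideanSpace ℝ (Fin n)) (f : Smooth n) : ℂ →+ ℂ :=
  AddMonoidHom.mulLeft (Smooth.eval n f x)

theorem eval_scalarDelta (x : EuclideanSpace ℝ (Fin n)) (φ : (Fin k → Smooth n) → Smooth n)
    (f : Fin (k + 1) → Smooth n) : Smooth.eval n (scalarDelta n k φ f) x =
      hochschild (pointAct x) (pointAct x) k (fun w => Smooth.eval n (φ w) x) f :=
  (hochschild_map (V := Smooth n) AddMonoidHom.mulLeft AddMonoidHom.mulLeft (pointAct x)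
    (pointAct x) (evalAt x).toAddMonoidHom (fun _ _ => rfl) (fun _ _ => rfl) k φ f).symm

theorem IsRegular.insertNth {φ : (Fin (k + 1) → Smooth n) → Smooth n}
    (hφ : IsRegular t Set.univ φ) (l : Fin (k + 1)) (v : Smooth n) :
    IsRegular t Set.univ fun f : Fin k → Smooth n => φ (l.insertNth v f) := by
  have h : ∀ j, IsRegular t {i | l.succAbove i = j} fun f : Fin k → Smooth n =>
      (l.insertNth v f : Fin (k + 1) → Smooth n) j := fun j => by
    refine Fin.succAboveCases l ?_ (fun j => ?_) j
    · simp only [Fin.insertNth_apply_same]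
      exact (IsRegular.const t v).congr_set (by ext i; simp [Fin.succAbove_ne])
    · simp only [Fin.insertNth_apply_succAbove]
      exact (IsRegular.proj t j).congr_set (by ext i; simp)
  exact hφ.comp l.succAbove h

theorem IsRegular.update_partialQ {φ : (Fin k → Smooth n) → Smooth n}
    (hφ : IsRegular t Set.univ φ) (j : Fin k) (i : Fin n) :
    IsRegular t Set.univ fun f => φ (Function.update f j (FormalWeyl.partialQ i (f j))) := by
  have h : ∀ l, IsRegular t {m | id m = l} fun f : Fin k → Smooth n =>
      Function.update f j (FormalWeyl.partialQ i (f j)) l := fun l => by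
    by_cases hl : l = j
    · subst hl
      simp only [Function.update_self]
      exact (IsRegular.proj t l).partialQ i
    · simp only [Function.update_of_ne hl]
      exact IsRegular.proj t l
  exact hφ.comp id h

theorem IsMultiLin.insertNth_sub_algebraMap {φ : (Fin (k + 1) → Smooth n) → Smooth n}
    (hφ : IsMultiLin Set.univ φ) (l : Fin (k + 1)) (v : Smooth n) (c : ℂ) (g : Fin k → Smooth n) :
    φ (l.insertNth (v - algebraMap ℂ _ c) g) =
      φ (l.insertNth v g) - c • φ (l.insertNth 1 g) := by
  have h1 := hφ.toMultilinearMap.map_update_sub (l.insertNth 0 g) l v (algebraMap ℂ _ c)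
  have h2 := hφ.toMultilinearMap.map_update_smul (l.insertNth 0 g) l c 1
  rw [← Algebra.algebraMap_eq_smul_one] at h2
  rw [h2] at h1
  simp only [Fin.update_insertNth] at h1
  exact h1

theorem eval_insertNth_centered {φ : (Fin (k + 1) → Smooth n) → Smooth n}
    (hφ : IsMultiLin Set.univ φ) (l : Fin (k + 1)) (i : Fin n) (x : EuclideanSpace ℝ (Fin n))
    (s : ℝ) (g : Fin k → Smooth n) :
    Smooth.eval n (φ (l.insertNth (centered x i) (dil s x ∘ g))) x =
      dilEval (fun f => φ (l.insertNth (coord i) f)) g s x -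
        (x i : ℂ) * dilEval (fun f => φ (l.insertNth 1 f)) g s x := by
  rw [centered, hφ.insertNth_sub_algebraMap, map_sub, map_smul]
  rfl

theorem continuous_eval_insertNth_centered {φ : (Fin (k + 1) → Smooth n) → Smooth n}
    (hφ : IsRegular t Set.univ φ) (l : Fin (k + 1)) (i : Fin n) (x : EuclideanSpace ℝ (Fin n))
    (g : Fin k → Smooth n) : Continuous fun s : ℝ =>
      Smooth.eval n (φ (l.insertNth (centered x i) (dil s x ∘ g))) x := by
  simp only [eval_insertNth_centered hφ.isMultiLin]
  exact (continuous_dilEval (hφ.insertNth l _).continuous continuous_const continuous_id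
    continuous_const).sub (continuous_const.mul (continuous_dilEval
      (hφ.insertNth l _).continuous continuous_const continuous_id continuous_const))

/-- The inserted function depends on `x`, so it is not a fixed insertion into `φ`. Splitting off
`x^i` leaves insertions of `q^i` and `1`, and after integration the scalar `x^i` becomes
multiplication by the coordinate function. -/
theorem exists_average_insertNth {φ : (Fin (k + 1) → Smooth n) → Smooth n}
    (hφ : IsRegular t Set.univ φ) (l : Fin (k + 1)) (i : Fin n) :
    ∃ ψ : (Fin k → Smooth n) → Smooth n, IsRegular t Set.univ ψ ∧ ∀ g x, Smooth.eval n (ψ g) x =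
      ∫ s in (0 : ℝ)..1, Smooth.eval n (φ (l.insertNth (centered x i) (dil s x ∘ g))) x := by
  obtain ⟨ψ, hψ, h⟩ := exists_average (hφ.insertNth l (coord i))
  obtain ⟨ψ', hψ', h'⟩ := exists_average (hφ.insertNth l 1)
  refine ⟨ψ - fun f => coord i * ψ' f, hψ.sub (hψ'.mulLeft _), fun g x => ?_⟩
  have hint : ∀ v, IntervalIntegrable (fun s => dilEval (fun f => φ (l.insertNth v f)) g s x)
      MeasureTheory.volume 0 1 := fun v => by
    simpa using intervalIntegrable_dilEval 1 (hφ.insertNth l v).continuous g x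
  simp only [eval_insertNth_centered hφ.isMultiLin]
  rw [intervalIntegral.integral_sub (hint _) ((hint _).const_mul _),
    intervalIntegral.integral_const_mul, ← h, ← h']
  simp

/-- The homotopy formula behind the Hochschild-Kostant-Rosenberg theorem. -/
theorem exists_decomposition {φ : (Fin (k + 1) → Smooth n) → Smooth n}
    (hφ : IsRegular t Set.univ φ) (hδ : scalarDelta n (k + 1) φ = 0) :
    ∃ (ψ : Fin n → (Fin k → Smooth n) → Smooth n) (χ : (Fin k → Smooth n) → Smooth n),
      (∀ i, IsRegular t Set.univ (ψ i) ∧ scalarDelta n k (ψ i) = 0) ∧ IsRegular t Set.univ χ ∧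
      ∀ f, φ f = (∏ j, f j) * (φ fun _ => 1) +
        ∑ i, partialQ i (f 0) * ψ i (Matrix.vecTail f) - scalarDelta n k χ f := by
  choose A hA hAe using fun l i => exists_average_insertNth hφ l i
  have hcocycle : ∀ x, hochschild (pointAct x) (pointAct x) (k + 1)
      (fun w => Smooth.eval n (φ w) x) = 0 := fun x => by
    funext f
    rw [← eval_scalarDelta, hδ]
    simp
  have hupdate : ∀ s x i (f : Fin k → Smooth n) j,
      Function.update (dil s x ∘ f) j (dil s x (partialQ i (f j))) =
        dil s x ∘ Function.update f j (partialQ i (f j)) := fun s x i f j => by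
    funext l
    by_cases hl : l = j
    · subst hl; simp
    · simp [Function.update_of_ne hl]
  -- Integration over `s` is treated as a map of coefficient modules, from functions of `s` to
  -- numbers. It therefore commutes with the Hochschild differential.
  let T : C(ℝ, ℂ) →+ ℂ :=
    { toFun := fun c => ∫ s in (0 : ℝ)..1, c s
      map_zero' := by simp
      map_add' := fun c d => by
        simp only [ContinuousMap.add_apply]
        exact intervalIntegral.integral_add (c.continuous.intervalIntegrable _ _)
          (d.continuous.intervalIntegrable _ _) }
  let act : EuclideanSpace ℝ (Fin n) → Smooth n → C(ℝ, ℂ) →+ C(ℝ, ℂ) := fun x f =>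
    AddMonoidHom.mulLeft (ContinuousMap.const ℝ (Smooth.eval n f x))
  let evC : ℝ → C(ℝ, ℂ) →+ ℂ := fun s =>
    { toFun := fun c => c s, map_zero' := rfl, map_add' := fun _ _ => rfl }
  have hT : ∀ x (Φ : (Fin k → Smooth n) → C(ℝ, ℂ)) f,
      hochschild (pointAct x) (pointAct x) k (fun w => T (Φ w)) f =
        ∫ s in (0 : ℝ)..1, hochschild (pointAct x) (pointAct x) k (fun w => Φ w s) f := by
    intro x Φ f
    have hTact : ∀ a v, T (act x a v) = pointAct x a (T v) := fun a v =>
      intervalIntegral.integral_const_mul _ _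
    rw [hochschild_map (act x) (act x) (pointAct x) (pointAct x) T hTact hTact]
    refine intervalIntegral.integral_congr fun s _ => ?_
    exact (hochschild_map (act x) (act x) (pointAct x) (pointAct x) (evC s)
      (fun _ _ => rfl) (fun _ _ => rfl) k Φ f).symm
  let C : EuclideanSpace ℝ (Fin n) → Fin n → Fin (k + 1) → (Fin k → Smooth n) → C(ℝ, ℂ) :=
    fun x i l g => ⟨_, continuous_eval_insertNth_centered hφ l i x g⟩
  have hAT : ∀ l i g x, Smooth.eval n (A l i g) x = T (C x i l g) := hAe
  let ι : EuclideanSpace ℝ (Fin n) → Fin n → (Fin k → Smooth n) → C(ℝ, ℂ) := fun x i g =>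
    ∑ l : Fin (k + 1), (-1 : ℤ) ^ (l : ℕ) • C x i l g
  have hι : ∀ x i g s, ι x i g s =
      iota (centered x i) k (fun w => Smooth.eval n (φ w) x) (dil s x ∘ g) := fun x i g s => by
    rw [iota_eq_sum]
    change evC s (ι x i g) = _
    rw [map_sum]
    exact Finset.sum_congr rfl fun l _ => map_zsmul _ _ _
  let H : EuclideanSpace ℝ (Fin n) → Fin n → (Fin k → Smooth n) → C(ℝ, ℂ) := fun x i g =>
    ∑ j, ∑ l, shuffleSign k j l • C x i l (Function.update g j (partialQ i (g j)))
  have hH : ∀ x i g s, H x i g s = shuffleH (dil s x) (fun g => dil s x (partialQ i g))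
      (centered x i) k (fun w => Smooth.eval n (φ w) x) g := fun x i g s => by
    rw [shuffleH_eq_sum]
    change evC s (H x i g) = _
    simp only [H, map_sum, map_zsmul, hupdate]
    rfl
  -- At `x`, `ψ i` is the average of the insertion of `q^i - x^i` into `φ` on dilated arguments, and
  -- `χ i` below is the average of the homotopy.
  let ψ : Fin n → (Fin k → Smooth n) → Smooth n := fun i =>
    ∑ l : Fin (k + 1), (-1 : ℤ) ^ (l : ℕ) • A l i
  have hψ : ∀ i g x, Smooth.eval n (ψ i g) x = T (ι x i g) := fun i g x => by
    simp only [ψ, ι, Finset.sum_apply, map_sum, Pi.smul_apply, map_zsmul, hAT]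
  let χ : Fin n → (Fin k → Smooth n) → Smooth n := fun i => ∑ j, ∑ l, shuffleSign k j l •
    fun f => A l i (Function.update f j (partialQ i (f j)))
  have hχ : ∀ i g x, Smooth.eval n (χ i g) x = T (H x i g) := fun i g x => by
    simp only [χ, H, Finset.sum_apply, map_sum, Pi.smul_apply, map_zsmul, hAT]
  refine ⟨ψ, ∑ i, χ i, fun i => ⟨IsRegular.sum _ fun l _ => (hA l i).zsmul _, ?_⟩,
    IsRegular.sum _ fun i _ => IsRegular.sum _ fun j _ => IsRegular.sum _ fun l _ =>
      ((hA l i).update_partialQ j i).zsmul _, fun f => ?_⟩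
  · funext f
    refine Smooth.eval_ext fun x => ?_
    rw [eval_scalarDelta]
    simp only [hψ]
    rw [hT, Pi.zero_apply, map_zero, Pi.zero_apply]
    simp only [hι]
    refine (intervalIntegral.integral_congr (g := fun _ => (0 : ℂ)) fun s _ => ?_).trans (by simp)
    -- For each `s`, insertion into the cocycle `φ` is a cocycle because both actions at `x` agree.
    -- Dilation preserves this.
    have h1 := hochschild_comp (pointAct x) (pointAct x) (dil s x) (map_mul _)
      (fun a => by rw [pointAct, eval_dil_self]; rfl)
      (fun a => by rw [pointAct, eval_dil_self]; rfl)
      k (iota (centered x i) k fun w => Smooth.eval n (φ w) x) f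
    have h2 := iota_hochschild_add_hochschild_iota (pointAct x) (pointAct x) (centered x i) k
      (fun w => Smooth.eval n (φ w) x) (dil s x ∘ f)
    have h3 : iota (centered x i) (k + 1) (0 : (Fin (k + 2) → Smooth n) → ℂ) (dil s x ∘ f) = 0 := by
      simp [iota_eq_sum]
    rw [hcocycle, h3, zero_add, sub_self] at h2
    exact h1.trans h2
  · refine Smooth.eval_ext fun x => ?_
    obtain ⟨a, w, rfl⟩ := exists_eq_vecCons f
    have h1 := integral_derivSum hφ.continuous_type (a ∷ w) x
    -- The homotopy formula for a cocycle, applicable because `q^i - x^i` acts by zero at `x`.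
    have h2 : ∀ i s, hochschild (pointAct x) (pointAct x) k (fun w => H x i w s) (a ∷ w) =
        Smooth.eval n (partialQ i a) x * ι x i w s -
          derivSum (dil s x) (fun g => dil s x (partialQ i g)) (centered x i) (k + 1)
            (fun g => Smooth.eval n (φ g) x) (a ∷ w) := fun i s => by
      have h3 := shuffleH_hochschild_add (pointAct x) (pointAct x) (dil s x)
        (fun g => dil s x (partialQ i g)) (centered x i) (map_mul _)
        (fun a b => by simp only [partialQ_mul, map_add, map_mul])
        (fun a => by rw [pointAct, eval_dil_self]; rfl)
        (fun a => by rw [pointAct, eval_dil_self]; rfl)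
        (by rw [pointAct, eval_centered]; ext; simp) k (fun w => Smooth.eval n (φ w) x)
        (fun f j a b => by
          dsimp only
          rw [hφ.isMultiLin.isMultiAdd f j a b, map_add, Pi.add_apply]) a w
      have h4 : shuffleH (dil s x) (fun g => dil s x (partialQ i g)) (centered x i) (k + 1)
          (0 : (Fin (k + 2) → Smooth n) → ℂ) (a ∷ w) = 0 := by
        simp [shuffleH_eq_sum]
      rw [hcocycle, h4, zero_add, pointAct, eval_dil_self] at h3
      simp only [hH, hι]
      exact h3
    have h5 : Smooth.eval n (scalarDelta n k (∑ i, χ i) (a ∷ w)) x =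
        ∑ i, (Smooth.eval n (partialQ i a) x * T (ι x i w)) -
        ∑ i, ∫ s in (0 : ℝ)..1, derivSum (dil s x) (fun g => dil s x (partialQ i g))
          (centered x i) (k + 1) (fun g => Smooth.eval n (φ g) x) (a ∷ w) := by
      rw [scalarDelta, hochschild_sum, map_sum, Finset.sum_apply, ← Finset.sum_sub_distrib]
      refine Finset.sum_congr rfl fun i _ => ?_
      rw [eval_scalarDelta]
      simp only [hχ]
      rw [hT]
      simp only [h2]
      rw [intervalIntegral.integral_sub
        (((ι x i w).continuous.intervalIntegrable 0 1).const_mul _)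
        ((continuous_derivSum_dil hφ.continuous _ x i).intervalIntegrable 0 1),
        intervalIntegral.integral_const_mul]
      rfl
    rw [map_sub, Pi.sub_apply, h5, h1, map_add, Pi.add_apply, map_sum,
      Finset.sum_apply]
    simp only [Smooth.eval_mul, hψ, Matrix.cons_val_zero, Matrix.tail_cons]
    ring

end ScalarCohomology

/-! ### The Hochschild-Kostant-Rosenberg theorem -/

section HKR

local infixr:67 " ∷ " => Matrix.vecCons

variable {n k : ℕ} {t : CochainType}

/-- Coboundaries of regular scalar cochains. -/
def IsScalarCoboundary (t : CochainType) : (k : ℕ) → ((Fin k → Smooth n) → Smooth n) → Prop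
  | 0, β => β = 0
  | k + 1, β => ∃ χ : (Fin k → Smooth n) → Smooth n,
      IsRegular t Set.univ χ ∧ β = scalarDelta n k χ

theorem scalarDelta_add (φ ψ : (Fin k → Smooth n) → Smooth n) :
    scalarDelta n k (φ + ψ) = scalarDelta n k φ + scalarDelta n k ψ := by
  funext f
  have := hochschild_sum (V := Smooth n) Finset.univ AddMonoidHom.mulLeft AddMonoidHom.mulLeft k
    ![φ, ψ] f
  simpa [Fin.sum_univ_two] using this

theorem scalarDelta_mul (c : Smooth n) (φ : (Fin k → Smooth n) → Smooth n) :
    (scalarDelta n k fun f => c * φ f) = fun f => c * scalarDelta n k φ f := by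
  funext f
  exact hochschild_map (V := Smooth n) _ _ _ _ (AddMonoidHom.mulLeft c)
    (fun a v => by simp only [AddMonoidHom.coe_mulLeft]; ring)
    (fun a v => by simp only [AddMonoidHom.coe_mulLeft]; ring) k φ f

namespace IsScalarCoboundary

theorem zero (t : CochainType) : ∀ k, IsScalarCoboundary (n := n) t k 0
  | 0 => rfl
  | k + 1 => ⟨0, .zero t _, by funext f; simp [scalarDelta, hochschild_eq_sum]⟩

theorem add : ∀ {k} {β γ : (Fin k → Smooth n) → Smooth n}, IsScalarCoboundary t k β →
    IsScalarCoboundary t k γ → IsScalarCoboundary t k (β + γ)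
  | 0, _, _, hβ, hγ => by
    change _ = _
    rw [show _ = _ from hβ, show _ = _ from hγ, add_zero]
  | k + 1, _, _, ⟨χ, hχ, hβ⟩, ⟨η, hη, hγ⟩ =>
    ⟨χ + η, hχ.add hη, by rw [hβ, hγ, scalarDelta_add]⟩

theorem mulLeft (c : Smooth n) : ∀ {k} {β : (Fin k → Smooth n) → Smooth n},
    IsScalarCoboundary t k β → IsScalarCoboundary t k fun f => c * β f
  | 0, _, hβ => by
    change _ = _
    rw [show _ = _ from hβ]
    simp
    rfl
  | k + 1, _, ⟨χ, hχ, hβ⟩ => ⟨fun f => c * χ f, hχ.mulLeft c, by rw [hβ, scalarDelta_mul]⟩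

theorem smul (c : ℂ) {β : (Fin k → Smooth n) → Smooth n} (hβ : IsScalarCoboundary t k β) :
    IsScalarCoboundary t k (c • β) := by
  have : c • β = fun f => algebraMap ℂ (Smooth n) c * β f := by
    funext f
    rw [Pi.smul_apply, Algebra.smul_def]
  rw [this]
  exact hβ.mulLeft _

theorem zsmul (c : ℤ) {β : (Fin k → Smooth n) → Smooth n} (hβ : IsScalarCoboundary t k β) :
    IsScalarCoboundary t k (c • β) := by
  have : c • β = (c : ℂ) • β := by rw [Int.cast_smul_eq_zsmul]
  rw [this]
  exact hβ.smul _

theorem sum {ι : Type*} (s : Finset ι) {β : ι → (Fin k → Smooth n) → Smooth n}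
    (h : ∀ i ∈ s, IsScalarCoboundary t k (β i)) : IsScalarCoboundary t k (∑ i ∈ s, β i) := by
  classical
  induction s using Finset.induction_on with
  | empty => exact .zero t k
  | insert a s ha ih =>
    rw [Finset.sum_insert ha]
    exact (h a (by simp)).add (ih fun i hi => h i (by simp [hi]))

theorem sub {β γ : (Fin k → Smooth n) → Smooth n} (hβ : IsScalarCoboundary t k β)
    (hγ : IsScalarCoboundary t k γ) : IsScalarCoboundary t k (β - γ) := by
  rw [sub_eq_add_neg, ← neg_one_zsmul]
  exact hβ.add (hγ.zsmul _)

end IsScalarCoboundary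

/-! ### Products of derivations up to coboundaries -/

/-- The cup product of a linear operator with a cochain. -/
def cup (T : Module.End ℂ (Smooth n)) (ψ : (Fin k → Smooth n) → Smooth n)
    (f : Fin (k + 1) → Smooth n) : Smooth n :=
  T (f 0) * ψ (Matrix.vecTail f)

theorem IsRegular.cup {T : Module.End ℂ (Smooth n)} {ψ : (Fin k → Smooth n) → Smooth n}
    (hT : IsRegular t {0} fun f : Fin (k + 1) → Smooth n => T (f 0))
    (hψ : IsRegular t Set.univ ψ) : IsRegular t Set.univ (cup T ψ) := by
  have h1 : IsRegular t (⋃ j : Fin k, {j.succ}) fun f : Fin (k + 1) → Smooth n =>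
      ψ fun j => f j.succ := by
    refine hψ.comp' (fun i j hij => ?_) fun j => IsRegular.proj t j.succ
    simpa [Function.onFun] using hij
  refine (hT.mul h1 ?_).congr_set ?_
  · simp
  · ext i
    refine Fin.cases ?_ (fun i => ?_) i <;> simp

/-- The coefficient of `ψ w` is the failure of `T` to be a derivation. It vanishes for `∂_i`, and
for `∂_i ∂_j` it is `-(∂_i a ∂_j b + ∂_j a ∂_i b)`. -/
theorem scalarDelta_cup (T : Module.End ℂ (Smooth n)) (ψ : (Fin k → Smooth n) → Smooth n)
    (a b : Smooth n) (w : Fin k → Smooth n) :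
    scalarDelta n (k + 1) (cup T ψ) (a ∷ b ∷ w) =
      (a * T b - T (a * b) + T a * b) * ψ w - T a * scalarDelta n k ψ (b ∷ w) := by
  have h : rho (V := Smooth n) AddMonoidHom.mulLeft k (fun w => T a * ψ w) (b ∷ w) =
      T a * rho (V := Smooth n) AddMonoidHom.mulLeft k ψ (b ∷ w) :=
    rho_map _ _ (AddMonoidHom.mulLeft (T a))
      (fun a v => by simp only [AddMonoidHom.coe_mulLeft]; ring) k ψ (b ∷ w)
  have h2 : (fun w => cup T ψ (a ∷ w)) = fun w => T a * ψ w := rfl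
  have h3 : scalarDelta n k ψ (b ∷ w) =
      b * ψ w - rho (V := Smooth n) AddMonoidHom.mulLeft k ψ (b ∷ w) := rfl
  rw [scalarDelta, hochschild_cons, rho_cons, h2, h, h3]
  simp only [cup, AddMonoidHom.coe_mulLeft, Matrix.cons_val_zero, Matrix.tail_cons]
  ring

/-- For a derivation the differential passes through the cup product with a sign, so `∂_i ∪ δχ =
-δ(∂_i ∪ χ)`. -/
theorem IsScalarCoboundary.cup (i : Fin n) : ∀ {k} {β : (Fin k → Smooth n) → Smooth n},
    IsScalarCoboundary t k β → IsScalarCoboundary t (k + 1) (FormalWeyl.cup (partialQ i) β)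
  | 0, β, hβ => by
    have : FormalWeyl.cup (partialQ i) β = 0 := by
      funext f
      simp [FormalWeyl.cup, show β = 0 from hβ]
    rw [this]
    exact .zero t _
  | k + 1, β, ⟨χ, hχ, hβ⟩ => by
    refine ⟨(-1 : ℤ) • FormalWeyl.cup (partialQ i) χ,
      (IsRegular.cup ((IsRegular.proj t 0).partialQ i) hχ).zsmul _, ?_⟩
    have h : (-1 : ℤ) • FormalWeyl.cup (partialQ i) χ =
        fun f => (-1 : Smooth n) * FormalWeyl.cup (partialQ i) χ f := by
      funext f
      simp
    rw [h, scalarDelta_mul]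
    funext f
    obtain ⟨a, w, rfl⟩ := exists_eq_vecCons f
    obtain ⟨b, w, rfl⟩ := exists_eq_vecCons w
    rw [scalarDelta_cup, partialQ_mul, hβ]
    simp only [FormalWeyl.cup, Matrix.cons_val_zero, Matrix.tail_cons]
    ring

/-- The monomial `∂_{I_1} f_1 ⋯ ∂_{I_k} f_k`. -/
def derivMonomial (I : Fin k → Fin n) (f : Fin k → Smooth n) : Smooth n :=
  ∏ j, partialQ (I j) (f j)

theorem derivMonomial_cons (i : Fin n) (I : Fin k → Fin n) :
    derivMonomial (i ∷ I) = cup (partialQ i) (derivMonomial I) := by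
  funext f
  rw [derivMonomial, Fin.prod_univ_succ]
  rfl

theorem isRegular_derivMonomial (I : Fin k → Fin n) : IsRegular t Set.univ (derivMonomial I) := by
  have := IsRegular.prod (t := t) Finset.univ (T := fun j : Fin k => {j})
    (fun j => (IsRegular.proj t j).partialQ (I j)) (by
      intro i j hij
      simpa [Function.onFun] using hij)
  convert this.congr_set (T := Set.univ) (by ext; simp) using 1
  funext f
  simp [derivMonomial]

theorem scalarDelta_derivMonomial (I : Fin k → Fin n) : scalarDelta n k (derivMonomial I) = 0 := by
  induction k with
  | zero =>
    funext f
    simp [scalarDelta, hochschild_eq_sum, derivMonomial]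
  | succ k ih =>
    obtain ⟨i, I, rfl⟩ := exists_eq_vecCons I
    funext f
    obtain ⟨a, w, rfl⟩ := exists_eq_vecCons f
    obtain ⟨b, w, rfl⟩ := exists_eq_vecCons w
    rw [derivMonomial_cons, scalarDelta_cup, ih, partialQ_mul, Pi.zero_apply, Pi.zero_apply]
    ring

/-- The symmetric part is the failure of the second-order operator `∂_i ∂_j` to be a derivation,
cupped with a cocycle. -/
theorem isScalarCoboundary_derivMonomial_swap (i j : Fin n) (I : Fin k → Fin n) :
    IsScalarCoboundary t (k + 2)
      (derivMonomial (i ∷ j ∷ I) + derivMonomial (j ∷ i ∷ I)) := by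
  refine ⟨(-1 : ℤ) • cup (partialQ i * partialQ j) (derivMonomial I),
    (IsRegular.cup (((IsRegular.proj t 0).partialQ j).partialQ i)
      (isRegular_derivMonomial I)).zsmul _, ?_⟩
  have h : (-1 : ℤ) • cup (partialQ i * partialQ j) (derivMonomial I) =
      fun f => (-1 : Smooth n) * cup (partialQ i * partialQ j) (derivMonomial I) f := by
    funext f
    simp
  rw [h, scalarDelta_mul]
  funext f
  obtain ⟨a, w, rfl⟩ := exists_eq_vecCons f
  obtain ⟨b, w, rfl⟩ := exists_eq_vecCons w
  rw [scalarDelta_cup, scalarDelta_derivMonomial]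
  simp only [derivMonomial_cons, cup, Module.End.mul_apply, partialQ_mul, map_add,
    Matrix.cons_val_zero, Matrix.tail_cons, Pi.add_apply, Pi.zero_apply]
  ring

theorem isScalarCoboundary_derivMonomial_adjacent :
    ∀ {k} (I : Fin (k + 1) → Fin n) (j : Fin k), IsScalarCoboundary t (k + 1)
      (derivMonomial I + derivMonomial (I ∘ Equiv.swap j.castSucc j.succ)) := by
  intro k
  induction k with
  | zero => exact fun I j => j.elim0
  | succ k ih =>
    intro I j
    refine Fin.cases ?_ (fun j => ?_) j
    · obtain ⟨a, I, rfl⟩ := exists_eq_vecCons I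
      obtain ⟨b, I, rfl⟩ := exists_eq_vecCons I
      have : (a ∷ b ∷ I) ∘ Equiv.swap (Fin.castSucc 0) (Fin.succ 0) = b ∷ a ∷ I := by
        funext l
        refine Fin.cases ?_ (fun l => ?_) l
        · simp
        · refine Fin.cases ?_ (fun l => ?_) l
          · simp
          · rw [Function.comp_apply, Equiv.swap_apply_of_ne_of_ne]
            · rfl
            · simp
            · simp [Fin.ext_iff]
      rw [this]
      exact isScalarCoboundary_derivMonomial_swap a b I
    · obtain ⟨a, I, rfl⟩ := exists_eq_vecCons I
      have : (a ∷ I) ∘ Equiv.swap (Fin.castSucc j.succ) j.succ.succ =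
          a ∷ (I ∘ Equiv.swap j.castSucc j.succ) := by
        funext l
        refine Fin.cases ?_ (fun l => ?_) l
        · rw [Function.comp_apply, Equiv.swap_apply_of_ne_of_ne]
          · rfl
          · simp [Fin.ext_iff]
          · simp [Fin.ext_iff]
        · rw [Function.comp_apply, ← Fin.succ_castSucc,
            ← (Fin.succ_injective _).map_swap]
          rfl
      rw [this, derivMonomial_cons, derivMonomial_cons]
      have h := (ih I j).cup a
      convert h using 1
      funext f
      simp [cup, mul_add]

/-- Adjacent transpositions generate the symmetric group, and the differences telescope along a
word. -/
theorem isScalarCoboundary_derivMonomial_perm (I : Fin k → Fin n) (σ : Equiv.Perm (Fin k)) :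
    IsScalarCoboundary t k
      (derivMonomial I - (Equiv.Perm.sign σ : ℤ) • derivMonomial (I ∘ σ)) := by
  cases k with
  | zero =>
    rw [Subsingleton.elim σ 1]
    simpa using IsScalarCoboundary.zero t 0
  | succ k =>
    have hσ : σ ∈ Submonoid.closure (Set.range fun i : Fin k =>
        Equiv.swap i.castSucc i.succ) := by
      rw [Equiv.Perm.mclosure_swap_castSucc_succ]
      trivial
    induction hσ using Submonoid.closure_induction generalizing I with
    | mem τ hτ =>
      obtain ⟨j, rfl⟩ := hτ
      rw [Equiv.Perm.sign_swap (Fin.castSucc_lt_succ).ne]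
      simpa using isScalarCoboundary_derivMonomial_adjacent (t := t) I j
    | one => simpa using IsScalarCoboundary.zero t (k + 1)
    | mul σ τ _ _ hσ hτ =>
      have h := (hσ I).add ((hτ (I ∘ σ)).zsmul (Equiv.Perm.sign σ : ℤ))
      convert h using 1
      rw [Equiv.Perm.sign_mul, smul_sub, smul_smul, Equiv.Perm.coe_mul, Function.comp_assoc]
      push_cast
      abel

/-! ### The constant term and the reduction to products of derivations -/

theorem rho_prod (c : Smooth n) (f : Fin (k + 1) → Smooth n) :
    rho (V := Smooth n) AddMonoidHom.mulLeft k (fun f => (∏ j, f j) * c) f =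
      if Even k then (∏ j, f j) * c else 0 := by
  induction k generalizing c with
  | zero => simp [rho]
  | succ k ih =>
    obtain ⟨a, w, rfl⟩ := exists_eq_vecCons f
    obtain ⟨b, w, rfl⟩ := exists_eq_vecCons w
    have h : (fun w => (∏ j, (a ∷ w) j) * c) =
        fun w : Fin k → Smooth n => (∏ j, w j) * (a * c) := by
      funext w
      rw [Fin.prod_univ_succ]
      simp only [Matrix.cons_val_zero, Matrix.cons_val_succ]
      ring
    rw [rho_cons, h, ih]
    simp only [Fin.prod_univ_succ, Matrix.cons_val_zero, Matrix.cons_val_succ, Nat.even_add_one]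
    by_cases hk : Even k
    · simp [hk]; ring
    · simp [hk]; ring

theorem rho_one (φ : (Fin k → Smooth n) → Smooth n) :
    rho (V := Smooth n) AddMonoidHom.mulLeft k φ (fun _ => 1) =
      if Even k then φ fun _ => 1 else 0 := by
  induction k with
  | zero => simp [rho, Subsingleton.elim ![] fun _ => (1 : Smooth n)]
  | succ k ih =>
    have h1 : ∀ k, (fun _ : Fin (k + 1) => (1 : Smooth n)) = 1 ∷ fun _ => 1 := fun k => by
      funext i
      refine Fin.cases ?_ (fun _ => ?_) i <;> rfl
    rw [h1, h1, rho_cons, ← h1 k, ih, mul_one, ← h1]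
    simp only [Nat.even_add_one]
    by_cases hk : Even k <;> simp [hk]

/-- The constant terms in the homotopy formula are coboundaries. -/
theorem isScalarCoboundary_prod {φ : (Fin (k + 1) → Smooth n) → Smooth n}
    (hδ : scalarDelta n (k + 1) φ = 0) :
    IsScalarCoboundary t (k + 1) fun f => (∏ j, f j) * (φ fun _ => 1) := by
  -- In odd degree `k + 1`, evaluating the cocycle identity at `(1, …, 1)` forces the coefficient to
  -- vanish. In even degree, the same product with one argument fewer is a primitive.
  by_cases hk : Even k
  · have h : φ (fun _ => 1) = 0 := by
      have := congrFun hδ fun _ => 1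
      rw [scalarDelta, hochschild, rho_one, if_neg (by simpa [Nat.even_add_one] using hk)] at this
      simpa [Matrix.vecTail, Function.comp_def] using this
    simp only [h, mul_zero]
    exact .zero t _
  · refine ⟨fun f => (∏ j, f j) * (φ fun _ => 1), ?_, ?_⟩
    · have := IsRegular.prod (t := t) Finset.univ (T := fun j : Fin k => {j})
        (fun j => IsRegular.proj (n := n) t j) (by
          intro i j hij
          simpa [Function.onFun] using hij)
      convert (this.congr_set (T := Set.univ) (by ext; simp)).mulLeft (φ fun _ => 1) using 1
      funext f
      simp [mul_comm]
    · funext f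
      rw [scalarDelta, hochschild, rho_prod, if_neg hk, Fin.prod_univ_succ]
      simp [Matrix.vecTail, mul_assoc]

/-- Every regular cocycle is cohomologous to a combination of products of derivations. -/
theorem exists_derivMonomial_sum (φ : (Fin k → Smooth n) → Smooth n)
    (hφ : IsRegular t Set.univ φ) (hδ : scalarDelta n k φ = 0) :
    ∃ c : (Fin k → Fin n) → Smooth n,
      IsScalarCoboundary t k (φ - ∑ I, fun f => c I * derivMonomial I f) := by
  induction k with
  | zero =>
    refine ⟨fun _ => φ ![], ?_⟩
    change _ = _
    funext f
    simp [derivMonomial, Subsingleton.elim f ![]]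
  | succ k ih =>
    obtain ⟨ψ, χ, hψ, hχ, h⟩ := exists_decomposition hφ hδ
    choose c hc using fun i => ih (ψ i) (hψ i).1 (hψ i).2
    -- The first index belongs to the derivative split off by the homotopy formula, the others to
    -- the monomials of `ψ i`.
    refine ⟨fun I => c (I 0) (Matrix.vecTail I), ?_⟩
    have h1 := ((isScalarCoboundary_prod (t := t) hδ).add
      (IsScalarCoboundary.sum Finset.univ fun i _ => (hc i).cup i)).sub
      (⟨χ, hχ, rfl⟩ : IsScalarCoboundary t (k + 1) (scalarDelta n k χ))
    convert h1 using 1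
    funext f
    have h2 : ∑ I : Fin (k + 1) → Fin n, c (I 0) (Matrix.vecTail I) * derivMonomial I f =
        ∑ i, ∑ I : Fin k → Fin n, c i I * derivMonomial (i ∷ I) f := by
      rw [← (Fin.consEquiv fun _ => Fin n).sum_comp, Fintype.sum_prod_type]
      rfl
    simp only [Pi.sub_apply, Pi.add_apply, Finset.sum_apply, h2, cup, h f, mul_sub,
      Finset.sum_sub_distrib, Finset.mul_sum, derivMonomial_cons]
    have h3 : ∀ (i : Fin n) (I : Fin k → Fin n), partialQ i (f 0) *
        (c i I * derivMonomial I (Matrix.vecTail f)) =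
        c i I * (partialQ i (f 0) * derivMonomial I (Matrix.vecTail f)) := fun i I => by ring
    simp only [h3]
    ring

theorem derivMonomial_coord (I J : Fin k → Fin n) :
    derivMonomial I (fun j => coord (J j)) = if I = J then 1 else 0 := by
  simp only [derivMonomial, partialQ_coord]
  split_ifs with h
  · subst h; simp
  · obtain ⟨j, hj⟩ := Function.ne_iff.1 h
    exact Finset.prod_eq_zero (Finset.mem_univ j) (if_neg hj)

/-- The two actions coincide, so all commutators vanish. -/
theorem sum_sign_scalarDelta (χ : (Fin k → Smooth n) → Smooth n) (f : Fin (k + 1) → Smooth n) :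
    ∑ σ : Equiv.Perm (Fin (k + 1)), (Equiv.Perm.sign σ : ℤ) • scalarDelta n k χ (f ∘ σ) = 0 := by
  rw [scalarDelta, sum_sign_hochschild]
  simp

/-- The injectivity half of the Hochschild-Kostant-Rosenberg theorem: a regular cocycle whose
alternation vanishes on the coordinate functions is a coboundary. -/
theorem isScalarCoboundary_of_alternation_eq_zero {φ : (Fin (k + 1) → Smooth n) → Smooth n}
    (hφ : IsRegular t Set.univ φ) (hδ : scalarDelta n (k + 1) φ = 0)
    (halt : ∀ J : Fin (k + 1) → Fin n, ∑ σ : Equiv.Perm (Fin (k + 1)),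
      (Equiv.Perm.sign σ : ℤ) • φ (fun j => coord (J (σ j))) = 0) :
    IsScalarCoboundary t (k + 1) φ := by
  obtain ⟨c, hc⟩ := exists_derivMonomial_sum φ hφ hδ
  -- Evaluation on coordinate functions reads off the coefficients, and the alternation does not see
  -- the coboundary.
  have hc0 : ∀ J, ∑ σ : Equiv.Perm (Fin (k + 1)), (Equiv.Perm.sign σ : ℤ) • c (J ∘ σ) = 0 := by
    intro J
    obtain ⟨χ, -, hχ⟩ := hc
    have h1 := sum_sign_scalarDelta χ fun j => coord (J j)
    rw [← hχ] at h1
    have h2 : ∀ σ : Equiv.Perm (Fin (k + 1)), (fun j => coord (n := n) (J j)) ∘ σ =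
      fun j => coord ((J ∘ σ) j) := fun σ => rfl
    simp only [Pi.sub_apply, Finset.sum_apply, h2, derivMonomial_coord, smul_sub,
      Finset.sum_sub_distrib, mul_ite, mul_one, mul_zero, Finset.sum_ite_eq', Finset.mem_univ,
      if_true] at h1
    have h3 := halt J
    rw [sub_eq_zero] at h1
    rw [← h1]
    exact h3
  have h1 : IsScalarCoboundary t (k + 1)
      (∑ I, fun f => c I * ∑ σ : Equiv.Perm (Fin (k + 1)),
        (derivMonomial I - (Equiv.Perm.sign σ : ℤ) • derivMonomial (I ∘ σ)) f) := by
    refine IsScalarCoboundary.sum _ fun I _ => IsScalarCoboundary.mulLeft _ ?_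
    have := IsScalarCoboundary.sum (t := t) Finset.univ fun (σ : Equiv.Perm (Fin (k + 1))) _ =>
      isScalarCoboundary_derivMonomial_perm I σ
    convert this using 1
    funext f
    simp
  -- Summation over all permutations turns the second terms into the alternation of `c`, which is
  -- zero. What remains is `(k+1)!` times the combination of monomials.
  have h2 : (∑ I, fun f => c I * ∑ σ : Equiv.Perm (Fin (k + 1)),
        (derivMonomial I - (Equiv.Perm.sign σ : ℤ) • derivMonomial (I ∘ σ)) f) =
      ((k + 1).factorial : ℂ) • ∑ I, fun f => c I * derivMonomial I f := by
    funext f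
    have h4 : ∀ σ : Equiv.Perm (Fin (k + 1)),
        ∑ I, c I * ((Equiv.Perm.sign σ : ℤ) • derivMonomial (I ∘ σ) f) =
        ∑ I, ((Equiv.Perm.sign σ⁻¹ : ℤ) • c (I ∘ ⇑σ⁻¹)) * derivMonomial I f := fun σ => by
      -- Reindexing moves the permutation from the monomials to the coefficients.
      rw [← (Equiv.arrowCongr σ (Equiv.refl (Fin n))).sum_comp]
      refine Finset.sum_congr rfl fun I _ => ?_
      have h5 : (Equiv.arrowCongr σ (Equiv.refl (Fin n)) I) ∘ σ = I := by
        funext j; simp [Equiv.arrowCongr]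
      have h6 : Equiv.arrowCongr σ (Equiv.refl (Fin n)) I = I ∘ ⇑σ⁻¹ := rfl
      rw [h5, h6, Equiv.Perm.sign_inv, mul_smul_comm, smul_mul_assoc]
    have h7 : ∑ σ : Equiv.Perm (Fin (k + 1)),
        ∑ I, ((Equiv.Perm.sign σ⁻¹ : ℤ) • c (I ∘ ⇑σ⁻¹)) * derivMonomial I f = 0 := by
      rw [Finset.sum_comm]
      refine Finset.sum_eq_zero fun I _ => ?_
      have h8 := Equiv.sum_comp (Equiv.inv (Equiv.Perm (Fin (k + 1))))
        fun σ => (Equiv.Perm.sign σ : ℤ) • c (I ∘ ⇑σ)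
      rw [hc0] at h8
      rw [← Finset.sum_mul]
      exact mul_eq_zero_of_left h8 _
    simp only [Finset.sum_apply, Pi.smul_apply, Pi.sub_apply, Finset.mul_sum, mul_sub,
      Finset.sum_sub_distrib]
    rw [Finset.sum_comm (f := fun I (σ : Equiv.Perm (Fin (k + 1))) =>
      c I * ((Equiv.Perm.sign σ : ℤ) • derivMonomial (I ∘ σ) f))]
    simp only [h4, h7, sub_zero, Finset.sum_const, Finset.card_univ, Fintype.card_perm,
      Fintype.card_fin, Finset.smul_sum, Nat.cast_smul_eq_nsmul]
  rw [h2] at h1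
  have h3 := hc.add (h1.smul (((k + 1).factorial : ℂ)⁻¹))
  rwa [smul_smul, inv_mul_cancel₀ (Nat.cast_ne_zero.2 (Nat.factorial_ne_zero _)), one_smul,
    sub_add_cancel] at h3

end HKR

/-! ### The bimodule structure of the formal Weyl algebra -/

section Star

variable {n : ℕ}

/-- The action of formal series of operators on formal series. -/
def opAct (T : PowerSeries (Module.End ℂ (W₀ n))) : W n →+ W n where
  toFun a := PowerSeries.mk fun r => ∑ x ∈ Finset.HasAntidiagonal.antidiagonal r,
    PowerSeries.coeff x.1 T (PowerSeries.coeff x.2 a)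
  map_zero' := by ext1 r; simp
  map_add' a b := by ext1 r; simp [Finset.sum_add_distrib]

theorem coeff_opAct (T : PowerSeries (Module.End ℂ (W₀ n))) (a : W n) (r : ℕ) :
    PowerSeries.coeff r (opAct T a) = ∑ x ∈ Finset.HasAntidiagonal.antidiagonal r,
      PowerSeries.coeff x.1 T (PowerSeries.coeff x.2 a) := by
  change PowerSeries.coeff r (PowerSeries.mk fun r => ∑ x ∈ Finset.HasAntidiagonal.antidiagonal r,
    PowerSeries.coeff x.1 T (PowerSeries.coeff x.2 a)) = _
  rw [PowerSeries.coeff_mk]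

theorem opAct_mul (S T : PowerSeries (Module.End ℂ (W₀ n))) (a : W n) :
    opAct (S * T) a = opAct S (opAct T a) := by
  ext1 r
  simp only [coeff_opAct, PowerSeries.coeff_mul, map_sum, LinearMap.sum_apply,
    Module.End.mul_apply, Finset.sum_sigma']
  refine Finset.sum_nbij' (fun z => ⟨(z.2.1, z.2.2 + z.1.2), (z.2.2, z.1.2)⟩)
    (fun z => ⟨(z.1.1 + z.2.1, z.2.2), (z.1.1, z.2.1)⟩) ?_ ?_ ?_ ?_ ?_
  all_goals
    rintro ⟨⟨a1, a2⟩, ⟨b1, b2⟩⟩ hz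
    simp only [Finset.mem_sigma, Finset.HasAntidiagonal.mem_antidiagonal, Sigma.mk.injEq, heq_eq_eq,
      Prod.mk.injEq, and_true, true_and] at hz ⊢
    try omega

theorem coeff_dP (i : Fin n) (a : W₀ n) (α : Fin n →₀ ℕ) :
    MvPowerSeries.coeff α (dP i a) =
      ((α i + 1 : ℕ) : ℂ) • MvPowerSeries.coeff (α + Finsupp.single i 1) a := by
  refine (MvPowerSeries.coeff_pderiv _ _).trans ?_
  rw [Nat.cast_smul_eq_nsmul, nsmul_eq_mul, mul_comm]
  push_cast
  rfl

theorem dP_C_mul (i : Fin n) (f : Smooth n) (a : W₀ n) :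
    dP i (MvPowerSeries.C f * a) = MvPowerSeries.C f * dP i a := by
  ext1 α
  rw [MvPowerSeries.coeff_C_mul, coeff_dP, coeff_dP, MvPowerSeries.coeff_C_mul, mul_smul_comm]

theorem dP_C (i : Fin n) (f : Smooth n) : dP i (MvPowerSeries.C f : W₀ n) = 0 :=
  MvPowerSeries.pderiv_C

theorem dQ_C (i : Fin n) (f : Smooth n) :
    dQ i (MvPowerSeries.C f : W₀ n) = MvPowerSeries.C (partialQ i f) := by
  classical
  ext1 α
  change partialQ i (MvPowerSeries.coeff α _) = _
  rw [MvPowerSeries.coeff_C, MvPowerSeries.coeff_C]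
  split_ifs <;> simp

theorem dP_comm (i j : Fin n) (a : W₀ n) : dP i (dP j a) = dP j (dP i a) := by
  rcases eq_or_ne i j with rfl | h
  · rfl
  ext1 α
  simp only [coeff_dP, Finsupp.add_apply, Finsupp.single_eq_of_ne h, Finsupp.single_eq_of_ne h.symm,
    add_zero]
  rw [smul_comm, add_right_comm]

/-- Multiplication by a function. -/
def mulC (f : Smooth n) : Module.End ℂ (W₀ n) := LinearMap.mulLeft ℂ (MvPowerSeries.C f)

/-- The operator `a ↦ ∑ (1/s!) ∂_{k_1} ⋯ ∂_{k_s} f ∂_{p_{k_1}} ⋯ ∂_{p_{k_s}} a`. -/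
def moyal : ℕ → Smooth n → Module.End ℂ (W₀ n)
  | 0, f => mulC f
  | s + 1, f => ((s + 1 : ℕ) : ℂ)⁻¹ • ∑ k, moyal s (partialQ k f) * dP k

theorem moyal_succ (s : ℕ) (f : Smooth n) : ((s + 1 : ℕ) : ℂ) • moyal (s + 1) f =
    ∑ k, moyal s (partialQ k f) * dP k := by
  rw [moyal, smul_smul, mul_inv_cancel₀ (Nat.cast_ne_zero.2 s.succ_ne_zero), one_smul]

theorem moyal_add (s : ℕ) (f g : Smooth n) : moyal s (f + g) = moyal s f + moyal s g := by
  induction s generalizing f g with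
  | zero => simp [moyal, mulC]; ext; simp [add_mul]
  | succ s ih => simp only [moyal, map_add, ih, add_mul, Finset.sum_add_distrib, smul_add]

theorem commute_moyal_dP (s : ℕ) (f : Smooth n) (i : Fin n) : Commute (moyal s f) (dP i) := by
  induction s generalizing f with
  | zero => exact LinearMap.ext fun a => (dP_C_mul i f a).symm
  | succ s ih =>
    refine Commute.smul_left (Commute.sum_left _ _ _ fun k _ => (ih _).mul_left ?_) _
    exact LinearMap.ext fun a => dP_comm k i a

theorem commute_moyal (s t : ℕ) (f g : Smooth n) : Commute (moyal s f) (moyal t g) := by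
  induction s generalizing f with
  | zero =>
    induction t generalizing g with
    | zero => exact LinearMap.ext fun a => mul_left_comm _ _ _
    | succ t ih =>
      exact Commute.smul_right (Commute.sum_right _ _ _ fun k _ =>
        (ih _).mul_right (commute_moyal_dP 0 f k)) _
  | succ s ih =>
    exact Commute.smul_left (Commute.sum_left _ _ _ fun k _ =>
      (ih _).mul_left (commute_moyal_dP t g k).symm) _

/-- This is the Leibniz rule in divided-power form. It makes `⋆`-multiplication by functions
multiplicative and so gives a bimodule. -/
theorem moyal_mul (s : ℕ) (f g : Smooth n) : moyal s (f * g) =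
    ∑ x ∈ Finset.HasAntidiagonal.antidiagonal s, moyal x.1 f * moyal x.2 g := by
  induction s generalizing f g with
  | zero =>
    ext1 a
    simp [moyal, mulC]
  | succ s ih =>
    have h0 : ((s + 1 : ℕ) : ℂ) ≠ 0 := Nat.cast_ne_zero.2 s.succ_ne_zero
    -- After multiplication by `s + 1`, writing `s + 1 = x.1 + x.2` in each term lets the recursion
    -- act on either factor.
    refine smul_right_injective _ h0 ?_
    have h1 : ((s + 1 : ℕ) : ℂ) • ∑ x ∈ Finset.HasAntidiagonal.antidiagonal (s + 1),
        moyal x.1 f * moyal x.2 g =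
        ∑ x ∈ Finset.HasAntidiagonal.antidiagonal (s + 1),
          ((x.1 : ℂ) • moyal x.1 f * moyal x.2 g + moyal x.1 f * (x.2 : ℂ) • moyal x.2 g) := by
      rw [Finset.smul_sum]
      refine Finset.sum_congr rfl fun x hx => ?_
      rw [← Finset.HasAntidiagonal.mem_antidiagonal.1 hx]
      rw [smul_mul_assoc, mul_smul_comm, ← add_smul]
      push_cast
      rfl
    dsimp only
    rw [h1, moyal_succ, Finset.sum_add_distrib, Finset.Nat.sum_antidiagonal_succ,
      Finset.Nat.sum_antidiagonal_succ']
    simp only [moyal_succ, partialQ_mul, moyal_add, ih, Nat.cast_zero, zero_smul, zero_mul,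
      mul_zero, zero_add, add_mul, Finset.sum_add_distrib, Finset.sum_mul,
      Finset.mul_sum]
    congr 1
    · rw [Finset.sum_comm]
      refine Finset.sum_congr rfl fun x _ => Finset.sum_congr rfl fun k _ => ?_
      rw [mul_assoc, mul_assoc, (commute_moyal_dP x.2 g k).eq]
    · rw [Finset.sum_comm]
      refine Finset.sum_congr rfl fun x _ => Finset.sum_congr rfl fun k _ => ?_
      rw [mul_assoc]

/-- `∂_p` kills functions of `q`, so one half of the Poisson tensor acts. The factor `s!` cancels
the one in the exponential. -/
theorem mul'_poissonTensor_left (s : ℕ) (f : Smooth n) (a : W₀ n) :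
    LinearMap.mul' ℂ (W₀ n) ((poissonTensor n ^ s) (MvPowerSeries.C f ⊗ₜ[ℂ] a)) =
      (s.factorial : ℂ) • moyal s f a := by
  induction s generalizing f a with
  | zero => simp [moyal, mulC]
  | succ s ih =>
    have h : poissonTensor n (MvPowerSeries.C f ⊗ₜ[ℂ] a) =
        ∑ k, MvPowerSeries.C (partialQ k f) ⊗ₜ[ℂ] dP k a := by
      simp [poissonTensor, dP_C, dQ_C]
    rw [pow_succ, Module.End.mul_apply, h, map_sum, map_sum, Nat.factorial_succ, Nat.cast_mul,
      mul_comm, mul_smul]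
    simp only [ih]
    rw [← Finset.smul_sum, ← LinearMap.smul_apply, moyal_succ]
    simp

/-- Here the other half acts, with a minus sign at each step. Right multiplication is thus left
multiplication with `i/2` replaced by `-i/2`. -/
theorem mul'_poissonTensor_right (s : ℕ) (f : Smooth n) (a : W₀ n) :
    LinearMap.mul' ℂ (W₀ n) ((poissonTensor n ^ s) (a ⊗ₜ[ℂ] MvPowerSeries.C f)) =
      (s.factorial : ℂ) • (-1 : ℂ) ^ s • moyal s f a := by
  induction s generalizing f a with
  | zero => simp [moyal, mulC, mul_comm]
  | succ s ih =>
    have h : poissonTensor n (a ⊗ₜ[ℂ] MvPowerSeries.C f) =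
        -∑ k, dP k a ⊗ₜ[ℂ] MvPowerSeries.C (partialQ k f) := by
      simp [poissonTensor, dP_C, dQ_C]
    rw [pow_succ, Module.End.mul_apply, h, map_neg, map_neg, map_sum, map_sum, Nat.factorial_succ,
      Nat.cast_mul, mul_comm, mul_smul]
    simp only [ih]
    rw [← Finset.smul_sum, ← Finset.smul_sum, smul_comm ((s + 1 : ℕ) : ℂ), ← LinearMap.smul_apply,
      moyal_succ]
    simp [pow_succ]

theorem weylCoeff_C_left (s : ℕ) (f : Smooth n) (a : W₀ n) :
    weylCoeff s (MvPowerSeries.C f) a = (Complex.I / 2) ^ s • moyal s f a := by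
  have h0 : (s.factorial : ℂ) ≠ 0 := Nat.cast_ne_zero.2 s.factorial_ne_zero
  change ((Complex.I / 2) ^ s / (s.factorial : ℂ)) • LinearMap.mul' ℂ (W₀ n)
    ((poissonTensor n ^ s) (MvPowerSeries.C f ⊗ₜ[ℂ] a)) = _
  rw [mul'_poissonTensor_left, smul_smul, div_mul_cancel₀ _ h0]

theorem weylCoeff_C_right (s : ℕ) (f : Smooth n) (a : W₀ n) :
    weylCoeff s a (MvPowerSeries.C f) = (-(Complex.I / 2)) ^ s • moyal s f a := by
  have h0 : (s.factorial : ℂ) ≠ 0 := Nat.cast_ne_zero.2 s.factorial_ne_zero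
  change ((Complex.I / 2) ^ s / (s.factorial : ℂ)) • LinearMap.mul' ℂ (W₀ n)
    ((poissonTensor n ^ s) (a ⊗ₜ[ℂ] MvPowerSeries.C f)) = _
  rw [mul'_poissonTensor_right, smul_smul, div_mul_cancel₀ _ h0, smul_smul, ← mul_pow, mul_neg_one]

/-- The operator of `⋆`-multiplication by `f`, from the left for `c = i/2` and from the right for
`c = -i/2`. -/
def starOp (c : ℂ) (f : Smooth n) : PowerSeries (Module.End ℂ (W₀ n)) :=
  PowerSeries.mk fun s => c ^ s • moyal s f

theorem starOp_mul (c : ℂ) (f g : Smooth n) : starOp c (f * g) = starOp c f * starOp c g := by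
  ext1 s
  rw [PowerSeries.coeff_mul, starOp, PowerSeries.coeff_mk, moyal_mul, Finset.smul_sum]
  refine Finset.sum_congr rfl fun x hx => ?_
  rw [starOp, starOp, PowerSeries.coeff_mk, PowerSeries.coeff_mk, smul_mul_smul_comm, ← pow_add,
    Finset.HasAntidiagonal.mem_antidiagonal.1 hx]

theorem commute_starOp (c d : ℂ) (f g : Smooth n) : Commute (starOp c f) (starOp d g) := by
  refine PowerSeries.ext fun s => ?_
  rw [PowerSeries.coeff_mul, PowerSeries.coeff_mul, ← Finset.Nat.sum_antidiagonal_swap]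
  refine Finset.sum_congr rfl fun x _ => ?_
  simp only [starOp, PowerSeries.coeff_mk, Prod.fst_swap, Prod.snd_swap, smul_mul_smul_comm,
    (commute_moyal x.2 x.1 f g).eq, mul_comm]

/-- Left `⋆`-multiplication. -/
def starL (f : Smooth n) : W n →+ W n := opAct (starOp (Complex.I / 2) f)

/-- Right `⋆`-multiplication. -/
def starR (f : Smooth n) : W n →+ W n := opAct (starOp (-(Complex.I / 2)) f)

theorem coeff_incl (f : Smooth n) (r : ℕ) :
    PowerSeries.coeff r (incl f) = if r = 0 then MvPowerSeries.C f else 0 := by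
  rw [incl, piStar, PowerSeries.coeff_map, PowerSeries.coeff_C]
  split_ifs <;> simp

theorem weylStar_incl_left (f : Smooth n) (a : W n) : weylStar (incl f) a = starL f a := by
  ext1 r
  rw [starL, coeff_opAct, weylStar, PowerSeries.coeff_mk]
  refine Finset.sum_congr rfl fun x _ => ?_
  rw [starOp, PowerSeries.coeff_mk, Finset.sum_eq_single (0, x.2)]
  · simp [coeff_incl, weylCoeff_C_left]
  · rintro ⟨y, z⟩ hy hne
    have : y ≠ 0 := by
      rintro rfl
      exact hne (by simpa using hy)
    simp [coeff_incl, this]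
  · simp

theorem weylStar_incl_right (f : Smooth n) (a : W n) : weylStar a (incl f) = starR f a := by
  ext1 r
  rw [starR, coeff_opAct, weylStar, PowerSeries.coeff_mk]
  refine Finset.sum_congr rfl fun x _ => ?_
  rw [starOp, PowerSeries.coeff_mk, Finset.sum_eq_single (x.2, 0)]
  · simp [coeff_incl, weylCoeff_C_right]
  · rintro ⟨y, z⟩ hy hne
    have : z ≠ 0 := by
      rintro rfl
      exact hne (by simpa using hy)
    simp [coeff_incl, this]
  · simp

theorem delta_eq_hochschild (k : ℕ) (φ : (Fin k → Smooth n) → W n) :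
    delta n k φ = hochschild starL starR k φ := by
  funext f
  rw [hochschild_eq_sum, ← weylStar_incl_left, ← weylStar_incl_right]
  rfl

theorem delta_delta (k : ℕ) (φ : (Fin k → Smooth n) → W n) :
    delta n (k + 1) (delta n k φ) = 0 := by
  rw [delta_eq_hochschild, delta_eq_hochschild]
  funext f
  refine hochschild_hochschild _ _ (fun a b v => ?_) (fun a b v => ?_) (fun a b v => ?_) k φ f
  · rw [starL, starL, starL, starOp_mul, opAct_mul]
  · rw [starR, starR, starR, mul_comm, starOp_mul, opAct_mul]
  · rw [starL, starR, ← opAct_mul, ← opAct_mul, (commute_starOp _ _ a b).eq]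

theorem cl_starL (f : Smooth n) (a : W n) : cl (starL f a) = MvPowerSeries.C f * cl a := by
  rw [cl, cl, ← PowerSeries.coeff_zero_eq_constantCoeff_apply, starL, coeff_opAct]
  simp [starOp, moyal, mulC]

theorem cl_starR (f : Smooth n) (a : W n) : cl (starR f a) = MvPowerSeries.C f * cl a := by
  rw [cl, cl, ← PowerSeries.coeff_zero_eq_constantCoeff_apply, starR, coeff_opAct]
  simp [starOp, moyal, mulC]

/-! ### Commutators with the coordinate functions -/

theorem moyal_algebraMap (s : ℕ) (c : ℂ) : moyal (n := n) (s + 1) (algebraMap ℂ _ c) = 0 := by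
  have h0 : ∀ s, moyal (n := n) s 0 = 0 := fun s => by
    simpa using moyal_add (n := n) s 0 0
  simp [moyal, h0]

theorem moyal_one_coord (i : Fin n) : moyal 1 (coord i) = dP i := by
  have h0 : ∀ s, moyal (n := n) s 0 = 0 := fun s => by
    simpa using moyal_add (n := n) s 0 0
  have h1 : moyal (n := n) 0 1 = 1 := by ext1 a; simp [moyal, mulC]
  rw [moyal]
  simp only [partialQ_coord]
  rw [Finset.sum_eq_single i]
  · simp [h1]
  · intro j _ hj
    simp [hj, h0]
  · simp

theorem moyal_coord (s : ℕ) (i : Fin n) : moyal (s + 2) (coord i) = 0 := by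
  have h : ∀ k, partialQ k (coord i) = algebraMap ℂ (Smooth n) (if k = i then 1 else 0) :=
    fun k => by rw [partialQ_coord]; split_ifs <;> simp
  rw [moyal]
  simp only [h, moyal_algebraMap]
  simp

theorem coeff_zero_starL_sub_starR (f : Smooth n) (a : W n) :
    PowerSeries.coeff 0 (starL f a - starR f a) = 0 := by
  rw [PowerSeries.coeff_zero_eq_constantCoeff_apply, map_sub]
  exact sub_eq_zero.2 ((cl_starL f a).trans (cl_starR f a).symm)

/-- Second derivatives of `q^i` vanish and the terms of order zero cancel. The commutator is
therefore exactly `iλ ∂_{p_i}`, with `i = i/2 - (-i/2)` and no higher corrections. -/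
theorem coeff_succ_starL_sub_starR (i : Fin n) (a : W n) (r : ℕ) :
    PowerSeries.coeff (r + 1) (starL (coord i) a - starR (coord i) a) =
      Complex.I • dP i (PowerSeries.coeff r a) := by
  rw [map_sub, starL, starR, coeff_opAct, coeff_opAct, ← Finset.sum_sub_distrib,
    Finset.sum_eq_single (1, r)]
  · simp only [starOp, PowerSeries.coeff_mk, moyal_one_coord, LinearMap.smul_apply, ← sub_smul]
    congr 1
    ring
  · rintro ⟨s, r'⟩ hs hne
    match s with
    | 0 => simp [starOp]
    | 1 =>
      have : 1 + r' = r + 1 := by simpa using hs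
      exact absurd (by rw [show r' = r by omega]) hne
    | s + 2 => simp [starOp, moyal_coord]
  · simp [add_comm]

end Star

/-! ### Cochains and their coefficients -/

section Cochains

variable {n k m : ℕ} {t : CochainType}

/-- The coefficient of `λ^r p^α`. -/
def coeffW (r : ℕ) (α : Fin n →₀ ℕ) : W n →ₗ[ℂ] Smooth n where
  toFun a := MvPowerSeries.coeff α (PowerSeries.coeff r a)
  map_add' a b := by simp
  map_smul' _ _ := rfl

theorem coeffW_apply (r : ℕ) (α : Fin n →₀ ℕ) (a : W n) :
    coeffW r α a = MvPowerSeries.coeff α (PowerSeries.coeff r a) := rfl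

theorem W_ext {a b : W n} (h : ∀ r α, coeffW r α a = coeffW r α b) : a = b :=
  PowerSeries.ext fun r => MvPowerSeries.ext fun α => h r α

theorem isDifferential_iff (φ : (Fin k → Smooth n) → W n) :
    IsDifferential φ ↔ ∀ r α, IsRegular .differential Set.univ fun f => coeffW r α (φ f) := by
  refine forall_congr' fun r => forall_congr' fun α => ?_
  change _ ↔ _ ∈ diffOps n Set.univ
  rw [diffOps, Finsupp.mem_span_range_iff_exists_finsupp]
  refine exists_congr fun c => ?_
  rw [eq_comm, funext_iff]
  refine forall_congr' fun f => ?_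
  simp [Finsupp.sum, Finset.sum_apply, coeffW_apply]

/-- Both classes of cochains, multilinearity included, are tested coefficient by coefficient.
Everything reduces to scalar cochains. -/
theorem mem_cochains_iff (φ : (Fin k → Smooth n) → W n) :
    φ ∈ cochains t n k ↔ ∀ r α, IsRegular t Set.univ fun f => coeffW r α (φ f) := by
  constructor
  · rintro ⟨⟨M, rfl⟩, h⟩ r α
    cases t
    · exact (isDifferential_iff _).1 h r α
    · refine ⟨⟨fun f j _ a b => ?_, fun f j _ c a => ?_, fun f j hj => absurd trivial hj⟩,
        (continuous_iff_coeff _).1 h r α⟩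
      · rw [M.map_update_add, map_add]
      · rw [M.map_update_smul, map_smul]
  · intro h
    refine ⟨⟨⟨φ, fun {inst} f j a b => W_ext fun r α => ?_, fun {inst} f j c a =>
      W_ext fun r α => ?_⟩, rfl⟩, ?_⟩
    · rw [Subsingleton.elim inst (instDecidableEqFin k), map_add]
      exact (h r α).isMultiLin.add f j trivial a b
    · rw [Subsingleton.elim inst (instDecidableEqFin k), map_smul]
      exact (h r α).isMultiLin.smul f j trivial c a
    · cases t
      · exact (isDifferential_iff _).2 h
      · exact (continuous_iff_coeff _).2 fun r α => (h r α).continuous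

theorem coe_predAbove (i : Fin k) (l : Fin (k + 1)) :
    (i.predAbove l : ℕ) = if (i : ℕ) < l then (l : ℕ) - 1 else l := by
  rw [Fin.predAbove]
  simp only [Fin.lt_def, Fin.val_castSucc]
  split_ifs <;> simp

theorem IsRegular.contractNth {φ : (Fin k → Smooth n) → Smooth n}
    (hφ : IsRegular t Set.univ φ) (i : Fin k) :
    IsRegular t Set.univ fun f : Fin (k + 1) → Smooth n =>
      φ (Fin.contractNth i.castSucc (· * ·) f) := by
  -- The fibre of `predAbove i` over `i` is the pair of arguments that gets multiplied; all other
  -- fibres are singletons.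
  refine hφ.comp (Fin.predAbove i)
    (θ := fun j f => Fin.contractNth i.castSucc (· * ·) f j) fun j => ?_
  rcases lt_trichotomy j i with h | rfl | h
  · simp only [Fin.contractNth_apply_of_lt _ (· * ·) _ j
      (show (j : ℕ) < (i.castSucc : Fin (k + 1)) from h)]
    refine (IsRegular.proj t _).congr_set ?_
    ext l
    simp only [Set.mem_singleton_iff, Set.mem_ofPred_eq, coe_predAbove, Fin.ext_iff, Fin.lt_def,
      Fin.val_castSucc] at h ⊢
    split_ifs <;> omega
  · simp only [Fin.contractNth_apply_of_eq j.castSucc (· * ·) _ j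
      (show (j : ℕ) = (j.castSucc : Fin (k + 1)) from rfl)]
    refine ((IsRegular.proj t _).mul (IsRegular.proj t _) ?_).congr_set ?_
    · simp [Fin.ext_iff]
    ext l
    simp only [Set.mem_union, Set.mem_singleton_iff, Set.mem_ofPred_eq, coe_predAbove, Fin.ext_iff,
      Fin.val_castSucc, Fin.val_succ]
    split_ifs <;> omega
  · simp only [Fin.contractNth_apply_of_gt i.castSucc (· * ·) _ j
      (show (i.castSucc : Fin (k + 1)) < (j : ℕ) from h)]
    refine (IsRegular.proj t _).congr_set ?_
    ext l
    simp only [Set.mem_singleton_iff, Set.mem_ofPred_eq, coe_predAbove, Fin.ext_iff, Fin.lt_def,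
      Fin.val_succ] at h ⊢
    split_ifs <;> omega

theorem isRegular_moyal (s : ℕ) {S T : Set (Fin m)} (hST : Disjoint S T)
    {F : (Fin m → Smooth n) → Smooth n} (hF : IsRegular t S F)
    {A : (Fin m → Smooth n) → W₀ n}
    (hA : ∀ α, IsRegular t T fun f => MvPowerSeries.coeff α (A f)) (α : Fin n →₀ ℕ) :
    IsRegular t (S ∪ T) fun f => MvPowerSeries.coeff α (moyal s (F f) (A f)) := by
  induction s generalizing F A α with
  | zero =>
    convert hF.mul (hA α) hST using 1
    funext f
    exact MvPowerSeries.coeff_C_mul _ _ _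
  | succ s ih =>
    have h := (IsRegular.sum Finset.univ fun (i : Fin n) _ => ih (hF.partialQ i)
      (A := fun f => dP i (A f)) (fun α => by
        simp only [coeff_dP]
        exact (hA _).smul _) α).smul ((s + 1 : ℕ) : ℂ)⁻¹
    convert h using 1
    funext f
    rw [Pi.smul_apply, Finset.sum_apply, moyal, LinearMap.smul_apply, LinearMap.sum_apply]
    have : ∀ (c : ℂ) (a : W₀ n), MvPowerSeries.coeff α (c • a) = c • MvPowerSeries.coeff α a :=
      fun _ _ => rfl
    rw [this, map_sum]
    rfl

theorem isRegular_starOp (c : ℂ) {S T : Set (Fin m)} (hST : Disjoint S T)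
    {F : (Fin m → Smooth n) → Smooth n} (hF : IsRegular t S F)
    {A : (Fin m → Smooth n) → W n}
    (hA : ∀ r α, IsRegular t T fun f => coeffW r α (A f)) (r : ℕ) (α : Fin n →₀ ℕ) :
    IsRegular t (S ∪ T) fun f => coeffW r α (opAct (starOp c (F f)) (A f)) := by
  have h := IsRegular.sum (Finset.HasAntidiagonal.antidiagonal r) fun x _ =>
    (isRegular_moyal x.1 hST hF (A := fun f => PowerSeries.coeff x.2 (A f))
      (fun α => hA x.2 α) α).smul (c ^ x.1)
  convert h using 1
  funext f
  rw [Finset.sum_apply, coeffW_apply, coeff_opAct, map_sum]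
  refine Finset.sum_congr rfl fun x _ => ?_
  rw [starOp, PowerSeries.coeff_mk]
  rfl

theorem delta_mem_cochains {φ : (Fin k → Smooth n) → W n} (hφ : φ ∈ cochains t n k) :
    delta n k φ ∈ cochains t n (k + 1) := by
  have hφ' := (mem_cochains_iff φ).1 hφ
  have h1 : (fun f : Fin (k + 1) → Smooth n => starL (f 0) (φ (Fin.tail f))) ∈
      cochains t n (k + 1) := by
    refine (mem_cochains_iff _).2 fun r α => ?_
    refine (isRegular_starOp (S := {0}) (T := ⋃ j : Fin k, {j.succ}) _ ?_ (.proj t 0)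
      (fun r α => (hφ' r α).comp' (S := fun j : Fin k => {j.succ}) (fun i j hij => ?_)
        fun j => IsRegular.proj t j.succ) r α).congr_set ?_
    · simp
    · simpa [Function.onFun] using hij
    · ext i
      refine Fin.cases ?_ (fun i => ?_) i <;> simp
  have h2 : (fun f : Fin (k + 1) → Smooth n => starR (f (Fin.last k)) (φ (Fin.init f))) ∈
      cochains t n (k + 1) := by
    refine (mem_cochains_iff _).2 fun r α => ?_
    refine (isRegular_starOp (S := {Fin.last k}) (T := ⋃ j : Fin k, {j.castSucc}) _ ?_
      (.proj t _) (fun r α => (hφ' r α).comp' (S := fun j : Fin k => {j.castSucc})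
        (fun i j hij => ?_) fun j => IsRegular.proj t j.castSucc) r α).congr_set ?_
    · simp
    · simpa [Function.onFun] using hij
    · ext i
      refine Fin.lastCases ?_ (fun i => ?_) i <;> simp
  have h3 : ∀ i : Fin k, (fun f : Fin (k + 1) → Smooth n =>
      φ (Fin.contractNth i.castSucc (· * ·) f)) ∈ cochains t n (k + 1) := fun i =>
    (mem_cochains_iff _).2 fun r α => (hφ' r α).contractNth i
  have h4 := add_mem (add_mem h1 (sum_mem (t := Finset.univ) fun i _ =>
    zsmul_mem (h3 i) ((-1 : ℤ) ^ ((i : ℕ) + 1)))) (zsmul_mem h2 ((-1 : ℤ) ^ (k + 1)))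
  convert h4 using 1
  funext f
  rw [delta_eq_hochschild, hochschild_eq_sum]
  simp

/-- At `λ = 0` no `p`-derivatives occur, so the coefficients of different `p^α` do not interact. -/
theorem coeffW_zero_delta (α : Fin n →₀ ℕ) (φ : (Fin k → Smooth n) → W n)
    (f : Fin (k + 1) → Smooth n) :
    coeffW 0 α (delta n k φ f) = scalarDelta n k (fun f => coeffW 0 α (φ f)) f := by
  have hL : ∀ (c : ℂ) (a : Smooth n) (v : W n),
      coeffW 0 α (opAct (starOp c a) v) = a * coeffW 0 α v := fun c a v => by
    rw [coeffW_apply, coeff_opAct]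
    simp [starOp, moyal, mulC, coeffW_apply]
  rw [delta_eq_hochschild, scalarDelta]
  exact (hochschild_map starL starR AddMonoidHom.mulLeft AddMonoidHom.mulLeft
    (coeffW 0 α).toAddMonoidHom (fun a v => hL _ a v) (fun a v => hL _ a v) k φ f).symm

/-- The series in `p` with given coefficients. -/
def seriesOf (g : (Fin n →₀ ℕ) → Smooth n) : W₀ n := g

@[simp]
theorem coeff_seriesOf (g : (Fin n →₀ ℕ) → Smooth n) (α : Fin n →₀ ℕ) :
    MvPowerSeries.coeff α (seriesOf g) = g α := rfl

/-- The cochain independent of `λ` with given coefficients. -/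
def ofCoeff (χ : (Fin n →₀ ℕ) → (Fin k → Smooth n) → Smooth n) (f : Fin k → Smooth n) : W n :=
  PowerSeries.C (seriesOf fun α => χ α f)

theorem coeffW_ofCoeff (χ : (Fin n →₀ ℕ) → (Fin k → Smooth n) → Smooth n) (f : Fin k → Smooth n)
    (r : ℕ) (α : Fin n →₀ ℕ) : coeffW r α (ofCoeff χ f) = if r = 0 then χ α f else 0 := by
  rw [coeffW_apply, ofCoeff, PowerSeries.coeff_C]
  split_ifs <;> simp

theorem ofCoeff_mem_cochains {χ : (Fin n →₀ ℕ) → (Fin k → Smooth n) → Smooth n}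
    (hχ : ∀ α, IsRegular t Set.univ (χ α)) : ofCoeff χ ∈ cochains t n k := by
  refine (mem_cochains_iff _).2 fun r α => ?_
  simp only [coeffW_ofCoeff]
  split_ifs
  · exact hχ α
  · exact .zero t _

theorem coeffW_X_smul (r : ℕ) (α : Fin n →₀ ℕ) (a : W n) :
    coeffW (r + 1) α ((PowerSeries.X : PowerSeries ℂ) • a) = coeffW r α a := by
  rw [coeffW_apply, coeff_smul', Finset.sum_eq_single (1, r)]
  · simp [coeffW_apply]
  · rintro ⟨s, r'⟩ hs hne
    rw [PowerSeries.coeff_X, if_neg, zero_smul]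
    rintro rfl
    have : 1 + r' = r + 1 := by simpa using hs
    exact hne (by rw [show r' = r by omega])
  · simp [add_comm]

theorem coeffW_zero_X_smul (α : Fin n →₀ ℕ) (a : W n) :
    coeffW 0 α ((PowerSeries.X : PowerSeries ℂ) • a) = 0 := by
  rw [coeffW_apply, coeff_smul']
  simp

theorem X_smul_injective : Function.Injective fun a : W n => (PowerSeries.X : PowerSeries ℂ) • a :=
  fun a b h => W_ext fun r α => by
    rw [← coeffW_X_smul r α a, ← coeffW_X_smul r α b]
    exact congrArg (coeffW (r + 1) α) h

/-- A cochain whose classical limit vanishes is divisible by `λ`. -/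
theorem exists_eq_X_smul {φ : (Fin k → Smooth n) → W n} (hφ : φ ∈ cochains t n k)
    (h : ∀ f α, coeffW 0 α (φ f) = 0) :
    ∃ ψ ∈ cochains t n k, φ = (PowerSeries.X : PowerSeries ℂ) • ψ := by
  refine ⟨fun f => PowerSeries.mk fun r => PowerSeries.coeff (r + 1) (φ f), ?_, ?_⟩
  · refine (mem_cochains_iff _).2 fun r α => ?_
    convert (mem_cochains_iff φ).1 hφ (r + 1) α using 1
    funext f
    simp [coeffW_apply]
  · funext f
    refine W_ext fun r α => ?_
    rw [Pi.smul_apply]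
    cases r with
    | zero => rw [h, coeffW_zero_X_smul]
    | succ r =>
      rw [coeffW_X_smul]
      simp [coeffW_apply]

/-- A cocycle whose classical limit vanishes is divisible by `λ` as a cocycle. -/
theorem exists_cocycle_eq_X_smul {φ : (Fin k → Smooth n) → W n} (hφ : φ ∈ cocycles t n k)
    (h : ∀ f α, coeffW 0 α (φ f) = 0) :
    ∃ ψ ∈ cocycles t n k, φ = (PowerSeries.X : PowerSeries ℂ) • ψ := by
  obtain ⟨ψ, hψ, rfl⟩ := exists_eq_X_smul hφ.1 h
  refine ⟨ψ, ⟨hψ, ?_⟩, rfl⟩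
  -- From `λ δψ = 0` follows `δψ = 0`, because `𝓦` has no `λ`-torsion.
  have h2 := hφ.2
  rw [SetLike.mem_coe, LinearMap.mem_ker, map_smul] at h2
  rw [SetLike.mem_coe, LinearMap.mem_ker]
  funext f
  refine X_smul_injective ?_
  have := congrFun h2 f
  simpa using this

theorem delta_mem_cocycles {φ : (Fin k → Smooth n) → W n} (hφ : φ ∈ cochains t n k) :
    delta n k φ ∈ cocycles t n (k + 1) :=
  ⟨delta_mem_cochains hφ, delta_delta k φ⟩

end Cochains

/-! ### Forms and the Poincaré lemma -/

section FormsP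

variable {n k : ℕ} {t : CochainType}

theorem Forms_ext {η θ : Forms n k} (h : ∀ i : Fin k → Fin n,
    (η fun j => Pi.single (i j) 1) = θ fun j => Pi.single (i j) 1) : η = θ := by
  refine (Pi.basisFun ℂ (Fin n)).ext_alternating fun v _ => ?_
  simpa using h v

theorem extDerivP_single (η : Forms n k) (I : Fin (k + 1) → Fin n) :
    (extDerivP η fun j => Pi.single (I j) 1) = ∑ j : Fin (k + 1), (-1 : ℤ) ^ (j : ℕ) •
      dP (I j) (η fun l => Pi.single (I (j.succAbove l)) 1) := by
  rw [extDerivP_apply]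
  refine Finset.sum_congr rfl fun j _ => ?_
  rw [Finset.sum_eq_single (I j)]
  · rw [Pi.single_eq_same, one_smul]
    rfl
  · intro i _ hi
    rw [Pi.single_eq_of_ne hi, zero_smul]
  · simp

theorem extDerivP_smul (c : ℂ) (η : Forms n k) : extDerivP (c • η) = c • extDerivP η := by
  refine Forms_ext fun I => ?_
  simp only [extDerivP_single, AlternatingMap.smul_apply, map_smul, Finset.smul_sum]
  exact Finset.sum_congr rfl fun j _ => smul_comm _ _ _

/-- Division of the coefficient of `p^α` by `|α| + c`. -/
def eulerInv (c : ℕ) : Module.End ℂ (W₀ n) where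
  toFun a := seriesOf fun α => ((α.degree + c : ℕ) : ℂ)⁻¹ • MvPowerSeries.coeff α a
  map_add' a b := by
    ext1 α
    rw [map_add]
    simp only [coeff_seriesOf, map_add, smul_add]
  map_smul' d a := by
    ext1 α
    exact smul_comm _ d (MvPowerSeries.coeff α a)

theorem coeff_eulerInv (c : ℕ) (a : W₀ n) (α : Fin n →₀ ℕ) :
    MvPowerSeries.coeff α (eulerInv c a) =
      ((α.degree + c : ℕ) : ℂ)⁻¹ • MvPowerSeries.coeff α a := rfl

/-- `∂_{p_i}` lowers the degree by one, so the offset has to rise by one. -/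
theorem dP_eulerInv (c : ℕ) (i : Fin n) (a : W₀ n) :
    dP i (eulerInv c a) = eulerInv (c + 1) (dP i a) := by
  ext1 α
  rw [coeff_dP, coeff_eulerInv, coeff_eulerInv, coeff_dP, smul_comm, map_add,
    Finsupp.degree_single, add_assoc, add_comm 1 c]

theorem coeff_X_mul_dP (i : Fin n) (a : W₀ n) (α : Fin n →₀ ℕ) :
    MvPowerSeries.coeff α (MvPowerSeries.X i * dP i a) = (α i : ℂ) • MvPowerSeries.coeff α a := by
  classical
  rw [MvPowerSeries.X, MvPowerSeries.coeff_monomial_mul]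
  split_ifs with h
  · have h1 : 1 ≤ α i := by simpa using h i
    rw [one_mul, coeff_dP, tsub_add_cancel_of_le h]
    congr 2
    simp [h1]
  · have h1 : α i = 0 := by
      by_contra h0
      exact h (Finsupp.single_le_iff.2 (Nat.one_le_iff_ne_zero.2 h0))
    simp [h1]

/-- Euler's identity: `∑ p_i ∂_{p_i}` multiplies `p^α` by `|α|`. The offset `c + 1` keeps the
denominators nonzero even at `α = 0`. -/
theorem sum_X_mul_dP_eulerInv (c : ℕ) (a : W₀ n) :
    ∑ i, MvPowerSeries.X i * dP i (eulerInv (c + 1) a) + ((c + 1 : ℕ) : ℂ) • eulerInv (c + 1) a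
      = a := by
  ext1 α
  have h : ((α.degree + (c + 1) : ℕ) : ℂ) ≠ 0 := Nat.cast_ne_zero.2 (by omega)
  have h2 : ∀ (d : ℂ) (b : W₀ n), MvPowerSeries.coeff α (d • b) = d • MvPowerSeries.coeff α b :=
    fun _ _ => rfl
  rw [map_add, map_sum, h2]
  simp only [coeff_X_mul_dP]
  rw [← Finset.sum_smul, ← add_smul, coeff_eulerInv, smul_smul]
  have h3 : (∑ i, (α i : ℂ)) + ((c + 1 : ℕ) : ℂ) = ((α.degree + (c + 1) : ℕ) : ℂ) := by
    rw [Finsupp.degree_eq_sum]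
    push_cast
    rfl
  rw [h3, mul_inv_cancel₀ h, one_smul]

theorem dP_X_mul (i j : Fin n) (a : W₀ n) :
    dP i (MvPowerSeries.X j * a) = (if i = j then a else 0) + MvPowerSeries.X j * dP i a := by
  change MvPowerSeries.pderiv (Smooth n) i _ = _ + _ * MvPowerSeries.pderiv (Smooth n) i a
  rw [Derivation.leibniz, MvPowerSeries.pderiv_X, add_comm]
  simp only [smul_eq_mul]
  congr 1
  rcases eq_or_ne i j with rfl | h
  · simp
  · simp [h, h.symm]

/-- The homotopy operator for `d_p`. -/
def homotopyP (η : Forms n (k + 1)) : Forms n k :=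
  ∑ i, (LinearMap.mulLeft ℂ (MvPowerSeries.X i) * eulerInv (k + 1)).compAlternatingMap
    (η.curryLeft (Pi.single i 1))

theorem homotopyP_apply (η : Forms n (k + 1)) (v : Fin k → Fin n → ℂ) :
    homotopyP η v = ∑ i, MvPowerSeries.X i *
      eulerInv (k + 1) (η (Matrix.vecCons (Pi.single i 1) v)) := by
  exact map_sum (⟨⟨fun θ => θ v, rfl⟩, fun _ _ => rfl⟩ : Forms n k →+ W₀ n) _ _

/-- The Poincaré lemma for `d_p`. -/
theorem extDerivP_homotopyP {η : Forms n (k + 1)} (hη : extDerivP η = 0) :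
    extDerivP (homotopyP η) = η := by
  refine Forms_ext fun I => ?_
  -- Closedness evaluated on `(e_i, e_{I_0}, …, e_{I_k})`, solved for the term that differentiates
  -- along `e_i`.
  have hcl : ∀ i, dP i (η fun j => Pi.single (I j) 1) = ∑ j : Fin (k + 1), (-1 : ℤ) ^ (j : ℕ) •
      dP (I j) (η (Matrix.vecCons (Pi.single i 1)
        fun l => Pi.single (I (j.succAbove l)) 1)) := fun i => by
    have h := congrArg (fun θ : Forms n (k + 2) =>
      θ fun j => Pi.single ((Matrix.vecCons i I : Fin (k + 2) → Fin n) j) 1) hη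
    rw [extDerivP_single, Fin.sum_univ_succ] at h
    simp only [Fin.val_zero, pow_zero, one_smul, Matrix.cons_val_zero, Fin.zero_succAbove,
      Matrix.cons_val_succ, Fin.val_succ, pow_succ, mul_neg_one, neg_smul, Finset.sum_neg_distrib,
      AlternatingMap.zero_apply] at h
    rw [← sub_eq_add_neg, sub_eq_zero] at h
    rw [h]
    refine Finset.sum_congr rfl fun j _ => ?_
    congr 3
    funext l
    refine Fin.cases ?_ (fun l => ?_) l
    · simp
    · simp
  have hins : ∀ j : Fin (k + 1), (-1 : ℤ) ^ (j : ℕ) •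
      η (Matrix.vecCons (Pi.single (I j) 1) fun l => Pi.single (I (j.succAbove l)) 1) =
      η fun j => Pi.single (I j) 1 := fun j => by
    have h1 := η.map_insertNth j (Pi.single (I j) 1) fun l => Pi.single (I (j.succAbove l)) 1
    have h2 : j.insertNth (α := fun _ => Fin n → ℂ) (Pi.single (I j) 1)
        (fun l => Pi.single (I (j.succAbove l)) 1) = fun j => Pi.single (I j) 1 :=
      Fin.insertNth_self_removeNth j (fun j => (Pi.single (I j) 1 : Fin n → ℂ))
    rw [h2] at h1
    rw [h1]
  rw [extDerivP_single]
  simp only [homotopyP_apply, map_sum, dP_X_mul, Finset.smul_sum, smul_add,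
    Finset.sum_add_distrib, Finset.sum_ite_eq, Finset.mem_univ, if_true]
  have h1 : ∀ j : Fin (k + 1), (-1 : ℤ) ^ (j : ℕ) • eulerInv (k + 1)
      (η (Matrix.vecCons (Pi.single (I j) 1) fun l => Pi.single (I (j.succAbove l)) 1)) =
      eulerInv (k + 1) (η fun j => Pi.single (I j) 1) := fun j => by
    rw [← map_zsmul, hins]
  simp only [h1]
  rw [Finset.sum_comm]
  have h2 : ∀ i : Fin n, ∑ j : Fin (k + 1), (-1 : ℤ) ^ (j : ℕ) • (MvPowerSeries.X i *
      dP (I j) (eulerInv (k + 1) (η (Matrix.vecCons (Pi.single i 1)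
        fun l => Pi.single (I (j.succAbove l)) 1)))) =
      MvPowerSeries.X i * dP i (eulerInv (k + 1) (η fun j => Pi.single (I j) 1)) := fun i => by
    rw [dP_eulerInv, hcl, map_sum, Finset.mul_sum]
    refine Finset.sum_congr rfl fun j _ => ?_
    rw [dP_eulerInv, map_zsmul, mul_smul_comm]
  simp only [h2]
  rw [add_comm]
  -- The `k + 1` terms in which a derivative hits the factor `p_i` supply exactly the offset in
  -- Euler's identity.
  conv_rhs => rw [← sum_X_mul_dP_eulerInv k (η fun j => Pi.single (I j) 1)]
  rw [Finset.sum_const, Finset.card_univ, Fintype.card_fin, Nat.cast_smul_eq_nsmul]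

end FormsP

/-! ### The form of a cochain -/

section FormOfCochain

variable {n k : ℕ} {t : CochainType}

/-- The permutation which maps `0` to `j` and is given by `τ` on the other elements. -/
def insertPerm (j : Fin (k + 1)) (τ : Equiv.Perm (Fin k)) : Equiv.Perm (Fin (k + 1)) :=
  (Fin.cycleRange j)⁻¹ * Equiv.Perm.decomposeFin.symm (0, τ)

theorem insertPerm_zero (j : Fin (k + 1)) (τ : Equiv.Perm (Fin k)) : insertPerm j τ 0 = j := by
  rw [insertPerm, Equiv.Perm.mul_apply, Equiv.Perm.decomposeFin_symm_apply_zero]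
  exact Fin.cycleRange_symm_zero j

theorem insertPerm_succ (j : Fin (k + 1)) (τ : Equiv.Perm (Fin k)) (l : Fin k) :
    insertPerm j τ l.succ = j.succAbove (τ l) := by
  rw [insertPerm, Equiv.Perm.mul_apply, Equiv.Perm.decomposeFin_symm_apply_succ, Equiv.swap_self]
  exact Fin.cycleRange_symm_succ j (τ l)

theorem sign_insertPerm (j : Fin (k + 1)) (τ : Equiv.Perm (Fin k)) :
    (Equiv.Perm.sign (insertPerm j τ) : ℤ) = (-1) ^ (j : ℕ) * Equiv.Perm.sign τ := by
  rw [insertPerm, Equiv.Perm.sign_mul, Equiv.Perm.sign_inv, Fin.sign_cycleRange,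
    Equiv.Perm.decomposeFin.symm_sign]
  simp

/-- Sorting permutations by the image of `0` matches the alternating sum over the omitted index in
`d_p`. -/
theorem sum_perm_eq_sum_insertPerm {M : Type*} [AddCommMonoid M]
    (F : Equiv.Perm (Fin (k + 1)) → M) :
    ∑ σ, F σ = ∑ j, ∑ τ : Equiv.Perm (Fin k), F (insertPerm j τ) := by
  have hinj : Function.Injective fun x : Fin (k + 1) × Equiv.Perm (Fin k) =>
      insertPerm x.1 x.2 := by
    rintro ⟨j, τ⟩ ⟨j', τ'⟩ h
    dsimp only at h
    obtain rfl : j = j' := by rw [← insertPerm_zero j τ, h, insertPerm_zero]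
    refine Prod.ext rfl (Equiv.ext fun l => Fin.succAbove_right_injective (p := j) ?_)
    rw [← insertPerm_succ, h, insertPerm_succ]
  have hbij : Function.Bijective fun x : Fin (k + 1) × Equiv.Perm (Fin k) =>
      insertPerm x.1 x.2 :=
    (Fintype.bijective_iff_injective_and_card _).2 ⟨hinj, by
      rw [Fintype.card_prod, Fintype.card_perm, Fintype.card_perm, Fintype.card_fin,
        Fintype.card_fin, Nat.factorial_succ]⟩
  rw [← hbij.sum_comp, Fintype.sum_prod_type]

theorem cl_eq (a : W n) : cl a = PowerSeries.coeff 0 a :=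
  (PowerSeries.coeff_zero_eq_constantCoeff_apply a).symm

theorem factorial_smul_altCl (φ : (Fin k → Smooth n) → W n) (f : Fin k → Smooth n) :
    (k.factorial : ℂ) • altCl φ f =
      ∑ σ : Equiv.Perm (Fin k), (Equiv.Perm.sign σ : ℤ) • cl (φ (f ∘ σ)) := by
  rw [altCl, smul_smul, mul_inv_cancel₀ (Nat.cast_ne_zero.2 k.factorial_ne_zero), one_smul]

theorem sum_sign_delta_coord (ψ : (Fin k → Smooth n) → W n) (I : Fin (k + 1) → Fin n) :
    ∑ σ : Equiv.Perm (Fin (k + 1)), (Equiv.Perm.sign σ : ℤ) •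
        delta n k ψ ((fun j => coord (I j)) ∘ σ) =
      ∑ σ : Equiv.Perm (Fin (k + 1)), (Equiv.Perm.sign σ : ℤ) •
        (starL (coord (I (σ 0))) (ψ fun l => coord (I (σ l.succ))) -
          starR (coord (I (σ 0))) (ψ fun l => coord (I (σ l.succ)))) := by
  rw [delta_eq_hochschild]
  exact sum_sign_hochschild _ _ k ψ _

/-- Only commutators survive the alternation, and these are divisible by `λ`. -/
theorem altCl_delta_coord (ψ : (Fin k → Smooth n) → W n) (I : Fin (k + 1) → Fin n) :
    altCl (delta n k ψ) (fun j => coord (I j)) = 0 := by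
  have h := congrArg (PowerSeries.coeff 0) (sum_sign_delta_coord ψ I)
  simp only [map_sum, map_zsmul, coeff_zero_starL_sub_starR, smul_zero, Finset.sum_const_zero] at h
  simp only [altCl, cl_eq, h, smul_zero]

/-- The index in first position is differentiated by the commutator, which gives the factor `i`.
Alternating over the remaining `k` indices gives `k!` times the form of `ψ`. -/
theorem coeff_one_sum_sign_delta_coord (ψ : (Fin k → Smooth n) → W n) (I : Fin (k + 1) → Fin n) :
    ∑ σ : Equiv.Perm (Fin (k + 1)), (Equiv.Perm.sign σ : ℤ) •
        PowerSeries.coeff 1 (delta n k ψ ((fun j => coord (I j)) ∘ σ)) =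
      (Complex.I * k.factorial) • ∑ j : Fin (k + 1), (-1 : ℤ) ^ (j : ℕ) •
        dP (I j) (altCl ψ fun l => coord (I (j.succAbove l))) := by
  have h := congrArg (PowerSeries.coeff 1) (sum_sign_delta_coord ψ I)
  simp only [map_sum, map_zsmul, coeff_succ_starL_sub_starR] at h
  rw [h, sum_perm_eq_sum_insertPerm, Finset.smul_sum]
  refine Finset.sum_congr rfl fun j _ => ?_
  rw [mul_smul, smul_comm (k.factorial : ℂ), ← map_smul, factorial_smul_altCl, map_sum,
    Finset.smul_sum, Finset.smul_sum]
  refine Finset.sum_congr rfl fun τ _ => ?_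
  simp only [insertPerm_zero, insertPerm_succ, sign_insertPerm, map_zsmul, cl_eq]
  rw [mul_smul, smul_comm Complex.I, smul_comm Complex.I]
  rfl

/-- The linear map sending the standard basis to the coordinate functions. -/
def linCoord (n : ℕ) : (Fin n → ℂ) →ₗ[ℂ] Smooth n := Fintype.linearCombination ℂ coord

theorem linCoord_single (i : Fin n) : linCoord n (Pi.single i 1) = coord i := by
  rw [linCoord, Fintype.linearCombination_apply_single, one_smul]

/-- The classical limit as a linear map. -/
def clLin (n : ℕ) : W n →ₗ[ℂ] W₀ n where
  toFun := cl
  map_add' a b := by simp [cl]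
  map_smul' _ _ := rfl

/-- The form with the components `Alt (cl φ) (q^{i_1}, …, q^{i_k})`. -/
def altForm (φ : cochains t n k) : Forms n k :=
  (k.factorial : ℂ)⁻¹ • MultilinearMap.alternatization
    ((clLin n).compMultilinearMap (φ.2.1.choose.compLinearMap fun _ => linCoord n))

theorem altForm_single (φ : cochains t n k) (i : Fin k → Fin n) :
    (altForm φ fun j => Pi.single (i j) 1) = altCl φ.1 fun j => coord (i j) := by
  rw [altForm, altCl, AlternatingMap.smul_apply, MultilinearMap.alternatization_apply]
  congr 1
  refine Finset.sum_congr rfl fun σ _ => ?_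
  rw [Units.smul_def]
  congr 1
  change cl (φ.2.1.choose fun j => linCoord n (Pi.single (i (σ j)) 1)) = _
  simp only [linCoord_single, φ.2.1.choose_spec]
  rfl

/-- The form of `λ⁻¹ δψ` is a multiple of the exterior derivative of the form of `ψ`. -/
theorem altForm_of_delta_eq {ψ : cochains t n k} {φ : cochains t n (k + 1)}
    (h : delta n k ψ.1 = (PowerSeries.X : PowerSeries ℂ) • φ.1) :
    altForm φ = (Complex.I / (k + 1 : ℕ)) • extDerivP (altForm ψ) := by
  refine Forms_ext fun I => ?_
  have h1 := coeff_one_sum_sign_delta_coord ψ.1 I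
  have h2 : ∀ a : W n, PowerSeries.coeff 1 ((PowerSeries.X : PowerSeries ℂ) • a) = cl a :=
    fun a => MvPowerSeries.ext fun α => by
      rw [cl_eq]
      exact coeffW_X_smul 0 α a
  simp only [h, Pi.smul_apply, h2] at h1
  have h3 : ((k + 1).factorial : ℂ) ≠ 0 := Nat.cast_ne_zero.2 (Nat.factorial_ne_zero _)
  refine smul_right_injective _ h3 ?_
  dsimp only
  rw [altForm_single, factorial_smul_altCl, h1, AlternatingMap.smul_apply, extDerivP_single,
    smul_smul]
  simp only [altForm_single]
  congr 1
  rw [Nat.factorial_succ]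
  have h4 : ((k + 1 : ℕ) : ℂ) ≠ 0 := Nat.cast_ne_zero.2 k.succ_ne_zero
  push_cast at h4 ⊢
  field_simp

/-- A cocycle satisfies `δφ = λ · 0`, and the factor relating the two forms is nonzero. -/
theorem extDerivP_altForm {φ : cochains t n k} (hφ : delta n k φ.1 = 0) :
    extDerivP (altForm φ) = 0 := by
  have h1 := altForm_of_delta_eq (ψ := φ) (φ := (0 : cochains t n (k + 1))) (by simp [hφ])
  have h2 : altForm (0 : cochains t n (k + 1)) = 0 := Forms_ext fun I => by
    rw [altForm_single]
    simp [altCl, cl]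
  rw [h2] at h1
  refine (smul_eq_zero.1 h1.symm).resolve_left ?_
  exact div_ne_zero Complex.I_ne_zero (Nat.cast_ne_zero.2 k.succ_ne_zero)

end FormOfCochain

/-! ### The cohomology in positive degrees -/

section Cohomology

variable {n k : ℕ} {t : CochainType}

theorem altCl_add (φ ψ : (Fin k → Smooth n) → W n) (f : Fin k → Smooth n) :
    altCl (φ + ψ) f = altCl φ f + altCl ψ f := by
  simp only [altCl, cl, Pi.add_apply, map_add, smul_add, Finset.sum_add_distrib]

theorem cl_smul (c : PowerSeries ℂ) (a : W n) :
    cl (c • a) = PowerSeries.constantCoeff c • cl a := by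
  simp [cl_eq, coeff_smul']

theorem altCl_smul (c : PowerSeries ℂ) (φ : (Fin k → Smooth n) → W n) (f : Fin k → Smooth n) :
    altCl (c • φ) f = PowerSeries.constantCoeff c • altCl φ f := by
  simp only [altCl, Pi.smul_apply, cl_smul, smul_comm _ (PowerSeries.constantCoeff c),
    Finset.smul_sum]

/-- Every exact form is the form of a cocycle `λ⁻¹ δθ`. -/
theorem exists_cocycle_of_exact (t : CochainType) (ζ : Forms n k) :
    ∃ θ ∈ cochains t n k, ∃ φ ∈ cocycles t n (k + 1),
      delta n k θ = (PowerSeries.X : PowerSeries ℂ) • φ ∧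
      ∀ I : Fin (k + 1) → Fin n, altCl φ (fun j => coord (I j)) =
        extDerivP ζ fun j => Pi.single (I j) 1 := by
  -- The inverse of the factor `i/(k+1)` in `altForm_of_delta_eq`.
  let c : ℂ := ((k + 1 : ℕ) : ℂ) / Complex.I
  let χ : (Fin n →₀ ℕ) → (Fin k → Smooth n) → Smooth n := fun α =>
    ∑ J : Fin k → Fin n, fun f =>
      MvPowerSeries.coeff α ((c • ζ) fun j => Pi.single (J j) 1) * derivMonomial J f
  have hχ : ∀ α, IsRegular t Set.univ (χ α) := fun α =>
    IsRegular.sum _ fun J _ => (isRegular_derivMonomial J).mulLeft _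
  have hχδ : ∀ α, scalarDelta n k (χ α) = 0 := fun α => by
    funext f
    rw [scalarDelta, hochschild_sum]
    refine Finset.sum_eq_zero fun J _ => ?_
    have h := congrFun (scalarDelta_mul (MvPowerSeries.coeff α
      ((c • ζ) fun j => Pi.single (J j) 1)) (derivMonomial J)) f
    rw [scalarDelta_derivMonomial] at h
    rw [← scalarDelta, h]
    simp
  have hθ : ofCoeff χ ∈ cochains t n k := ofCoeff_mem_cochains hχ
  obtain ⟨φ, hφ, hδ⟩ := exists_cocycle_eq_X_smul (delta_mem_cocycles hθ) fun f α => by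
    rw [coeffW_zero_delta]
    simp only [coeffW_ofCoeff, if_true]
    exact congrFun (hχδ α) f
  refine ⟨ofCoeff χ, hθ, φ, hφ, hδ, fun I => ?_⟩
  have hcl : ∀ J : Fin k → Fin n, cl (ofCoeff χ fun j => coord (J j)) =
      (c • ζ) fun j => Pi.single (J j) 1 := fun J => MvPowerSeries.ext fun α => by
    have h := coeffW_ofCoeff χ (fun j => coord (J j)) 0 α
    rw [if_pos rfl, coeffW_apply, ← cl_eq] at h
    rw [h]
    simp only [χ, Finset.sum_apply]
    rw [Finset.sum_eq_single J]
    · rw [derivMonomial_coord, if_pos rfl, mul_one]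
    · intro J' _ hJ'
      rw [derivMonomial_coord, if_neg hJ', mul_zero]
    · simp
  -- The coefficients are already alternating, so all `k!` terms of the alternation agree.
  have hform : altForm (⟨ofCoeff χ, hθ⟩ : cochains t n k) = c • ζ := Forms_ext fun I => by
    have h0 : (k.factorial : ℂ) ≠ 0 := Nat.cast_ne_zero.2 k.factorial_ne_zero
    refine smul_right_injective _ h0 ?_
    dsimp only
    rw [altForm_single, factorial_smul_altCl]
    have h : ∀ σ : Equiv.Perm (Fin k), (Equiv.Perm.sign σ : ℤ) •
        cl (ofCoeff χ ((fun j => coord (I j)) ∘ σ)) = (c • ζ) fun j => Pi.single (I j) 1 :=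
      fun σ => by
        refine (congrArg _ (hcl (I ∘ σ))).trans ?_
        have h1 := (c • ζ).map_perm (fun j => Pi.single (I j) 1) σ
        refine (congrArg _ h1).trans ?_
        rw [Units.smul_def, smul_smul, ← Units.val_mul, Int.units_mul_self, Units.val_one, one_smul]
    simp only [h, Finset.sum_const, Finset.card_univ, Fintype.card_perm, Fintype.card_fin,
      Nat.cast_smul_eq_nsmul]
  have h1 := altForm_of_delta_eq (ψ := ⟨ofCoeff χ, hθ⟩) (φ := ⟨φ, hφ.1⟩) hδ
  rw [hform, extDerivP_smul, smul_smul] at h1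
  have h2 : Complex.I / ((k + 1 : ℕ) : ℂ) * c = 1 := by
    have h4 : ((k + 1 : ℕ) : ℂ) ≠ 0 := Nat.cast_ne_zero.2 k.succ_ne_zero
    have h5 := Complex.I_ne_zero
    simp only [c]
    field_simp
  rw [h2, one_smul] at h1
  rw [← h1, altForm_single]

/-- The cocycles whose form vanishes. -/
def altKer (t : CochainType) (n k : ℕ) : Set ((Fin k → Smooth n) → W n) :=
  {φ | φ ∈ cocycles t n k ∧ ∀ I : Fin k → Fin n, altCl φ (fun j => coord (I j)) = 0}

/-- HKR removes the classical limit. The obstruction to continuing is the form of the quotient by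
`λ`; it is closed, hence exact, and an exact form is realized by a cocycle `λ⁻¹ δθ`. -/
theorem exists_cohomologous_X_smul {φ : (Fin (k + 1) → Smooth n) → W n}
    (hφ : φ ∈ altKer t n (k + 1)) :
    ∃ ψ ∈ cochains t n k, ∃ φ' ∈ altKer t n (k + 1),
      φ = delta n k ψ + (PowerSeries.X : PowerSeries ℂ) • φ' := by
  have h1 : ∀ α, IsScalarCoboundary t (k + 1) fun f => coeffW 0 α (φ f) := fun α => by
    refine isScalarCoboundary_of_alternation_eq_zero ((mem_cochains_iff φ).1 hφ.1.1 0 α) ?_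
      fun J => ?_
    · funext f
      have h2 : delta n (k + 1) φ = 0 := hφ.1.2
      rw [← coeffW_zero_delta, h2]
      exact map_zero _
    · have h2 := factorial_smul_altCl φ fun j => coord (J j)
      rw [hφ.2, smul_zero] at h2
      have h3 := congrArg (MvPowerSeries.coeff α) h2
      simp only [map_sum, map_zsmul, map_zero, cl_eq] at h3
      exact h3.symm
  choose χ hχ hχφ using h1
  have hψ : ofCoeff χ ∈ cochains t n k := ofCoeff_mem_cochains hχ
  obtain ⟨φ₁, hφ₁, h₁⟩ := exists_cocycle_eq_X_smul (sub_mem hφ.1 (delta_mem_cocycles hψ))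
    fun f α => by
      rw [Pi.sub_apply, map_sub, coeffW_zero_delta, sub_eq_zero]
      simp only [coeffW_ofCoeff, if_true]
      exact congrFun (hχφ α) f
  have hcl := extDerivP_altForm (φ := ⟨φ₁, hφ₁.1⟩) hφ₁.2
  obtain ⟨θ, hθ, φ₂, hφ₂, h₂, hform⟩ := exists_cocycle_of_exact t
    (homotopyP (altForm (⟨φ₁, hφ₁.1⟩ : cochains t n (k + 1))))
  rw [extDerivP_homotopyP hcl] at hform
  -- Adding `θ` to the primitive changes the remainder by a cocycle with the same form, so the new
  -- remainder has form zero.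
  refine ⟨ofCoeff χ + θ, add_mem hψ hθ, φ₁ + (-1 : PowerSeries ℂ) • φ₂,
    ⟨add_mem hφ₁ (Submodule.smul_mem _ _ hφ₂), fun I => ?_⟩, ?_⟩
  · rw [altCl_add, altCl_smul, hform, altForm_single]
    simp
  · rw [map_add, h₂, smul_add, ← h₁, smul_comm]
    simp
    abel

/-! ### Summation of the `λ`-adic iteration -/

/-- The series `∑ λ^m ψ_m`. -/
def lambdaSum (ψ : ℕ → (Fin k → Smooth n) → W n) (f : Fin k → Smooth n) : W n :=
  PowerSeries.mk fun r => ∑ x ∈ Finset.HasAntidiagonal.antidiagonal r,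
    PowerSeries.coeff x.2 (ψ x.1 f)

theorem lambdaSum_mem_cochains {ψ : ℕ → (Fin k → Smooth n) → W n}
    (hψ : ∀ m, ψ m ∈ cochains t n k) : lambdaSum ψ ∈ cochains t n k := by
  refine (mem_cochains_iff _).2 fun r α => ?_
  have h := IsRegular.sum (Finset.HasAntidiagonal.antidiagonal r) fun x _ =>
    (mem_cochains_iff _).1 (hψ x.1) x.2 α
  convert h using 1
  funext f
  rw [Finset.sum_apply, coeffW_apply, lambdaSum, PowerSeries.coeff_mk, map_sum]
  rfl

theorem lambdaSum_eq (ψ : ℕ → (Fin k → Smooth n) → W n) :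
    lambdaSum ψ = ψ 0 + (PowerSeries.X : PowerSeries ℂ) • lambdaSum fun m => ψ (m + 1) := by
  funext f
  refine W_ext fun r α => ?_
  rw [Pi.add_apply, Pi.smul_apply, map_add]
  cases r with
  | zero =>
    rw [coeffW_zero_X_smul, add_zero]
    simp [lambdaSum, coeffW_apply]
  | succ r =>
    rw [coeffW_X_smul]
    simp only [lambdaSum, coeffW_apply, PowerSeries.coeff_mk, Finset.Nat.sum_antidiagonal_succ,
      map_add]

theorem mem_coboundaries_of_altKer {φ : (Fin (k + 1) → Smooth n) → W n}
    (hφ : φ ∈ altKer t n (k + 1)) : φ ∈ coboundaries t n (k + 1) := by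
  choose! ψ hψ φ' hφ' h using fun (φ : (Fin (k + 1) → Smooth n) → W n)
    (hφ : φ ∈ altKer t n (k + 1)) => exists_cohomologous_X_smul hφ
  -- The error for `φ` is `λ` times the error for its remainder. Induction on the order then kills
  -- every coefficient, for all `φ` at once.
  have hX : ∀ φ ∈ altKer t n (k + 1), φ - delta n k (lambdaSum fun m => ψ (φ'^[m] φ)) =
      (PowerSeries.X : PowerSeries ℂ) •
        (φ' φ - delta n k (lambdaSum fun m => ψ (φ'^[m] (φ' φ)))) := fun φ hφ => by
    rw [lambdaSum_eq, map_add, map_smul, smul_sub]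
    conv_lhs => enter [1]; rw [h φ hφ]
    simp only [Function.iterate_zero, id, Function.iterate_succ, Function.comp_apply]
    abel
  have key : ∀ (r : ℕ) (φ : (Fin (k + 1) → Smooth n) → W n), φ ∈ altKer t n (k + 1) →
      ∀ f α, coeffW r α ((φ - delta n k (lambdaSum fun m => ψ (φ'^[m] φ))) f) = 0 := by
    intro r
    induction r with
    | zero =>
      intro φ hφ f α
      rw [hX φ hφ, Pi.smul_apply, coeffW_zero_X_smul]
    | succ r ih =>
      intro φ hφ f α
      rw [hX φ hφ, Pi.smul_apply, coeffW_X_smul]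
      exact ih _ (hφ' φ hφ) f α
  have hmem : ∀ m, φ'^[m] φ ∈ altKer t n (k + 1) := fun m => by
    induction m with
    | zero => exact hφ
    | succ m ih =>
      rw [Function.iterate_succ_apply']
      exact hφ' _ ih
  refine ⟨lambdaSum fun m => ψ (φ'^[m] φ), lambdaSum_mem_cochains fun m => hψ _ (hmem m), ?_⟩
  refine (sub_eq_zero.1 (funext fun f => W_ext fun r α => ?_)).symm
  rw [key r φ hφ f α]
  exact (map_zero _).symm

theorem mem_coboundaries_iff {φ : (Fin (k + 1) → Smooth n) → W n}
    (hφ : φ ∈ cocycles t n (k + 1)) : φ ∈ coboundaries t n (k + 1) ↔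
      ∀ I : Fin (k + 1) → Fin n, altCl φ (fun j => coord (I j)) = 0 := by
  refine ⟨?_, fun h => mem_coboundaries_of_altKer ⟨hφ, h⟩⟩
  rintro ⟨ψ, _, rfl⟩ I
  exact altCl_delta_coord ψ I

theorem ClosedForms.ext {η θ : ClosedForms n k} (h : ∀ i, η.component i = θ.component i) : η = θ :=
  Subtype.ext (Forms_ext h)

theorem ClosedForms.component_add (η θ : ClosedForms n k) (i : Fin k → Fin n) :
    (η + θ).component i = η.component i + θ.component i := rfl

theorem ClosedForms.component_smul (c : PowerSeries ℂ) (η : ClosedForms n k) (i : Fin k → Fin n) :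
    (c • η).component i = PowerSeries.constantCoeff c • η.component i := rfl

/-- The closed form of a cocycle. -/
def closedForm (φ : cocycles t n k) : ClosedForms n k :=
  (⟨altForm (⟨φ.1, φ.2.1⟩ : cochains t n k), extDerivP_altForm φ.2.2⟩ : ↥(closedSubmodule n k))

theorem component_closedForm (φ : cocycles t n k) (i : Fin k → Fin n) :
    (closedForm φ).component i = altCl φ.1 fun j => coord (i j) :=
  altForm_single (⟨φ.1, φ.2.1⟩ : cochains t n k) i

/-- The closed form of a cocycle, as a linear map. -/
def cocycleForm (t : CochainType) (n k : ℕ) :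
    cocycles t n k →ₗ[PowerSeries ℂ] ClosedForms n k where
  toFun := closedForm
  map_add' φ ψ := ClosedForms.ext fun i => by
    rw [ClosedForms.component_add]
    simp only [component_closedForm]
    exact altCl_add φ.1 ψ.1 _
  map_smul' c φ := ClosedForms.ext fun i => by
    rw [RingHom.id_apply, ClosedForms.component_smul]
    simp only [component_closedForm]
    exact altCl_smul c φ.1 _

theorem component_cocycleForm (φ : cocycles t n k) (i : Fin k → Fin n) :
    (cocycleForm t n k φ).component i = altCl φ.1 fun j => coord (i j) :=
  component_closedForm φ i

theorem ker_cocycleForm : LinearMap.ker (cocycleForm t n (k + 1)) =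
    (coboundaries t n (k + 1)).submoduleOf (cocycles t n (k + 1)) := by
  ext φ
  change _ ↔ φ.1 ∈ coboundaries t n (k + 1)
  rw [mem_coboundaries_iff φ.2, LinearMap.mem_ker]
  constructor
  · intro h I
    rw [← component_cocycleForm, h]
    rfl
  · intro h
    refine ClosedForms.ext fun I => ?_
    rw [component_cocycleForm]
    exact h I

/-- In positive degree every closed form is exact, and exact forms are realized by
`exists_cocycle_of_exact`. -/
theorem cocycleForm_surjective : Function.Surjective (cocycleForm t n (k + 1)) := fun η => by
  obtain ⟨-, -, φ, hφ, -, h⟩ := exists_cocycle_of_exact t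
    (homotopyP (η : ↥(closedSubmodule n (k + 1))).1)
  rw [extDerivP_homotopyP (η : ↥(closedSubmodule n (k + 1))).2] at h
  refine ⟨⟨φ, hφ⟩, ClosedForms.ext fun I => ?_⟩
  rw [component_cocycleForm]
  exact h I

/-- The isomorphism of the cohomology in degree `k + 1` with the closed forms. -/
def cohomologyEquiv (t : CochainType) (n k : ℕ) :
    HH t n (k + 1) ≃ₗ[PowerSeries ℂ] ClosedForms n (k + 1) :=
  (Submodule.quotEquivOfEq _ _ ker_cocycleForm.symm).trans
    ((cocycleForm t n (k + 1)).quotKerEquivOfSurjective cocycleForm_surjective)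

/-! ### The cohomology in degree zero -/

/-- If `α i ≠ 0`, then `p_i ∂_{p_i}` multiplies the coefficient of `p^α` by a nonzero number. -/
theorem C_of_dP_eq_zero {a : W₀ n} (h : ∀ i, dP i a = 0) :
    a = MvPowerSeries.C (MvPowerSeries.constantCoeff a) := by
  classical
  ext1 α
  rw [MvPowerSeries.coeff_C]
  split_ifs with hα
  · rw [hα, MvPowerSeries.coeff_zero_eq_constantCoeff_apply]
  · obtain ⟨i, hi⟩ : ∃ i, α i ≠ 0 := by
      by_contra! h0
      exact hα (Finsupp.ext h0)
    have h1 := coeff_X_mul_dP i a α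
    rw [h, mul_zero, map_zero] at h1
    exact (smul_eq_zero.1 h1.symm).resolve_left (Nat.cast_ne_zero.2 hi)

theorem moyal_succ_C (s : ℕ) (f g : Smooth n) : moyal (s + 1) f (MvPowerSeries.C g) = 0 := by
  simp [moyal, dP_C]

theorem starL_piStar (f : Smooth n) (b : PowerSeries (Smooth n)) :
    starL f (piStar n b) = starR f (piStar n b) := by
  ext1 r
  rw [starL, starR, coeff_opAct, coeff_opAct]
  refine Finset.sum_congr rfl fun x _ => ?_
  rw [piStar, PowerSeries.coeff_map, starOp, starOp, PowerSeries.coeff_mk, PowerSeries.coeff_mk]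
  cases x.1 with
  | zero => simp
  | succ s => simp [moyal_succ_C]

theorem delta_zero_apply (φ : (Fin 0 → Smooth n) → W n) (f : Fin 1 → Smooth n) :
    delta n 0 φ f = starL (f 0) (φ ![]) - starR (f 0) (φ ![]) := by
  rw [delta_eq_hochschild, hochschild, rho]
  congr 3
  exact Subsingleton.elim _ _

/-- Commuting with the coordinate functions already forces every coefficient of `λ^r` to be
independent of `p`. -/
theorem eq_piStar_of_cocycle {φ : (Fin 0 → Smooth n) → W n} (hφ : φ ∈ cocycles t n 0) :
    φ ![] = piStar n (PowerSeries.map MvPowerSeries.constantCoeff (φ ![])) := by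
  have h : delta n 0 φ = 0 := hφ.2
  ext1 r
  rw [piStar, PowerSeries.coeff_map, PowerSeries.coeff_map]
  refine C_of_dP_eq_zero fun i => ?_
  have h1 := congrFun h fun _ => coord i
  rw [delta_zero_apply] at h1
  have h2 := coeff_succ_starL_sub_starR i (φ ![]) r
  rw [h1, Pi.zero_apply, map_zero] at h2
  exact (smul_eq_zero.1 h2.symm).resolve_left Complex.I_ne_zero

theorem const_piStar_mem_cocycles (t : CochainType) (b : PowerSeries (Smooth n)) :
    (fun _ => piStar n b : (Fin 0 → Smooth n) → W n) ∈ cocycles t n 0 := by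
  refine ⟨(mem_cochains_iff _).2 fun r α => ?_, ?_⟩
  · exact (IsRegular.const t _).congr_set (Subsingleton.elim _ _)
  · refine LinearMap.mem_ker.2 (funext fun f => ?_)
    rw [delta_zero_apply, starL_piStar, sub_self]
    rfl

/-- The series of a cocycle of degree zero. -/
def cocycleSeries (t : CochainType) (n : ℕ) :
    cocycles t n 0 →ₗ[PowerSeries ℂ] PowerSeries (Smooth n) where
  toFun φ := PowerSeries.map MvPowerSeries.constantCoeff (φ.1 ![])
  map_add' φ ψ := map_add _ _ _
  map_smul' c φ := by
    ext1 r
    rw [RingHom.id_apply, Algebra.smul_def, PowerSeries.coeff_mul, PowerSeries.coeff_map]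
    change MvPowerSeries.constantCoeff (PowerSeries.coeff r (c • φ.1 ![])) = _
    rw [coeff_smul', map_sum]
    refine Finset.sum_congr rfl fun x _ => ?_
    exact Algebra.smul_def (PowerSeries.coeff x.1 c)
      (MvPowerSeries.constantCoeff (PowerSeries.coeff x.2 (φ.1 ![])))

theorem piStar_cocycleSeries (φ : cocycles t n 0) : piStar n (cocycleSeries t n φ) = φ.1 ![] :=
  (eq_piStar_of_cocycle φ.2).symm

theorem cocycleSeries_bijective : Function.Bijective (cocycleSeries t n) := by
  refine ⟨fun φ ψ h => Subtype.ext (funext fun f => ?_), fun b => ?_⟩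
  · rw [Subsingleton.elim f ![], ← piStar_cocycleSeries, h, piStar_cocycleSeries]
  · refine ⟨⟨_, const_piStar_mem_cocycles t b⟩, ?_⟩
    ext1 r
    change PowerSeries.coeff r (PowerSeries.map MvPowerSeries.constantCoeff (piStar n b)) = _
    rw [PowerSeries.coeff_map, piStar, PowerSeries.coeff_map, MvPowerSeries.constantCoeff_C]

/-- The isomorphism of the cohomology in degree zero with `C^∞(ℝⁿ)[[λ]]`. -/
def cohomologyZeroEquiv (t : CochainType) (n : ℕ) :
    HH t n 0 ≃ₗ[PowerSeries ℂ] PowerSeries (Smooth n) :=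
  (Submodule.quotEquivOfEqBot _ (by
    ext φ
    change φ.1 ∈ (⊥ : Submodule (PowerSeries ℂ) ((Fin 0 → Smooth n) → W n)) ↔ _
    rw [Submodule.mem_bot, Submodule.mem_bot, ZeroMemClass.coe_eq_zero])).trans
    (LinearEquiv.ofBijective (cocycleSeries t n) cocycleSeries_bijective)

end Cohomology

end FormalWeyl

end

theorem mainTheorem3 (n : ℕ) (t : FormalWeyl.CochainType) :
    (∃ e : FormalWeyl.HH t n 0 ≃ₗ[PowerSeries ℂ] PowerSeries (FormalWeyl.Smooth n),
      ∀ φ : FormalWeyl.cocycles t n 0,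
        FormalWeyl.piStar n (e (FormalWeyl.HH.mk φ)) = φ.1 ![]) ∧
    (∀ k : ℕ, 1 ≤ k →
      ∃ e : FormalWeyl.HH t n k ≃ₗ[PowerSeries ℂ] FormalWeyl.ClosedForms n k,
        ∀ (φ : FormalWeyl.cocycles t n k) (i : Fin k → Fin n),
          (e (FormalWeyl.HH.mk φ)).component i =
            FormalWeyl.altCl φ.1 (fun j => FormalWeyl.coord (i j))) ∧
    (∀ k : ℕ, 1 ≤ k → ∀ φ ∈ FormalWeyl.cocycles t n k,
      (PowerSeries.X : PowerSeries ℂ) • φ ∈ FormalWeyl.coboundaries t n k) := by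
  refine ⟨⟨FormalWeyl.cohomologyZeroEquiv t n, FormalWeyl.piStar_cocycleSeries⟩,
    fun k hk => ?_, fun k hk φ hφ => ?_⟩
  · obtain ⟨k, rfl⟩ := Nat.exists_eq_add_of_le' hk
    exact ⟨FormalWeyl.cohomologyEquiv t n k, FormalWeyl.component_cocycleForm⟩
  · obtain ⟨k, rfl⟩ := Nat.exists_eq_add_of_le' hk
    -- The form depends on the classical limit only, and `λ` has constant term zero.
    refine (FormalWeyl.mem_coboundaries_iff (Submodule.smul_mem _ _ hφ)).2 fun I => ?_
    rw [FormalWeyl.altCl_smul, PowerSeries.constantCoeff_X, zero_smul]
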